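/- Let $\widehat{\mathfrak a}$ be the abelian complex Lie algebra with basis $e_{21}[n],e_{31}[n]$ $(n\in\mathbb Z)$, and put $e_{a}(z)=\sum_{n\in\mathbb Z}e_{a}[n]z^{-n-1}$ for $a\in\{21,31\}$. For non-negative integers $k,l_1,l_2$ with $l_1+l_2\le k$, let $X^k_{l_1,l_2}$ (the $\mathfrak{sl}_3$ small principal subspace) be the cyclic $\widehat{\mathfrak a}$-module with cyclic vector $v$ and defining relations $$e_{21}[n]v=e_{31}[n]v=0\ (n>0),\qquad e_{21}[0]^{l_1+1}v=0,\qquad e_{21}[0]^\alpha e_{31}[0]^\beta v=0\ (\alpha+\beta=l_1+l_2+1),$$ $$e_{21}(z)^\alpha e_{31}(z)^\beta=0 \text{ on } X^k_{l_1,l_2}\quad(\alpha+\beta=k+1).$$ It is graded by $\deg v=(0,0,0)$, $\deg e_{21}[n]=(1,0,-n)$, $\deg e_{31}[n]=(1,1,-n)$. Then $X^k_{l_1,l_2}$ is the direct sum of its homogeneous components $(X^k_{l_1,l_2})_{m_1,m_2,d}$, these are finite-dimensional, and its character $$\chi^k_{l_1,l_2}(z_1,z_2)=\sum_{m_1,m_2\ge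 0,\,d\in\mathbb Z}\dim (X^k_{l_1,l_2})_{m_1,m_2,d}\,z_1^{m_1}z_2^{m_2}q^d$$ is given by $$\chi^k_{l_1,l_2}(z_1,z_2)=\sum_{m\ge n\ge 0}\ \sum_{s=0}^{5}\frac{p_s(m,n)\,q^{a_s(m,n)}}{d_s(m,n)} .$$ Here, with $Q=k(m^2+n^2-mn)$, $(x)_N=\prod_{i=0}^{N-1}(1-xq^i)$, $(x)_\infty=\prod_{i\ge0}(1-xq^i)$ and $1/(q)_{-1}=0$, the numerators are $$\begin{array}{lll} s=0:& p_0=z_1^{km}z_2^{kn},& a_0=Q-ml_1-nl_2,\\ s=1:& p_1=z_1^{km+l_1}z_2^{kn},& a_1=Q+(m-n)l_1-nl_2,\\ s=2:& p_2=z_1^{km+l_1+l_2}z_2^{kn+l_2},& a_2=Q+(m-n)l_1+ml_2,\\ s=3:& p_3=z_1^{km+l_1+l_2}z_2^{kn+l_1+l_2},& a_3=Q+nl_1+ml_2,\\ s=4:& p_4=z_1^{km+l_1}z_2^{kn+l_1+l_2},& a_4=Q+nl_1+(n-m)l_2,\\ s=5:& p_5=z_1^{km}z_2^{kn+l_2},&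 a_5=Q-ml_1+(n-m)l_2, \end{array}$$ and the denominators are $$\begin{aligned} d_0={}&(q)_n(q)_{m-n}(z_1q^{2m-n})_\infty(z_1^{-1}q^{-2m+n+1})_{m-n}(z_1z_2q^{m+n})_\infty(z_1^{-1}z_2^{-1}q^{-m-n+1})_n(z_2q^{2n-m})_{m-n}(z_2^{-1}q^{-2n+m+1})_n,\\ d_1={}&(q)_n(q)_{m-n}(z_1q^{2m-n+1})_\infty(z_1^{-1}q^{-2m+n})_{m-n+1}(z_1z_2q^{m+n})_\infty(z_1^{-1}z_2^{-1}q^{-m-n+1})_n(z_2q^{2n-m})_{m-n}(z_2^{-1}q^{-2n+m+1})_n,\\ d_2={}&(q)_n(q)_{m-n}(z_1q^{2m-n+1})_\infty(z_1^{-1}q^{-2m+n})_{m-n}(z_1z_2q^{m+n+1})_\infty(z_1^{-1}z_2^{-1}q^{-m-n})_{n+1}(z_2q^{2n-m})_{m-n+1}(z_2^{-1}q^{-2n+m+1})_n,\\ d_3={}&(q)_n(q)_{m-n}(z_1q^{2m-n+1})_\infty(z_1^{-1}q^{-2m+n})_{m-n}(z_1z_2q^{m+n+1})_\infty(z_1^{-1}z_2^{-1}q^{-m-n})_{n+1}(z_2q^{2n-m+1})_{m-n}(z_2^{-1}q^{-2n+m})_{n+1},\\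 d_4={}&(q)_n(q)_{m-n-1}(z_1q^{2m-n})_\infty(z_1^{-1}q^{-2m+n+1})_{m-n}(z_1z_2q^{m+n+1})_\infty(z_1^{-1}z_2^{-1}q^{-m-n})_{n+1}(z_2q^{2n-m+1})_{m-n}(z_2^{-1}q^{-2n+m})_{n+1},\\ d_5={}&(q)_n(q)_{m-n-1}(z_1q^{2m-n})_\infty(z_1^{-1}q^{-2m+n+1})_{m-n}(z_1z_2q^{m+n})_\infty(z_1^{-1}z_2^{-1}q^{-m-n+1})_n(z_2q^{2n-m+1})_{m-n}(z_2^{-1}q^{-2n+m})_{n+1}. \end{aligned}$$ Each term is expanded as a formal power series in $z_1,z_2$ whose coefficients are formal Laurent series in $q$: a factor $1/(1-x)$ with $x=z_1^iz_2^jq^c$, $(i,j)\ne(0,0)$, is expanded as $\sum_{\alpha\ge0}x^\alpha$ if $i,j\ge0$ and as $-x^{-1}\sum_{\alpha\ge0}x^{-\alpha}$ if $i,j\le0$. For each monomial $z_1^{m_1}z_2^{m_2}$ only finitely many triples $(m,n,s)$ contribute, so the sum is well defined, and the equality is one of formal series. -/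

import Mathlib

open scoped BigOperators

noncomputable section

namespace SmallPrincipal

/-! ### The module `X^k_{l₁,l₂}` over the abelian current algebra -/

/-- The two root vectors `e₂₁`, `e₃₁` of `sl₃`. -/
inductive Root : Type
  | e21 : Root
  | e31 : Root

/-- The universal enveloping algebra `U(â)` of the abelian Lie algebra `â` with basis
`e₂₁[n]`, `e₃₁[n]` (`n ∈ ℤ`): the polynomial algebra on these elements.  An `â`-module is the
same thing as a module over this algebra. -/
abbrev UA : Type := MvPolynomial (Root × ℤ) ℂ

/-- The element `e_a[n]` of `U(â)`. -/
def mode (a : Root) (n : ℤ) : UA := MvPolynomial.X (a, n)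

/-- The sequence of root vectors `e₂₁,…,e₂₁,e₃₁,…,e₃₁` (`α` times and `β` times). -/
def rootSeq (α β : ℕ) : Fin α ⊕ Fin β → Root :=
  Sum.elim (fun _ => Root.e21) (fun _ => Root.e31)

/-- The monomial `e₂₁[f₁]⋯e₂₁[f_α] e₃₁[f_{α+1}]⋯e₃₁[f_{α+β}]`. -/
def word {α β : ℕ} (f : Fin α ⊕ Fin β → ℤ) : UA := ∏ i, mode (rootSeq α β i) (f i)

/-- The relation `e₂₁(z)^α e₃₁(z)^β = 0` on a module `M`, where `e(z) = ∑ₙ e[n] z^{-n-1}`: for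
every total mode `N`, the corresponding coefficient, which is the sum of all monomials
`e₂₁[f₁]⋯e₃₁[f_{α+β}]` with `∑ fᵢ = N`, is locally finite on `M` and acts by zero. -/
def CurrentVanishes (α β : ℕ) (M : Type*) [AddCommGroup M] [Module UA M] : Prop :=
  ∀ (N : ℤ) (w : M),
    ({f : Fin α ⊕ Fin β → ℤ | ∑ i, f i = N} ∩ Function.support fun f => word f • w).Finite ∧
      ∑ᶠ f ∈ {f : Fin α ⊕ Fin β → ℤ | ∑ i, f i = N}, word f • w = 0

/-- The defining relations of `X^k_{l₁,l₂}`, for a vector `v` of a module `M`. -/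
structure Relations (k l₁ l₂ : ℕ) {M : Type*} [AddCommGroup M] [Module UA M] (v : M) : Prop where
  pos : ∀ (a : Root) (n : ℤ), 0 < n → mode a n • v = 0
  top : mode Root.e21 0 ^ (l₁ + 1) • v = 0
  mixed : ∀ α β : ℕ, α + β = l₁ + l₂ + 1 →
    (mode Root.e21 0 ^ α * mode Root.e31 0 ^ β) • v = 0
  current : ∀ α β : ℕ, α + β = k + 1 → CurrentVanishes α β M

/-- The annihilator of the cyclic vector of `X^k_{l₁,l₂}`: the smallest ideal of `U(â)` whose
cyclic quotient satisfies the defining relations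
(see `relations_smallPrincipal` and `relationIdeal_eq_span`). -/
def relationIdeal (k l₁ l₂ : ℕ) : Ideal UA :=
  sInf {J : Ideal UA | Relations k l₁ l₂ (Ideal.Quotient.mk J 1)}

/-- The small principal subspace `X^k_{l₁,l₂}`: the cyclic `â`-module given by the defining
relations; the cyclic vector is the class of `1`. -/
abbrev X (k l₁ l₂ : ℕ) : Type := UA ⧸ relationIdeal k l₁ l₂

/-- The degrees `deg e₂₁[n] = (1,0,-n)` and `deg e₃₁[n] = (1,1,-n)`. -/
def modeDegree : Root × ℤ → ℕ × ℕ × ℤ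
  | (Root.e21, n) => (1, 0, -n)
  | (Root.e31, n) => (1, 1, -n)

/-- The homogeneous component of `X^k_{l₁,l₂}` of degree `g = (m₁,m₂,d)`, the cyclic vector
having degree `(0,0,0)`: the image of the polynomials that are homogeneous of degree `g`. -/
def piece (k l₁ l₂ : ℕ) (g : ℕ × ℕ × ℤ) : Submodule ℂ (X k l₁ l₂) :=
  (MvPolynomial.weightedHomogeneousSubmodule ℂ modeDegree g).map
    (Ideal.Quotient.mkₐ ℂ (relationIdeal k l₁ l₂)).toLinearMap

/-- The coefficient of `z₁^m₁ z₂^m₂ q^d` in the character `χ^k_{l₁,l₂}(z₁,z₂)`. -/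
def charCoeff (k l₁ l₂ m₁ m₂ : ℕ) (d : ℤ) : ℕ := Module.finrank ℂ (piece k l₁ l₂ (m₁, m₂, d))

/-- For a vector killed by all positive modes only non-positive modes contribute to the
coefficient of a product of currents; this is the (finite) sum of these contributions. -/
def truncCoeff (α β N : ℕ) : UA :=
  ∑ f ∈ Finset.piAntidiag (Finset.univ : Finset (Fin α ⊕ Fin β)) N,
    word fun i => -(f i : ℤ)

/-- Explicit generators of `relationIdeal`. -/
def generators (k l₁ l₂ : ℕ) : Set UA :=
  {x | ∃ (a : Root) (n : ℤ), 0 < n ∧ x = mode a n} ∪ {mode Root.e21 0 ^ (l₁ + 1)} ∪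
    {x | ∃ α β : ℕ, α + β = l₁ + l₂ + 1 ∧ x = mode Root.e21 0 ^ α * mode Root.e31 0 ^ β} ∪
    {x | ∃ α β N : ℕ, α + β = k + 1 ∧ x = truncCoeff α β N}

theorem word_smul_eq_zero {M : Type*} [AddCommGroup M] [Module UA M] {w : M}
    (hw : ∀ (a : Root) (n : ℤ), 0 < n → mode a n • w = 0) {α β : ℕ} (f : Fin α ⊕ Fin β → ℤ)
    (i : Fin α ⊕ Fin β) (hi : 0 < f i) : word f • w = 0 := by
  classical
  rw [word, ← Finset.prod_erase_mul _ _ (Finset.mem_univ i), mul_smul, hw _ _ hi, smul_zero]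

theorem inter_support_subset {M : Type*} [AddCommGroup M] [Module UA M] {w : M}
    (hw : ∀ (a : Root) (n : ℤ), 0 < n → mode a n • w = 0) (α β : ℕ) (N : ℤ) :
    ({f : Fin α ⊕ Fin β → ℤ | ∑ i, f i = N} ∩ Function.support fun f => word f • w) ⊆
      {f | ∑ i, f i = N ∧ ∀ i, f i ≤ 0} := by
  rintro f ⟨hf, hs⟩
  refine ⟨hf, fun i => ?_⟩
  by_contra h
  exact hs (word_smul_eq_zero hw f i (not_le.mp h))

theorem nonpos_eq_image (α β n : ℕ) :
    {f : Fin α ⊕ Fin β → ℤ | ∑ i, f i = -(n : ℤ) ∧ ∀ i, f i ≤ 0} =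
      (fun (f : Fin α ⊕ Fin β → ℕ) i => -(f i : ℤ)) ''
        (Finset.piAntidiag (Finset.univ : Finset (Fin α ⊕ Fin β)) n : Set _) := by
  ext f
  simp only [Set.mem_ofPred_eq, Set.mem_image, Finset.mem_coe, Finset.mem_piAntidiag]
  constructor
  · rintro ⟨hs, hn⟩
    refine ⟨fun i => (-f i).toNat, ⟨?_, by simp⟩, ?_⟩
    · have : ((∑ i, (-f i).toNat : ℕ) : ℤ) = n := by
        rw [Nat.cast_sum, Finset.sum_congr rfl fun i _ =>
          Int.toNat_of_nonneg (by have := hn i; omega : (0 : ℤ) ≤ -f i),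
          Finset.sum_neg_distrib, hs, neg_neg]
      exact_mod_cast this
    · funext i
      have := hn i
      show -(((-f i).toNat : ℕ) : ℤ) = f i
      omega
  · rintro ⟨g, ⟨hg, -⟩, rfl⟩
    refine ⟨?_, fun i => by simp⟩
    rw [Finset.sum_neg_distrib, ← hg]
    push_cast
    rfl

theorem finite_inter_support {M : Type*} [AddCommGroup M] [Module UA M] {w : M}
    (hw : ∀ (a : Root) (n : ℤ), 0 < n → mode a n • w = 0) (α β : ℕ) (N : ℤ) :
    ({f : Fin α ⊕ Fin β → ℤ | ∑ i, f i = N} ∩ Function.support fun f => word f • w).Finite := by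
  refine Set.Finite.subset ?_ (inter_support_subset hw α β N)
  by_cases hN : N ≤ 0
  · obtain ⟨n, rfl⟩ : ∃ n : ℕ, N = -(n : ℤ) := ⟨(-N).toNat, by omega⟩
    rw [nonpos_eq_image]
    exact (Finset.finite_toSet _).image _
  · convert Set.finite_empty
    ext f
    simp only [Set.mem_ofPred_eq, Set.mem_empty_iff_false, iff_false, not_and]
    intro hs hn
    have := Finset.sum_nonpos fun i (_ : i ∈ Finset.univ) => hn i
    omega

theorem finsum_word_smul {M : Type*} [AddCommGroup M] [Module UA M] {w : M}
    (hw : ∀ (a : Root) (n : ℤ), 0 < n → mode a n • w = 0) (α β n : ℕ) :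
    ∑ᶠ f ∈ {f : Fin α ⊕ Fin β → ℤ | ∑ i, f i = -(n : ℤ)}, word f • w =
      truncCoeff α β n • w := by
  have hinj : Set.InjOn (fun (f : Fin α ⊕ Fin β → ℕ) i => -(f i : ℤ))
      (Finset.piAntidiag (Finset.univ : Finset (Fin α ⊕ Fin β)) n : Set _) := by
    intro f _ g _ h
    funext i
    have := congrFun h i
    simp only [neg_inj, Nat.cast_inj] at this
    exact this
  rw [truncCoeff, Finset.sum_smul, ← finsum_mem_coe_finset,
    ← finsum_mem_image (f := fun g => word g • w) hinj, ← nonpos_eq_image]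
  refine finsum_mem_inter_support_eq _ _ _ ?_
  ext f
  constructor
  · intro h
    exact ⟨inter_support_subset hw α β _ h, h.2⟩
  · rintro ⟨h1, h2⟩
    exact ⟨h1.1, h2⟩

theorem relations_iff_generators (k l₁ l₂ : ℕ) (J : Ideal UA) :
    Relations k l₁ l₂ (Ideal.Quotient.mk J 1) ↔ generators k l₁ l₂ ⊆ J := by
  have key : ∀ x : UA, x • (Ideal.Quotient.mk J 1) = 0 ↔ x ∈ J := by
    intro x
    rw [← Ideal.Quotient.eq_zero_iff_mem, ← Ideal.Quotient.mk_eq_mk, ← Ideal.Quotient.mk_eq_mk,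
      ← Submodule.Quotient.mk_smul, smul_eq_mul, mul_one]
  have key' : ∀ (x : UA), x ∈ J → ∀ w : UA ⧸ J, x • w = 0 := by
    intro x hx w
    obtain ⟨y, rfl⟩ := Ideal.Quotient.mk_surjective w
    rw [← Ideal.Quotient.mk_eq_mk, ← Submodule.Quotient.mk_smul, Ideal.Quotient.mk_eq_mk,
      Ideal.Quotient.eq_zero_iff_mem]
    exact J.mul_mem_right y hx
  constructor
  · intro h x hx
    rcases hx with ((⟨a, n, hn, rfl⟩ | rfl) | ⟨α, β, hab, rfl⟩) | ⟨α, β, N, hab, rfl⟩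
    · exact (key _).1 (h.pos a n hn)
    · exact (key _).1 h.top
    · exact (key _).1 (h.mixed α β hab)
    · refine (key _).1 ?_
      rw [← finsum_word_smul h.pos]
      exact (h.current α β hab _ _).2
  · intro h
    have hpos : ∀ (a : Root) (n : ℤ), 0 < n → mode a n ∈ J := fun a n hn =>
      h (Or.inl (Or.inl (Or.inl ⟨a, n, hn, rfl⟩)))
    refine ⟨fun a n hn => (key _).2 (hpos a n hn), (key _).2 (h (Or.inl (Or.inl (Or.inr rfl)))),
      fun α β hab => (key _).2 (h (Or.inl (Or.inr ⟨α, β, hab, rfl⟩))), fun α β hab N w => ?_⟩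
    have hw : ∀ (a : Root) (n : ℤ), 0 < n → mode a n • w = 0 := fun a n hn =>
      key' _ (hpos a n hn) w
    refine ⟨finite_inter_support hw α β N, ?_⟩
    by_cases hN : N ≤ 0
    · obtain ⟨n, rfl⟩ : ∃ n : ℕ, N = -(n : ℤ) := ⟨(-N).toNat, by omega⟩
      rw [finsum_word_smul hw]
      exact key' _ (h (Or.inr ⟨α, β, n, hab, rfl⟩)) w
    · refine finsum_mem_eq_zero_of_forall_eq_zero fun f hf => ?_
      by_contra hne
      have hn := (inter_support_subset hw α β N ⟨hf, hne⟩).2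
      have := Finset.sum_nonpos fun i (_ : i ∈ Finset.univ) => hn i
      have hf' : ∑ i, f i = N := hf
      omega

theorem relationIdeal_eq_span (k l₁ l₂ : ℕ) :
    relationIdeal k l₁ l₂ = Ideal.span (generators k l₁ l₂) := by
  simp only [relationIdeal, relations_iff_generators]
  refine le_antisymm (sInf_le Ideal.subset_span) (le_sInf fun J hJ => Ideal.span_le.2 hJ)

theorem relations_smallPrincipal (k l₁ l₂ : ℕ) :
    Relations k l₁ l₂ (Ideal.Quotient.mk (relationIdeal k l₁ l₂) 1) := by
  rw [relations_iff_generators, relationIdeal_eq_span]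
  exact Ideal.subset_span

/-! ### The bosonic sum -/

/-- Formal power series in `z₁, z₂` whose coefficients are formal Laurent series in `q`. -/
abbrev Series : Type := MvPowerSeries (Fin 2) (LaurentSeries ℚ)

/-- The exponent of `z₁^i z₂^j`. -/
def expo (i j : ℕ) : Fin 2 →₀ ℕ := Finsupp.single 0 i + Finsupp.single 1 j

/-- The monomial `z₁^i z₂^j q^c`. -/
def mono (i j : ℕ) (c : ℤ) : Series :=
  MvPowerSeries.monomial (expo i j) (HahnSeries.single c (1 : ℚ))

/-- The expansion of `1 / (1 - z₁^i z₂^j q^c)` as a power series in `z₁, z₂`, where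
`(i,j) ≠ (0,0)` and `i, j` are both non-negative or both non-positive.  With `x = z₁^i z₂^j q^c`
it is `1 + x + x² + ⋯` in the first case and `-x⁻¹ (1 + x⁻¹ + x⁻² + ⋯)` in the second case. -/
def invFactor (i j c : ℤ) : Series :=
  if 0 ≤ i ∧ 0 ≤ j then (1 - mono i.toNat j.toNat c)⁻¹
  else -mono (-i).toNat (-j).toNat (-c) * (1 - mono (-i).toNat (-j).toNat (-c))⁻¹

/-- The expansion of `1 / (z₁^i z₂^j q^c)_n`, where `(x)_n = ∏_{r=0}^{n-1} (1 - x q^r)`. -/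
def invPoch (i j c : ℤ) (n : ℕ) : Series := ∏ r ∈ Finset.range n, invFactor i j (c + r)

/-- The infinite product `(z₁^i z₂^j q^c)_∞ = ∏_{r ≥ 0} (1 - z₁^i z₂^j q^{c+r})`.  As the factors
with `r > d` do not contribute to the power `q^d`, the coefficients of `q^d` are those of the
product of the factors `r = 0,…,d` (see `coeff_prod_eq_coeff_pochInf`). -/
def pochInf (i j c : ℕ) : Series := fun e =>
  HahnSeries.ofPowerSeries ℤ ℚ (PowerSeries.mk fun d : ℕ =>
    (MvPowerSeries.coeff e (∏ r ∈ Finset.range (d + 1), (1 - mono i j (c + r)))).coeff (d : ℤ))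

/-- `1 / (q)_n`, with the usual convention `1 / (q)_n = 0` for `n < 0`. -/
def invQ (n : ℤ) : Series :=
  if n < 0 then 0
  else MvPowerSeries.C
    (∏ r ∈ Finset.range n.toNat, (1 - HahnSeries.single ((r : ℤ) + 1) (1 : ℚ)))⁻¹

/-- The monomials `p^k_{l₁,l₂}(m,n,s,z₁,z₂)`: the exponents of `z₁` and `z₂`. -/
def pExp (k l₁ l₂ m n : ℕ) : Fin 6 → ℕ × ℕ
  | 0 => (k * m, k * n)
  | 1 => (k * m + l₁, k * n)
  | 2 => (k * m + l₁ + l₂, k * n + l₂)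
  | 3 => (k * m + l₁ + l₂, k * n + l₁ + l₂)
  | 4 => (k * m + l₁, k * n + l₁ + l₂)
  | 5 => (k * m, k * n + l₂)

/-- The quadratic form `Q₂(m,n) = m² + n² - mn`. -/
def Q₂ (m n : ℤ) : ℤ := m ^ 2 + n ^ 2 - m * n

/-- The exponents `a^k_{l₁,l₂}(m,n,s)`. -/
def aExp (k l₁ l₂ m n : ℤ) : Fin 6 → ℤ
  | 0 => k * Q₂ m n - m * l₁ - n * l₂
  | 1 => k * Q₂ m n + (m - n) * l₁ - n * l₂
  | 2 => k * Q₂ m n + (m - n) * l₁ + m * l₂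
  | 3 => k * Q₂ m n + n * l₁ + m * l₂
  | 4 => k * Q₂ m n + n * l₁ + (-m + n) * l₂
  | 5 => k * Q₂ m n - m * l₁ + (-m + n) * l₂

/-- The expansions of `1 / d(m,n,s,z₁,z₂)`, for `m ≥ n`. -/
def invD (m n : ℕ) : Fin 6 → Series
  | 0 => invQ n * invQ (m - n)
      * (pochInf 1 0 (2 * m - n))⁻¹ * invPoch (-1) 0 (-2 * m + n + 1) (m - n)
      * (pochInf 1 1 (m + n))⁻¹ * invPoch (-1) (-1) (-m - n + 1) n
      * invPoch 0 1 (2 * n - m) (m - n) * invPoch 0 (-1) (-2 * n + m + 1) n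
  | 1 => invQ n * invQ (m - n)
      * (pochInf 1 0 (2 * m - n + 1))⁻¹ * invPoch (-1) 0 (-2 * m + n) (m - n + 1)
      * (pochInf 1 1 (m + n))⁻¹ * invPoch (-1) (-1) (-m - n + 1) n
      * invPoch 0 1 (2 * n - m) (m - n) * invPoch 0 (-1) (-2 * n + m + 1) n
  | 2 => invQ n * invQ (m - n)
      * (pochInf 1 0 (2 * m - n + 1))⁻¹ * invPoch (-1) 0 (-2 * m + n) (m - n)
      * (pochInf 1 1 (m + n + 1))⁻¹ * invPoch (-1) (-1) (-m - n) (n + 1)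
      * invPoch 0 1 (2 * n - m) (m - n + 1) * invPoch 0 (-1) (-2 * n + m + 1) n
  | 3 => invQ n * invQ (m - n)
      * (pochInf 1 0 (2 * m - n + 1))⁻¹ * invPoch (-1) 0 (-2 * m + n) (m - n)
      * (pochInf 1 1 (m + n + 1))⁻¹ * invPoch (-1) (-1) (-m - n) (n + 1)
      * invPoch 0 1 (2 * n - m + 1) (m - n) * invPoch 0 (-1) (-2 * n + m) (n + 1)
  | 4 => invQ n * invQ (m - n - 1)
      * (pochInf 1 0 (2 * m - n))⁻¹ * invPoch (-1) 0 (-2 * m + n + 1) (m - n)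
      * (pochInf 1 1 (m + n + 1))⁻¹ * invPoch (-1) (-1) (-m - n) (n + 1)
      * invPoch 0 1 (2 * n - m + 1) (m - n) * invPoch 0 (-1) (-2 * n + m) (n + 1)
  | 5 => invQ n * invQ (m - n - 1)
      * (pochInf 1 0 (2 * m - n))⁻¹ * invPoch (-1) 0 (-2 * m + n + 1) (m - n)
      * (pochInf 1 1 (m + n))⁻¹ * invPoch (-1) (-1) (-m - n + 1) n
      * invPoch 0 1 (2 * n - m + 1) (m - n) * invPoch 0 (-1) (-2 * n + m) (n + 1)

/-- The index set of the bosonic sum: triples `(m,n,s)` with `m ≥ n ≥ 0` and `s = 0,…,5`. -/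
def bosonIndex : Set (ℕ × ℕ × Fin 6) := {t | t.2.1 ≤ t.1}

/-- The term `p^k_{l₁,l₂}(m,n,s,z₁,z₂) q^{a^k_{l₁,l₂}(m,n,s)} / d(m,n,s,z₁,z₂)`. -/
def bosonTerm (k l₁ l₂ : ℕ) (t : ℕ × ℕ × Fin 6) : Series :=
  mono (pExp k l₁ l₂ t.1 t.2.1 t.2.2).1 (pExp k l₁ l₂ t.1 t.2.1 t.2.2).2
    (aExp k l₁ l₂ t.1 t.2.1 t.2.2) * invD t.1 t.2.1 t.2.2

/-- The bosonic sum `χ_B`, summed coefficientwise in `z₁, z₂`. -/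
def chiB (k l₁ l₂ : ℕ) : Series := fun e =>
  ∑ᶠ t ∈ bosonIndex, MvPowerSeries.coeff e (bosonTerm k l₁ l₂ t)

theorem coeff_prod_of_neg (i j c N : ℕ) : ∀ (e : Fin 2 →₀ ℕ) (d : ℤ), d < 0 →
    (MvPowerSeries.coeff e (∏ r ∈ Finset.range N, (1 - mono i j (c + r)))).coeff d = 0 := by
  classical
  induction N with
  | zero =>
    intro e d hd
    rw [Finset.prod_range_zero, MvPowerSeries.coeff_one]
    split_ifs with h
    · exact HahnSeries.coeff_single_of_ne hd.ne
    · rfl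
  | succ N ih =>
    intro e d hd
    rw [Finset.prod_range_succ, mul_sub, mul_one, map_sub, HahnSeries.coeff_sub, ih e d hd, mono,
      MvPowerSeries.coeff_mul_monomial]
    split_ifs with h
    · have h0 := ih (e - expo i j) (d - (c + N)) (by omega)
      have h1 := HahnSeries.coeff_mul_single_add (R := ℚ) (r := 1)
        (x := MvPowerSeries.coeff (e - expo i j)
          (∏ r ∈ Finset.range N, (1 - mono i j (c + r)))) (a := d - (c + N)) (b := (c + N : ℤ))
      rw [sub_add_cancel, h0, zero_mul] at h1
      rw [h1, sub_zero]
    · simp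

theorem coeff_pochInf (i j c : ℕ) (e : Fin 2 →₀ ℕ) :
    MvPowerSeries.coeff e (pochInf i j c) =
      HahnSeries.ofPowerSeries ℤ ℚ (PowerSeries.mk fun d : ℕ =>
        (MvPowerSeries.coeff e
          (∏ r ∈ Finset.range (d + 1), (1 - mono i j (c + r)))).coeff (d : ℤ)) :=
  rfl

theorem coeff_prod_eq_coeff_pochInf (i j c N : ℕ) (e : Fin 2 →₀ ℕ) (d : ℤ) (hd : d < N) :
    (MvPowerSeries.coeff e (∏ r ∈ Finset.range N, (1 - mono i j (c + r)))).coeff d =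
      (MvPowerSeries.coeff e (pochInf i j c)).coeff d := by
  classical
  by_cases hneg : d < 0
  · rw [coeff_prod_of_neg i j c N e d hneg, coeff_pochInf,
      HahnSeries.ofPowerSeries_apply, HahnSeries.embDomain_of_notMem_range]
    rintro ⟨n, hn⟩
    have : (n : ℤ) = d := hn
    omega
  obtain ⟨d, rfl⟩ : ∃ n : ℕ, d = n := ⟨d.toNat, by omega⟩
  have hinf : (MvPowerSeries.coeff e (pochInf i j c)).coeff (d : ℤ) =
      (MvPowerSeries.coeff e (∏ r ∈ Finset.range (d + 1), (1 - mono i j (c + r)))).coeff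
        (d : ℤ) := by
    rw [coeff_pochInf, HahnSeries.ofPowerSeries_apply_coeff,
      PowerSeries.coeff_mk]
  rw [hinf]
  obtain ⟨M, rfl⟩ : ∃ M, N = d + 1 + M := ⟨N - (d + 1), by omega⟩
  clear hd hneg
  induction M with
  | zero => rfl
  | succ M ih =>
    rw [← add_assoc, Finset.prod_range_succ, mul_sub, mul_one, map_sub, HahnSeries.coeff_sub, ih,
      mono, MvPowerSeries.coeff_mul_monomial]
    split_ifs with h
    · have h0 := coeff_prod_of_neg i j c (d + 1 + M) (e - expo i j)
        (d - (c + (d + 1 + M : ℕ))) (by push_cast; omega)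
      have h1 := HahnSeries.coeff_mul_single_add (R := ℚ) (r := 1)
        (x := MvPowerSeries.coeff (e - expo i j)
          (∏ r ∈ Finset.range (d + 1 + M), (1 - mono i j (c + r))))
        (a := (d : ℤ) - (c + (d + 1 + M : ℕ))) (b := (c + (d + 1 + M : ℕ) : ℤ))
      rw [sub_add_cancel, h0, zero_mul] at h1
      rw [h1, sub_zero]
    · simp

end SmallPrincipal

end

open scoped BigOperators

noncomputable section

namespace SmallPrincipal

/-! ### Shifting the modes -/

/-! Character and bosonic sum satisfy the same recursion, and that recursion has only one solution.
Put `l₃ = k - l₁ - l₂` and write `χ_{l₁,l₂}` for either side. The recursion is `χ_{l₁,l₂}(z₁,z₂) =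
χ_{l₁-1,l₂+1}(z₁,z₂) + z₁^l₁ χ_{l₂,l₃}(z₁z₂, q/z₂)`, where the first summand on the right is absent
for `l₁ = 0`.

For the character it comes from an exact sequence `0 → X_{l₂,l₃} → X_{l₁,l₂} → X_{l₁-1,l₂+1} → 0`.
The kernel of the surjection is generated by `e₂₁[0]^l₁ v`, and the injection is `w v ↦ e₂₁[0]^l₁
shift(w) v` for the automorphism `shift`. This map is well defined by `relationIdeal_shift`.
Injectivity needs a model in which vectors can be seen to be nonzero. The model is a tensor product
of `k` level-one lattice modules, realised by commuting vertex operators on a polynomial ring. Its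
vacuum vector carries one of three types at each tensor factor, with multiplicities `l₁`, `l₂`,
`l₃`. It satisfies the defining relations (`relationIdeal_le_vacuumAnn`), and applying `e₂₁[0]^l₁`
followed by `shift` rotates the three types (`mem_vacuumAnn_rotate`). An induction on the degree
then shows that homogeneous elements killing the vacuum lie in the relation ideal
(`mem_relationIdeal_of_mem_vacuumAnn`). Injectivity follows
(`mem_relationIdeal_of_pow_mul_shift_mem`).

For the bosonic sum the recursion holds term by term under a bijection onto part of the index set
(`bose_rec`), and the remaining terms cancel (`bose_sub_of_notMem_range`). The summand that would
belong to `l₁ = -1` vanishes by an involution that reverses signs (`bose_boseSwap`).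

Uniqueness (`IsRecursive.eq`): the substitution `(z₁,z₂) ↦ (z₁z₂, q/z₂)` has square `(z₁,z₂) ↦ (qz₁,
z₂)`. Hence, by induction on the degree `D > 0` in `z₁`, the difference of two solutions at `(0,k)`
equals `q^D` times itself, so it is zero. Since `q/z₂` is not a power series in `z₂`, the comparison
takes place over the fraction field of the power series in `z₂`, into which `toBase` embeds the
coefficients. -/

/-- The permutation of the modes that sends `e₂₁[n]` to `e₃₁[n]` and `e₃₁[n]` to `e₂₁[n-1]`. -/
def shiftIndex : Root × ℤ ≃ Root × ℤ where
  toFun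
    | (Root.e21, n) => (Root.e31, n)
    | (Root.e31, n) => (Root.e21, n - 1)
  invFun
    | (Root.e21, n) => (Root.e31, n + 1)
    | (Root.e31, n) => (Root.e21, n)
  left_inv := by rintro ⟨_ | _, n⟩ <;> simp
  right_inv := by rintro ⟨_ | _, n⟩ <;> simp

/-- The automorphism of `U(â)` induced by `shiftIndex`. -/
def shift : UA ≃ₐ[ℂ] UA := MvPolynomial.renameEquiv ℂ shiftIndex

@[simp]
theorem shift_mode_e21 (n : ℤ) : shift (mode Root.e21 n) = mode Root.e31 n := by
  simp [shift, mode, shiftIndex]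

@[simp]
theorem shift_mode_e31 (n : ℤ) : shift (mode Root.e31 n) = mode Root.e21 (n - 1) := by
  simp [shift, mode, shiftIndex]

/-- The generating series `∑_{n ≥ 0} e_a[-n] z^n`. -/
def current (a : Root) : PowerSeries UA := PowerSeries.mk fun n => mode a (-(n : ℤ))

theorem coeff_current (a : Root) (n : ℕ) :
    PowerSeries.coeff n (current a) = mode a (-(n : ℤ)) :=
  PowerSeries.coeff_mk _ _

/-- Multiplying out the currents gives exactly the words with nonpositive modes. In this form the
current relations can be handled by ring identities between power series. -/
theorem truncCoeff_eq_coeff (α β N : ℕ) :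
    truncCoeff α β N =
      PowerSeries.coeff N (current Root.e21 ^ α * current Root.e31 ^ β) := by
  classical
  have h : current Root.e21 ^ α * current Root.e31 ^ β =
      ∏ i : Fin α ⊕ Fin β, current (rootSeq α β i) := by
    simp [Fintype.prod_sum_type, rootSeq]
  rw [h, PowerSeries.coeff_prod, truncCoeff]
  refine Finset.sum_bij' (fun f _ => Finsupp.equivFunOnFinite.symm f) (fun f _ => f)
    ?_ ?_ ?_ ?_ ?_
  · intro f hf
    simpa [Finset.mem_finsuppAntidiag] using hf
  · intro f hf
    simpa [Finset.mem_finsuppAntidiag] using hf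
  · intro f _; rfl
  · intro f _; ext; rfl
  · intro f _
    simp [word, coeff_current]

theorem map_shift_current_e21 :
    (current Root.e21).map (shift : UA →+* UA) = current Root.e31 := by
  ext1 n
  simp [coeff_current, PowerSeries.coeff_map]

/-- `shift` sends `e₃₁[-n]` to `e₂₁[-n-1]`, so the tail of the first current is a shifted copy of
the second. Modulo the zero mode, the two currents therefore differ by `shift` and a factor of the
formal variable. -/
theorem current_e21_eq :
    current Root.e21 = PowerSeries.C (mode Root.e21 0) +
      PowerSeries.X * (current Root.e31).map (shift : UA →+* UA) := by
  ext1 n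
  cases n with
  | zero => simp [PowerSeries.coeff_zero_eq_constantCoeff_apply, current]
  | succ n =>
    simp [coeff_current, PowerSeries.coeff_succ_X_mul, PowerSeries.coeff_map]
    congr 1; ring

/-! ### The relations -/

theorem mem_relationIdeal_pos (k l₁ l₂ : ℕ) (a : Root) {n : ℤ} (hn : 0 < n) :
    mode a n ∈ relationIdeal k l₁ l₂ := by
  rw [relationIdeal_eq_span]
  exact Ideal.subset_span (Or.inl (Or.inl (Or.inl ⟨a, n, hn, rfl⟩)))

theorem mem_relationIdeal_top (k l₁ l₂ : ℕ) :
    mode Root.e21 0 ^ (l₁ + 1) ∈ relationIdeal k l₁ l₂ := by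
  rw [relationIdeal_eq_span]
  exact Ideal.subset_span (Or.inl (Or.inl (Or.inr rfl)))

theorem mem_relationIdeal_mixed (k l₁ l₂ : ℕ) {α β : ℕ} (h : α + β = l₁ + l₂ + 1) :
    mode Root.e21 0 ^ α * mode Root.e31 0 ^ β ∈ relationIdeal k l₁ l₂ := by
  rw [relationIdeal_eq_span]
  exact Ideal.subset_span (Or.inl (Or.inr ⟨α, β, h, rfl⟩))

theorem mem_relationIdeal_current (k l₁ l₂ : ℕ) {α β : ℕ} (N : ℕ) (h : α + β = k + 1) :
    PowerSeries.coeff N (current Root.e21 ^ α * current Root.e31 ^ β) ∈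
      relationIdeal k l₁ l₂ := by
  rw [relationIdeal_eq_span, ← truncCoeff_eq_coeff]
  exact Ideal.subset_span (Or.inr ⟨α, β, N, h, rfl⟩)

theorem relationIdeal_le_iff {k l₁ l₂ : ℕ} {I : Ideal UA} :
    relationIdeal k l₁ l₂ ≤ I ↔
      (∀ (a : Root) (n : ℤ), 0 < n → mode a n ∈ I) ∧ mode Root.e21 0 ^ (l₁ + 1) ∈ I ∧
      (∀ α β : ℕ, α + β = l₁ + l₂ + 1 → mode Root.e21 0 ^ α * mode Root.e31 0 ^ β ∈ I) ∧
      (∀ α β N : ℕ, α + β = k + 1 →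
        PowerSeries.coeff N (current Root.e21 ^ α * current Root.e31 ^ β) ∈ I) := by
  constructor
  · intro h
    exact ⟨fun a n hn => h (mem_relationIdeal_pos _ _ _ a hn), h (mem_relationIdeal_top _ _ _),
      fun α β hab => h (mem_relationIdeal_mixed _ _ _ hab),
      fun α β N hab => h (mem_relationIdeal_current _ _ _ N hab)⟩
  · rintro ⟨h1, h2, h3, h4⟩
    rw [relationIdeal_eq_span, Ideal.span_le]
    rintro x (((⟨a, n, hn, rfl⟩ | rfl) | ⟨α, β, hab, rfl⟩) | ⟨α, β, N, hab, rfl⟩)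
    · exact h1 a n hn
    · exact h2
    · exact h3 α β hab
    · rw [truncCoeff_eq_coeff]; exact h4 α β N hab

/-! ### The maps of the exact sequence. -/

theorem relationIdeal_succ_le (k l₁ l₂ : ℕ) :
    relationIdeal k l₁ (l₂ + 1) ≤
      relationIdeal k (l₁ + 1) l₂ ⊔ Ideal.span {mode Root.e21 0 ^ (l₁ + 1)} := by
  rw [relationIdeal_le_iff]
  refine ⟨fun a n hn => Ideal.mem_sup_left (mem_relationIdeal_pos _ _ _ a hn),
    Ideal.mem_sup_right (Ideal.mem_span_singleton_self _),
    fun α β h => Ideal.mem_sup_left (mem_relationIdeal_mixed _ _ _ (by omega)),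
    fun α β N h => Ideal.mem_sup_left (mem_relationIdeal_current _ _ _ N h)⟩

/-- Both ideals depend on `l₁ + l₂` in the same way, so only the power of `e₂₁[0]` distinguishes
them. Together with `relationIdeal_succ_le` this identifies the kernel of the surjection as
generated by one power of `e₂₁[0]`. -/
theorem relationIdeal_le_succ (k l₁ l₂ : ℕ) :
    relationIdeal k (l₁ + 1) l₂ ≤ relationIdeal k l₁ (l₂ + 1) := by
  rw [relationIdeal_le_iff]
  refine ⟨fun a n hn => mem_relationIdeal_pos _ _ _ a hn, ?_,
    fun α β h => mem_relationIdeal_mixed _ _ _ (by omega),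
    fun α β N h => mem_relationIdeal_current _ _ _ N h⟩
  rw [pow_succ]
  exact Ideal.mul_mem_right _ _ (mem_relationIdeal_top _ _ _)

/-- The elements of `U(â)` that are sent to an ideal by `shift` followed by the multiplication
with a fixed element. -/
def shiftColon (x : UA) (I : Ideal UA) : Ideal UA where
  carrier := {u | x * shift u ∈ I}
  add_mem' {a b} ha hb := by
    simpa [mul_add] using I.add_mem ha hb
  zero_mem' := by simp
  smul_mem' c u hu := by
    have := I.mul_mem_left (shift c) hu
    simpa [mul_left_comm] using this

theorem mem_shiftColon {x : UA} {I : Ideal UA} {u : UA} :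
    u ∈ shiftColon x I ↔ x * shift u ∈ I := Iff.rfl

/-- If `f ≡ g` modulo `x`, then `y f ≡ y g` modulo any ideal containing `y x`. -/
theorem coeff_C_mul_mem_of_dvd_sub {A : Type*} [CommRing A] {I : Ideal A} {x y : A}
    (hxy : y * x ∈ I) {f g : PowerSeries A} (h : PowerSeries.C x ∣ f - g) {n : ℕ}
    (hg : y * PowerSeries.coeff n g ∈ I) : y * PowerSeries.coeff n f ∈ I := by
  obtain ⟨r, hr⟩ := h
  rw [sub_eq_iff_eq_add] at hr
  rw [hr, map_add, mul_add, PowerSeries.coeff_C_mul, ← mul_assoc]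
  exact I.add_mem (I.mul_mem_right _ hxy) hg

/-- This is the well-definedness of the left map of the exact sequence. The relations trade places.
The shift of `e₃₁[1]` is `e₂₁[0]`, which falls under the top relation. The top relation for `l₂`
becomes a mixed one. The mixed relations become lowest coefficients of the current relations, and
the current relations reproduce themselves modulo `e₂₁[0]`. -/
theorem relationIdeal_shift (k l₁ l₂ l₃ : ℕ) (h : l₁ + l₂ + l₃ = k) :
    relationIdeal k l₂ l₃ ≤ shiftColon (mode Root.e21 0 ^ l₁) (relationIdeal k l₁ l₂) := by
  set I := relationIdeal k l₁ l₂ with hI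
  set x := mode Root.e21 0 with hx
  have htop : x ^ l₁ * x ∈ I := by rw [← pow_succ]; exact mem_relationIdeal_top _ _ _
  set A := current Root.e21 with hA
  set B := current Root.e31 with hB
  set D := B.map (shift : UA →+* UA) with hD
  have hAD : A = PowerSeries.C x + PowerSeries.X * D := current_e21_eq
  rw [relationIdeal_le_iff]
  simp only [mem_shiftColon]
  refine ⟨?_, ?_, ?_, ?_⟩
  · rintro (_ | _) n hn
    · rw [shift_mode_e21]
      exact I.mul_mem_left _ (mem_relationIdeal_pos _ _ _ _ hn)
    · rw [shift_mode_e31]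
      rcases eq_or_ne n 1 with rfl | hn1
      · simpa using htop
      · exact I.mul_mem_left _ (mem_relationIdeal_pos _ _ _ _ (by omega))
  · rw [map_pow, shift_mode_e21]
    exact mem_relationIdeal_mixed _ _ _ (by omega)
  · intro α β hab
    rw [map_mul, map_pow, map_pow, shift_mode_e21, shift_mode_e31]
    -- The exponents add up to `l₁ + l₂ + l₃ + 1 = k + 1`. With `A = x + zD`, only the term with
    -- exactly `l₁` factors `x` contributes to the coefficient of `z^β` modulo `I`.
    have hmem : PowerSeries.coeff β (A ^ (l₁ + β) * B ^ α) ∈ I :=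
      mem_relationIdeal_current _ _ _ _ (by omega)
    have hc : (((l₁ + β).choose l₁ : ℕ) : UA) * (x ^ l₁ * (mode Root.e31 0 ^ α *
        mode Root.e21 (0 - 1) ^ β)) ∈ I := by
      rw [hAD, add_pow, Finset.sum_mul, map_sum,
        ← Finset.add_sum_erase _ _ (Finset.mem_range.2 (by omega : l₁ < l₁ + β + 1))] at hmem
      have hmain : PowerSeries.coeff β (PowerSeries.C x ^ l₁ *
          (PowerSeries.X * D) ^ (l₁ + β - l₁) * ((l₁ + β).choose l₁ : PowerSeries UA) * B ^ α) =
          (((l₁ + β).choose l₁ : ℕ) : UA) * (x ^ l₁ * (mode Root.e31 0 ^ α *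
            mode Root.e21 (0 - 1) ^ β)) := by
        rw [Nat.add_sub_cancel_left, mul_pow, ← map_pow, ← map_natCast (PowerSeries.C (R := UA)),
          show PowerSeries.C (x ^ l₁) * (PowerSeries.X ^ β * D ^ β) *
            PowerSeries.C (((l₁ + β).choose l₁ : ℕ) : UA) * B ^ α =
            PowerSeries.C ((((l₁ + β).choose l₁ : ℕ) : UA) * x ^ l₁) *
              (PowerSeries.X ^ β * (D ^ β * B ^ α)) by rw [map_mul]; ring,
          PowerSeries.coeff_C_mul]
        have := PowerSeries.coeff_X_pow_mul (D ^ β * B ^ α) β 0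
        rw [zero_add] at this
        rw [this, PowerSeries.coeff_zero_eq_constantCoeff_apply, map_mul, map_pow, map_pow,
          ← PowerSeries.coeff_zero_eq_constantCoeff_apply,
          ← PowerSeries.coeff_zero_eq_constantCoeff_apply, hD, PowerSeries.coeff_map, hB,
          coeff_current]
        simp only [Nat.cast_zero, neg_zero, RingHom.coe_coe, shift_mode_e31]
        ring
      rw [hmain] at hmem
      refine (I.add_mem_iff_left (I.sum_mem fun j hj => ?_)).1 hmem
      rw [Finset.mem_erase, Finset.mem_range] at hj
      -- Fewer than `l₁` factors `x` leave a power of `z` above `β`; more than `l₁` produce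
      -- `x^(l₁+1)`, which lies in `I`.
      rcases lt_or_gt_of_ne hj.1 with hlt | hgt
      · have : PowerSeries.C x ^ j * (PowerSeries.X * D) ^ (l₁ + β - j) *
            ((l₁ + β).choose j : PowerSeries UA) * B ^ α =
            PowerSeries.X ^ (l₁ + β - j) * (PowerSeries.C x ^ j * D ^ (l₁ + β - j) *
            ((l₁ + β).choose j : PowerSeries UA) * B ^ α) := by
          rw [mul_pow]; ring
        rw [this, PowerSeries.coeff_X_pow_mul', if_neg (by omega)]
        exact I.zero_mem
      · obtain ⟨i, rfl⟩ : ∃ i, j = l₁ + 1 + i := ⟨j - (l₁ + 1), by omega⟩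
        have : PowerSeries.C x ^ (l₁ + 1 + i) * (PowerSeries.X * D) ^ (l₁ + β - (l₁ + 1 + i)) *
            ((l₁ + β).choose (l₁ + 1 + i) : PowerSeries UA) * B ^ α =
            PowerSeries.C (x ^ (l₁ + 1)) * (PowerSeries.C x ^ i *
              (PowerSeries.X * D) ^ (l₁ + β - (l₁ + 1 + i)) *
            ((l₁ + β).choose (l₁ + 1 + i) : PowerSeries UA) * B ^ α) := by
          rw [map_pow]; ring
        rw [this, PowerSeries.coeff_C_mul]
        exact I.mul_mem_right _ (mem_relationIdeal_top _ _ _)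
    have hne : (((l₁ + β).choose l₁ : ℕ) : ℂ) ≠ 0 :=
      Nat.cast_ne_zero.2 (Nat.choose_pos (by omega)).ne'
    have := I.mul_mem_left (MvPolynomial.C (((l₁ + β).choose l₁ : ℕ) : ℂ)⁻¹) hc
    rwa [← mul_assoc, ← map_natCast (MvPolynomial.C (R := ℂ)), ← map_mul, inv_mul_cancel₀ hne,
      map_one, one_mul] at this
  · intro α β N hab
    have hmap : shift (PowerSeries.coeff N (A ^ α * B ^ β)) =
        PowerSeries.coeff N (B ^ α * D ^ β) := by
      have := PowerSeries.coeff_map (shift : UA →+* UA) N (A ^ α * B ^ β)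
      rw [map_mul, map_pow, map_pow, hA, map_shift_current_e21] at this
      exact this.symm
    -- After multiplication by `z^β` each `D` is paired with a `z`, and `zD ≡ A` modulo `x`.
    -- Multiples of `x` are harmless because `x^l₁ x ∈ I`.
    rw [hmap, ← PowerSeries.coeff_X_pow_mul (B ^ α * D ^ β) β N,
      show PowerSeries.X ^ β * (B ^ α * D ^ β) = (PowerSeries.X * D) ^ β * B ^ α by
        rw [mul_pow]; ring]
    refine coeff_C_mul_mem_of_dvd_sub htop (g := A ^ β * B ^ α) ?_
      (I.mul_mem_left _ (mem_relationIdeal_current _ _ _ _ (by omega)))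
    rw [← sub_mul]
    refine Dvd.dvd.mul_right (dvd_trans ?_ (sub_dvd_pow_sub_pow _ _ β)) _
    rw [hAD]
    exact ⟨-1, by ring⟩

/-! ### The grading -/

/-- The homogeneous elements of `U(â)` of degree `g`. -/
abbrev homog (g : ℕ × ℕ × ℤ) : Submodule ℂ UA :=
  MvPolynomial.weightedHomogeneousSubmodule ℂ modeDegree g

attribute [local instance] MvPolynomial.weightedGradedAlgebra

theorem isWeightedHomogeneous_mode (a : Root) (n : ℤ) :
    MvPolynomial.IsWeightedHomogeneous modeDegree (mode a n) (modeDegree (a, n)) :=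
  MvPolynomial.isWeightedHomogeneous_X _ _ _

theorem isWeightedHomogeneous_truncCoeff (α β N : ℕ) :
    MvPolynomial.IsWeightedHomogeneous modeDegree (truncCoeff α β N) (α + β, β, (N : ℤ)) := by
  refine MvPolynomial.IsWeightedHomogeneous.sum _ _ _ fun f hf => ?_
  have h := MvPolynomial.IsWeightedHomogeneous.prod (w := modeDegree) Finset.univ
    (fun i => mode (rootSeq α β i) (-(f i : ℤ))) _ fun i _ => isWeightedHomogeneous_mode _ _
  refine cast (congrArg (MvPolynomial.IsWeightedHomogeneous modeDegree _) ?_) h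
  rw [Finset.mem_piAntidiag] at hf
  rw [← hf.1, Fintype.sum_sum_type, Fintype.sum_sum_type]
  simp [rootSeq, modeDegree, Prod.ext_iff, Prod.fst_sum, Prod.snd_sum]

theorem relationIdeal_isHomogeneous (k l₁ l₂ : ℕ) :
    (relationIdeal k l₁ l₂).IsHomogeneous homog := by
  rw [relationIdeal_eq_span]
  refine Ideal.homogeneous_span _ _ ?_
  rintro x (((⟨a, n, hn, rfl⟩ | rfl) | ⟨α, β, hab, rfl⟩) | ⟨α, β, N, hab, rfl⟩)
  · exact ⟨_, isWeightedHomogeneous_mode a n⟩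
  · exact ⟨_, (isWeightedHomogeneous_mode _ _).pow _⟩
  · exact ⟨_, ((isWeightedHomogeneous_mode _ _).pow _).mul ((isWeightedHomogeneous_mode _ _).pow _)⟩
  · exact ⟨_, isWeightedHomogeneous_truncCoeff α β N⟩

theorem component_mem_relationIdeal {k l₁ l₂ : ℕ} {u : UA} (hu : u ∈ relationIdeal k l₁ l₂)
    (g : ℕ × ℕ × ℤ) :
    MvPolynomial.weightedHomogeneousComponent modeDegree g u ∈ relationIdeal k l₁ l₂ :=
  MvPolynomial.weightedHomogeneousComponent_mem_of_mem ℂ modeDegree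
    (relationIdeal_isHomogeneous k l₁ l₂) hu g

section

open scoped BigOperators IsMulCommutative



/-! ### Commuting vertex operators -/

section VertexOperators

variable {ι : Type}

/-- The polynomial ring on which the vertex operators act. -/
abbrev Fock (ι : Type) : Type := MvPolynomial (ι × Root × ℕ) ℂ

/-- The variables of the Fock space, extended by zero to negative indices. -/
def fockVar (i : ι) (a : Root) (n : ℤ) : Fock ι :=
  if 0 ≤ n then MvPolynomial.X (i, a, n.toNat) else 0

theorem fockVar_of_neg (i : ι) (a : Root) {n : ℤ} (hn : n < 0) : fockVar i a n = 0 :=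
  if_neg (by omega)

theorem fockVar_natCast (i : ι) (a : Root) (n : ℕ) :
    fockVar i a (n : ℤ) = MvPolynomial.X (i, a, n) := by
  simp [fockVar]

/-- The coefficients of the polynomials `(x - z)²` (equal roots) and `±ε (x - z)` (different
roots). -/
def rootPairing (ε : ℂ) : Root → Root → Fin 3 → Fin 3 → ℂ
  | Root.e21, Root.e21 => ![![0, 0, 1], ![0, -2, 0], ![1, 0, 0]]
  | Root.e31, Root.e31 => ![![0, 0, 1], ![0, -2, 0], ![1, 0, 0]]
  | Root.e21, Root.e31 => ![![0, -ε, 0], ![ε, 0, 0], ![0, 0, 0]]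
  | Root.e31, Root.e21 => ![![0, ε, 0], ![-ε, 0, 0], ![0, 0, 0]]

/-- The coefficients of the polynomial in `x`, `z` that governs the interaction of the vertex
operator `(i,a)` with the generating series of the variables `(j,b)`. -/
def pairing [DecidableEq ι] (ε : ℂ) (i : ι) (a : Root) (j : ι) (b : Root) : Fin 3 → Fin 3 → ℂ :=
  if i = j then rootPairing ε a b else ![![1, 0, 0], ![0, 0, 0], ![0, 0, 0]]

/-- Viewed as polynomials, `P_{ia,jb}(x,z) = P_{jb,ia}(z,x)`. For different roots at one site this
forces the opposite signs of `±ε(x - z)`. Commutativity of the vertex operators rests on this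
symmetry. -/
theorem pairing_symm [DecidableEq ι] (ε : ℂ) (i : ι) (a : Root) (j : ι) (b : Root) (s t : Fin 3) :
    pairing ε i a j b s t = pairing ε j b i a t s := by
  unfold pairing
  by_cases h : i = j
  · subst h
    simp only [if_true]
    cases a <;> cases b <;> fin_cases s <;> fin_cases t <;> simp [rootPairing]
  · rw [if_neg h, if_neg (Ne.symm h)]
    fin_cases s <;> fin_cases t <;> simp

/-- The substitution in the variables performed by a vertex operator. -/
def vertexSubst [DecidableEq ι] (ε : ℂ) (i : ι) (a : Root) : Fock ι →ₐ[ℂ] Polynomial (Fock ι) :=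
  MvPolynomial.aeval fun y => ∑ s : Fin 3, ∑ t : Fin 3,
    Polynomial.C (MvPolynomial.C (pairing ε i a y.1 y.2.1 s t) *
      fockVar y.1 y.2.1 ((y.2.2 : ℤ) - (t : ℕ))) * Polynomial.X ^ (s : ℕ)

/-- The coefficient of `x^n` in the product of `∑ fockVar i a j x^j` with a polynomial. -/
def vertexCoeff (i : ι) (a : Root) (n : ℤ) : Polynomial (Fock ι) →ₗ[Fock ι] Fock ι :=
  Polynomial.lsum fun j => LinearMap.mulRight (Fock ι) (fockVar i a (n - j))

theorem vertexCoeff_monomial (i : ι) (a : Root) (n : ℤ) (j : ℕ) (c : Fock ι) :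
    vertexCoeff i a n (Polynomial.monomial j c) = c * fockVar i a (n - j) := by
  simp [vertexCoeff, Polynomial.lsum_apply, Polynomial.sum_monomial_index]

theorem vertexCoeff_C_mul_X_pow_mul (i : ι) (a : Root) (n : ℤ) (s : ℕ) (c : Fock ι)
    (P : Polynomial (Fock ι)) :
    vertexCoeff i a n (Polynomial.C c * Polynomial.X ^ s * P) = c * vertexCoeff i a (n - s) P := by
  induction P using Polynomial.induction_on' with
  | add p q hp hq => rw [mul_add, map_add, hp, hq, map_add, mul_add]
  | monomial j d =>
    rw [Polynomial.C_mul_X_pow_eq_monomial, Polynomial.monomial_mul_monomial,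
      vertexCoeff_monomial, vertexCoeff_monomial]
    push_cast
    rw [sub_sub, mul_assoc]

/-- The vertex operators. -/
def vertexOp [DecidableEq ι] (ε : ℂ) (i : ι) (a : Root) (n : ℤ) : Module.End ℂ (Fock ι) :=
  ((vertexCoeff i a n).restrictScalars ℂ).comp (vertexSubst ε i a).toLinearMap

theorem vertexOp_apply [DecidableEq ι] (ε : ℂ) (i : ι) (a : Root) (n : ℤ) (p : Fock ι) :
    vertexOp ε i a n p = vertexCoeff i a n (vertexSubst ε i a p) := rfl

theorem vertexOp_one [DecidableEq ι] (ε : ℂ) (i : ι) (a : Root) (n : ℤ) :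
    vertexOp ε i a n 1 = fockVar i a n := by
  rw [vertexOp_apply, map_one, ← Polynomial.C_1, ← Polynomial.monomial_zero_left,
    vertexCoeff_monomial]
  simp

/-- In generating series, with `X_{j,b}(z)` the series of variables and `V_{i,a}(x)` that of the
operators, this reads `V_{i,a}(x) X_{j,b}(z) = P_{ia,jb}(x,z) X_{j,b}(z) V_{i,a}(x)`. Together with
`V_{i,a}(x) 1 = X_{i,a}(x)` it determines the operators, so later identities are proved by induction
on the number of variables. -/
theorem vertexOp_fockVar_mul [DecidableEq ι] (ε : ℂ) (i : ι) (a : Root) (n : ℤ) (j : ι) (b : Root) (m : ℤ)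
    (p : Fock ι) :
    vertexOp ε i a n (fockVar j b m * p) = ∑ s : Fin 3, ∑ t : Fin 3,
      MvPolynomial.C (pairing ε i a j b s t) * fockVar j b (m - (t : ℕ)) *
        vertexOp ε i a (n - (s : ℕ)) p := by
  by_cases hm : m < 0
  · rw [fockVar_of_neg _ _ hm, zero_mul, map_zero]
    refine (Finset.sum_eq_zero fun s _ => Finset.sum_eq_zero fun t _ => ?_).symm
    rw [fockVar_of_neg _ _ (by omega), mul_zero, zero_mul]
  obtain ⟨m, rfl⟩ : ∃ k : ℕ, m = k := ⟨m.toNat, by omega⟩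
  rw [fockVar_natCast, vertexOp_apply, map_mul, vertexSubst, MvPolynomial.aeval_X,
    Finset.sum_mul, map_sum]
  refine Finset.sum_congr rfl fun s _ => ?_
  rw [Finset.sum_mul, map_sum]
  refine Finset.sum_congr rfl fun t _ => ?_
  rw [vertexCoeff_C_mul_X_pow_mul]
  rfl

/-- Induction on polynomials, multiplying by one variable at a time. -/
theorem fock_induction {P : Fock ι → Prop} (one : P 1) (add : ∀ p q, P p → P q → P (p + q))
    (smul : ∀ (c : ℂ) p, P p → P (c • p))
    (var : ∀ j b (m : ℤ) p, P p → P (fockVar j b m * p)) (p : Fock ι) : P p := by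
  induction p using MvPolynomial.induction_on with
  | C c =>
    have := smul c 1 one
    rwa [MvPolynomial.smul_eq_C_mul, mul_one] at this
  | add p q hp hq => exact add p q hp hq
  | mul_X p y hp =>
    obtain ⟨j, b, m⟩ := y
    rw [mul_comm, ← fockVar_natCast]
    exact var j b m p hp

theorem vertexOp_of_neg [DecidableEq ι] (ε : ℂ) (i : ι) (a : Root) {n : ℤ} (hn : n < 0) :
    vertexOp ε i a n = 0 := by
  refine LinearMap.ext fun p => ?_
  induction p using fock_induction generalizing n with
  | one => rw [vertexOp_one, fockVar_of_neg _ _ hn]; rfl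
  | add p q hp hq => rw [map_add, hp hn, hq hn]; simp
  | smul c p hp => rw [map_smul, hp hn]; simp
  | var j b m p hp =>
    rw [vertexOp_fockVar_mul]
    refine Finset.sum_eq_zero fun s _ => Finset.sum_eq_zero fun t _ => ?_
    rw [hp (by omega)]; simp

theorem vertexOp_vertexOp_one [DecidableEq ι] (ε : ℂ) (i j : ι) (a b : Root) (n m : ℤ) :
    vertexOp ε i a n (vertexOp ε j b m 1) =
      ∑ s : Fin 3, ∑ t : Fin 3, MvPolynomial.C (pairing ε i a j b s t) *
        fockVar j b (m - (t : ℕ)) * fockVar i a (n - (s : ℕ)) := by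
  rw [vertexOp_one, ← mul_one (fockVar j b m), vertexOp_fockVar_mul]
  simp only [vertexOp_one]

theorem vertexOp_vertexOp_fockVar_mul [DecidableEq ι] (ε : ℂ) (i j l : ι) (a b c : Root)
    (n m r : ℤ) (p : Fock ι) :
    vertexOp ε i a n (vertexOp ε j b m (fockVar l c r * p)) =
      ∑ s : Fin 3, ∑ t : Fin 3, ∑ s' : Fin 3, ∑ t' : Fin 3,
        MvPolynomial.C (pairing ε j b l c s t) * (MvPolynomial.C (pairing ε i a l c s' t') *
          fockVar l c (r - (t : ℕ) - (t' : ℕ)) *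
            vertexOp ε i a (n - (s' : ℕ)) (vertexOp ε j b (m - (s : ℕ)) p)) := by
  rw [vertexOp_fockVar_mul, map_sum]
  refine Finset.sum_congr rfl fun s _ => ?_
  rw [map_sum]
  refine Finset.sum_congr rfl fun t _ => ?_
  rw [mul_assoc, ← MvPolynomial.smul_eq_C_mul, map_smul, vertexOp_fockVar_mul,
    MvPolynomial.smul_eq_C_mul, Finset.mul_sum]
  refine Finset.sum_congr rfl fun s' _ => ?_
  rw [Finset.mul_sum]

/-- Moving both operators past a variable produces the same product of two pairing polynomials in
either order. On the vacuum both orders give `P_{ia,jb}(x,z) X_{i,a}(x) X_{j,b}(z)` by the symmetry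
of the pairing. -/
theorem vertexOp_comm [DecidableEq ι] (ε : ℂ) (i j : ι) (a b : Root) (n m : ℤ) :
    vertexOp ε i a n * vertexOp ε j b m = vertexOp ε j b m * vertexOp ε i a n := by
  refine LinearMap.ext fun p => ?_
  simp only [Module.End.mul_apply]
  induction p using fock_induction generalizing n m with
  | one =>
    rw [vertexOp_vertexOp_one, vertexOp_vertexOp_one, Finset.sum_comm]
    refine Finset.sum_congr rfl fun s _ => Finset.sum_congr rfl fun t _ => ?_
    rw [pairing_symm]
    ring
  | add p q hp hq => simp only [map_add, hp, hq]
  | smul c p hp => simp only [map_smul, hp]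
  | var l c r p hp =>
    rw [vertexOp_vertexOp_fockVar_mul, vertexOp_vertexOp_fockVar_mul]
    simp only [← Finset.sum_product', Finset.univ_product_univ]
    refine Fintype.sum_equiv ⟨fun x => (x.2.2.1, x.2.2.2, x.1, x.2.1),
      fun x => (x.2.2.1, x.2.2.2, x.1, x.2.1), fun _ => rfl, fun _ => rfl⟩ _ _ fun x => ?_
    obtain ⟨s, t, s', t'⟩ := x
    simp only [Equiv.coe_fn_mk]
    rw [hp, sub_right_comm r]
    ring

/-- The generating series of the antidiagonal sums of a function of two integers. -/
def convSeries {A : Type*} [CommRing A] (F : ℤ → ℤ → A) : PowerSeries A :=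
  PowerSeries.mk fun N => ∑ x ∈ Finset.HasAntidiagonal.antidiagonal N, F x.1 x.2

/-- The antidiagonal runs over natural numbers only, so shifting the arguments loses nothing
precisely because `F` vanishes at negative ones. -/
theorem convSeries_shift {A : Type*} [CommRing A] {F : ℤ → ℤ → A}
    (h₁ : ∀ n m, n < 0 → F n m = 0) (h₂ : ∀ n m, m < 0 → F n m = 0) (s t : ℕ) :
    convSeries (fun n m => F (n - s) (m - t)) = PowerSeries.X ^ (s + t) * convSeries F := by
  induction s generalizing F with
  | zero =>
    induction t generalizing F with
    | zero => simp
    | succ t ih =>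
      have := ih (F := fun n m => F n (m - 1)) (fun n m h => h₁ _ _ h)
        (fun n m h => h₂ _ _ (by omega))
      simp only [Nat.cast_zero, sub_zero] at this ⊢
      rw [show (fun n m => F n (m - ((t + 1 : ℕ) : ℤ))) = fun n m => F n (m - t - 1) by
        funext n m; push_cast; congr 1; ring, this, zero_add, zero_add, pow_succ, mul_assoc]
      congr 1
      ext1 N
      cases N with
      | zero => simp [convSeries, h₂]
      | succ N =>
        simp [convSeries, Finset.Nat.sum_antidiagonal_succ', PowerSeries.coeff_succ_X_mul, h₂]
  | succ s ih =>
    have := ih (F := fun n m => F (n - 1) m) (fun n m h => h₁ _ _ (by omega))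
      (fun n m h => h₂ _ _ h)
    rw [show (fun n m => F (n - ((s + 1 : ℕ) : ℤ)) (m - t)) = fun n m => F (n - s - 1) (m - t) by
      funext n m; push_cast; congr 1; ring, this, add_right_comm, pow_succ, mul_assoc]
    congr 1
    ext1 N
    cases N with
    | zero => simp [convSeries, h₁]
    | succ N =>
      simp [convSeries, Finset.Nat.sum_antidiagonal_succ, PowerSeries.coeff_succ_X_mul, h₁]

theorem convSeries_sum {A κ : Type*} [CommRing A] (S : Finset κ) (F : κ → ℤ → ℤ → A) :
    convSeries (fun n m => ∑ k ∈ S, F k n m) = ∑ k ∈ S, convSeries (F k) := by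
  ext1 N
  simp only [convSeries, PowerSeries.coeff_mk, map_sum]
  rw [Finset.sum_comm]

theorem convSeries_mul_left {A : Type*} [CommRing A] (c : A) (F : ℤ → ℤ → A) :
    convSeries (fun n m => c * F n m) = PowerSeries.C c * convSeries F := by
  ext1 N
  simp [convSeries, Finset.mul_sum]

/-- At a single site every pairing polynomial is divisible by `x - z`, so it vanishes on the
diagonal. -/
theorem sum_pairing_self [DecidableEq ι] (ε : ℂ) (i : ι) (a b : Root) :
    ∑ s : Fin 3, ∑ t : Fin 3,
      (PowerSeries.C (MvPolynomial.C (pairing ε i a i b s t)) * PowerSeries.X ^ ((s : ℕ) + t) :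
        PowerSeries (Fock ι)) = 0 := by
  have h2 : (2 : PowerSeries (Fock ι)) = PowerSeries.C (MvPolynomial.C 2) := by
    rw [map_ofNat, map_ofNat]
  cases a <;> cases b <;> simp [Fin.sum_univ_three, pairing, rootPairing] <;> ring_nf <;>
    rw [h2] <;> ring

/-- This is `V_{i,a}(z) V_{i,b}(z) = 0`: on the vacuum the product carries the factor `P(z,z) = 0`,
and passing a variable only multiplies by further polynomials. It is the level-one current relation
at each site. -/
theorem convSeries_vertexOp [DecidableEq ι] (ε : ℂ) (i : ι) (a b : Root) (p : Fock ι) :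
    convSeries (fun n m => vertexOp ε i a n (vertexOp ε i b m p)) = 0 := by
  induction p using fock_induction with
  | one =>
    have h : ∀ s t : Fin 3, convSeries (fun n m => MvPolynomial.C (pairing ε i a i b s t) *
        fockVar i b (m - (t : ℕ)) * fockVar i a (n - (s : ℕ))) =
        PowerSeries.C (MvPolynomial.C (pairing ε i a i b s t)) * PowerSeries.X ^ ((s : ℕ) + t) *
          convSeries fun n m => fockVar i b m * fockVar i a n := by
      intro s t
      rw [mul_assoc, ← convSeries_shift
        (fun n m hn => by rw [fockVar_of_neg i a hn, mul_zero])
        (fun n m hm => by rw [fockVar_of_neg i b hm, zero_mul]), ← convSeries_mul_left]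
      simp only [mul_assoc]
    simp only [vertexOp_vertexOp_one, convSeries_sum, h]
    simp only [← Finset.sum_mul, sum_pairing_self, zero_mul]
  | add p q hp hq =>
    rw [← add_zero (0 : PowerSeries (Fock ι))]
    nth_rw 1 [← hp]
    rw [← hq]
    ext1 N
    simp [convSeries, Finset.sum_add_distrib]
  | smul c p hp =>
    simp only [map_smul]
    simp only [MvPolynomial.smul_eq_C_mul, convSeries_mul_left, hp, mul_zero]
  | var l c r p hp =>
    simp only [vertexOp_vertexOp_fockVar_mul, convSeries_sum]
    refine Finset.sum_eq_zero fun s _ => Finset.sum_eq_zero fun t _ =>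
      Finset.sum_eq_zero fun s' _ => Finset.sum_eq_zero fun t' _ => ?_
    rw [convSeries_mul_left, convSeries_mul_left,
      convSeries_shift (F := fun n m => vertexOp ε i a n (vertexOp ε i b m p)), hp]
    · simp
    · intro n m hn
      rw [vertexOp_of_neg ε i a hn]; rfl
    · intro n m hm
      rw [vertexOp_of_neg ε i b hm, LinearMap.zero_apply, map_zero]

/-! ### The action of `U(â)` -/

/-- The algebra generated by the vertex operators. -/
def VertexAlg (ι : Type) [DecidableEq ι] (ε : ℂ) : Type :=
  Algebra.adjoin ℂ (Set.range fun x : ι × Root × ℤ => vertexOp ε x.1 x.2.1 x.2.2)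

instance [DecidableEq ι] (ε : ℂ) : CommRing (VertexAlg ι ε) :=
  have : IsMulCommutative
      (Algebra.adjoin ℂ (Set.range fun x : ι × Root × ℤ => vertexOp ε x.1 x.2.1 x.2.2)) :=
    Algebra.isMulCommutative_adjoin ℂ (by
      rintro _ ⟨x, rfl⟩ _ ⟨y, rfl⟩
      exact vertexOp_comm _ _ _ _ _ _ _)
  inferInstanceAs (CommRing
    (Algebra.adjoin ℂ (Set.range fun x : ι × Root × ℤ => vertexOp ε x.1 x.2.1 x.2.2)))

instance [DecidableEq ι] (ε : ℂ) : Algebra ℂ (VertexAlg ι ε) :=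
  inferInstanceAs (Algebra ℂ
    (Algebra.adjoin ℂ (Set.range fun x : ι × Root × ℤ => vertexOp ε x.1 x.2.1 x.2.2)))

/-- The inclusion of the vertex algebra into the endomorphisms of the Fock space. -/
def VertexAlg.toEnd [DecidableEq ι] (ε : ℂ) : VertexAlg ι ε →ₐ[ℂ] Module.End ℂ (Fock ι) :=
  Subalgebra.val
    (Algebra.adjoin ℂ (Set.range fun x : ι × Root × ℤ => vertexOp ε x.1 x.2.1 x.2.2))

theorem VertexAlg.toEnd_injective [DecidableEq ι] (ε : ℂ) :
    Function.Injective (VertexAlg.toEnd (ι := ι) ε) := Subtype.val_injective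

theorem VertexAlg.ext [DecidableEq ι] {ε : ℂ} {x y : VertexAlg ι ε}
    (h : ∀ p, VertexAlg.toEnd ε x p = VertexAlg.toEnd ε y p) : x = y :=
  VertexAlg.toEnd_injective ε (LinearMap.ext h)

/-- The vertex operators as elements of a commutative algebra. -/
def vertexElt [DecidableEq ι] (ε : ℂ) (i : ι) (a : Root) (n : ℤ) : VertexAlg ι ε :=
  ⟨vertexOp ε i a n, Algebra.subset_adjoin ⟨(i, a, n), rfl⟩⟩

@[simp]
theorem toEnd_vertexElt [DecidableEq ι] (ε : ℂ) (i : ι) (a : Root) (n : ℤ) :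
    VertexAlg.toEnd ε (vertexElt ε i a n) = vertexOp ε i a n := rfl

/-- The action of `U(â)` on the Fock space, with the modes shifted by `sh`. -/
def action [Fintype ι] [DecidableEq ι] (ε : ℂ) (sh : ι → Root → ℤ) : UA →ₐ[ℂ] VertexAlg ι ε :=
  MvPolynomial.aeval fun x => ∑ i, vertexElt ε i x.1 (-x.2 - sh i x.1)

theorem action_mode [Fintype ι] [DecidableEq ι] (ε : ℂ) (sh : ι → Root → ℤ) (a : Root) (n : ℤ) :
    action ε sh (mode a n) = ∑ i, vertexElt ε i a (-n - sh i a) :=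
  MvPolynomial.aeval_X _ _

theorem vertexElt_of_neg [DecidableEq ι] (ε : ℂ) (i : ι) (a : Root) {n : ℤ} (hn : n < 0) :
    vertexElt ε i a n = 0 :=
  VertexAlg.ext fun p => by rw [toEnd_vertexElt, vertexOp_of_neg ε i a hn, map_zero]

theorem vertexElt_zero_mul [DecidableEq ι] (ε : ℂ) (i : ι) (a b : Root) :
    vertexElt ε i a 0 * vertexElt ε i b 0 = 0 := by
  refine VertexAlg.ext fun p => ?_
  have := congrArg (PowerSeries.coeff 0) (convSeries_vertexOp ε i a b p)
  simpa [convSeries] using this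

/-- The generating series of the vertex operators, with the modes shifted by `r`. -/
def vertexCurrent [DecidableEq ι] (ε : ℂ) (i : ι) (a : Root) (r : ℤ) :
    PowerSeries (VertexAlg ι ε) :=
  PowerSeries.mk fun n => vertexElt ε i a (n - r)

theorem vertexCurrent_zero_mul [DecidableEq ι] (ε : ℂ) (i : ι) (a b : Root) :
    vertexCurrent ε i a 0 * vertexCurrent ε i b 0 = 0 := by
  ext1 N
  refine VertexAlg.ext fun p => ?_
  have := congrArg (PowerSeries.coeff N) (convSeries_vertexOp ε i a b p)
  rw [PowerSeries.coeff_mul]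
  simpa [convSeries, vertexCurrent, LinearMap.sum_apply] using this

theorem vertexCurrent_eq [DecidableEq ι] (ε : ℂ) (i : ι) (a : Root) (r : ℕ) :
    vertexCurrent ε i a r = PowerSeries.X ^ r * vertexCurrent ε i a 0 := by
  ext1 N
  rw [PowerSeries.coeff_X_pow_mul']
  split_ifs with h
  · simp [vertexCurrent, Nat.cast_sub h]
  · simp only [vertexCurrent, PowerSeries.coeff_mk]
    exact vertexElt_of_neg ε i a (by omega)

theorem vertexCurrent_mul [DecidableEq ι] (ε : ℂ) (i : ι) (a b : Root) {r s : ℤ} (hr : 0 ≤ r)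
    (hs : 0 ≤ s) : vertexCurrent ε i a r * vertexCurrent ε i b s = 0 := by
  lift r to ℕ using hr
  lift s to ℕ using hs
  rw [vertexCurrent_eq, vertexCurrent_eq, mul_mul_mul_comm, vertexCurrent_zero_mul, mul_zero]

/-- A product of more than `|ι|` sums over `ι` vanishes if any two terms with the same index
multiply to zero. -/
theorem prod_sum_eq_zero {A κ : Type*} [CommRing A] [Fintype κ] [DecidableEq κ] (s : Finset ι)
    (f : κ → ι → A) (h : ∀ x y i, f x i * f y i = 0) (hc : s.card < Fintype.card κ) :
    ∏ x, ∑ i ∈ s, f x i = 0 := by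
  rw [Finset.prod_univ_sum]
  refine Finset.sum_eq_zero fun g hg => ?_
  rw [Fintype.mem_piFinset] at hg
  obtain ⟨x, -, y, -, hne, hxy⟩ := Finset.exists_ne_map_eq_of_card_lt_of_maps_to
    (s := Finset.univ) (t := s) (by rwa [Finset.card_univ]) (f := g) (fun x _ => hg x)
  rw [← Finset.mul_prod_erase _ _ (Finset.mem_univ x),
    ← Finset.mul_prod_erase _ _ (Finset.mem_erase.2 ⟨hne.symm, Finset.mem_univ y⟩), ← mul_assoc,
    hxy, h, zero_mul]

theorem pow_mul_pow_sum_eq_zero {A : Type*} [CommRing A] (s : Finset ι) (f : Root → ι → A)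
    (h : ∀ a b i, f a i * f b i = 0) {α β : ℕ} (hc : s.card < α + β) :
    (∑ i ∈ s, f Root.e21 i) ^ α * (∑ i ∈ s, f Root.e31 i) ^ β = 0 := by
  have := prod_sum_eq_zero s (fun x : Fin α ⊕ Fin β => f (rootSeq α β x))
    (fun x y i => h _ _ i) (by simpa using hc)
  simpa [Fintype.prod_sum_type, rootSeq] using this

/-- Squares vanish, so only squarefree products survive, and the full one arises once for each
ordering of `s`. In the induction step `h0` removes the pure power of the old sum, leaving the part
linear in the new term. -/
theorem sum_pow_card {A : Type*} [CommRing A] [DecidableEq ι] (s : Finset ι) (f : ι → A)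
    (h : ∀ i, f i * f i = 0) : (∑ i ∈ s, f i) ^ s.card = (s.card.factorial : A) * ∏ i ∈ s, f i := by
  induction s using Finset.induction_on with
  | empty => simp
  | insert j s hj ih =>
    have h0 : (∑ i ∈ s, f i) ^ (s.card + 1) = 0 := by
      simpa using pow_mul_pow_sum_eq_zero s (fun _ => f) (fun _ _ => h) (α := s.card + 1) (β := 0)
        (by omega)
    rw [Finset.sum_insert hj, Finset.prod_insert hj, Finset.card_insert_of_notMem hj,
      Nat.factorial_succ]
    have h1 : ∀ (y : A) (n : ℕ), (f j + y) ^ (n + 1) = y ^ (n + 1) + (n + 1 : ℕ) * f j * y ^ n := by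
      intro y n
      induction n with
      | zero => simp [add_comm]
      | succ n ihn =>
        rw [pow_succ, ihn]
        push_cast
        linear_combination ((n : A) + 1) * y ^ n * h j
    rw [h1, h0, ih]
    push_cast
    ring

end VertexOperators

end

section VacuumAnnihilator

variable {ι : Type}

/-! ### Intertwining operators -/

/-- The substitution of variables `fockVar j b m ↦ c j b • fockVar j (w b) (m - d j b)`. -/
def fockSubst (c : ι → Root → ℂ) (d : ι → Root → ℕ) (w : Root → Root) : Fock ι →ₐ[ℂ] Fock ι :=
  MvPolynomial.aeval fun y =>
    MvPolynomial.C (c y.1 y.2.1) * fockVar y.1 (w y.2.1) ((y.2.2 : ℤ) - d y.1 y.2.1)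

theorem fockSubst_fockVar (c : ι → Root → ℂ) (d : ι → Root → ℕ) (w : Root → Root) (j : ι)
    (b : Root) (m : ℤ) : fockSubst c d w (fockVar j b m) =
      MvPolynomial.C (c j b) * fockVar j (w b) (m - d j b) := by
  by_cases hm : m < 0
  · rw [fockVar_of_neg _ _ hm, fockVar_of_neg _ _ (by omega), map_zero, mul_zero]
  obtain ⟨m, rfl⟩ : ∃ k : ℕ, m = k := ⟨m.toNat, by omega⟩
  rw [fockVar_natCast, fockSubst, MvPolynomial.aeval_X]

/-- The substitution replaces `X_{j,b}(z)` by `c z^d X_{j,w(b)}(z)`. This commutes with the rule for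
passing variables as soon as `w` preserves the pairing, and on the vacuum it produces the scalar and
the shift of the mode. -/
theorem fockSubst_vertexOp [DecidableEq ι] (c : ι → Root → ℂ) (d : ι → Root → ℕ)
    (w : Root → Root) {ε ε' : ℂ}
    (h : ∀ (i : ι) (a : Root) (j : ι) (b : Root), pairing ε i a j b = pairing ε' i (w a) j (w b)) (i : ι) (a : Root) (n : ℤ)
    (p : Fock ι) : fockSubst c d w (vertexOp ε i a n p) =
      MvPolynomial.C (c i a) * vertexOp ε' i (w a) (n - d i a) (fockSubst c d w p) := by
  induction p using fock_induction generalizing n with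
  | one => rw [vertexOp_one, map_one, vertexOp_one, fockSubst_fockVar]
  | add p q hp hq => simp only [map_add, hp, hq, mul_add]
  | smul r p hp => simp only [map_smul, hp, mul_smul_comm]
  | var j b m p hp =>
    rw [map_mul (fockSubst c d w), fockSubst_fockVar, mul_assoc,
      ← MvPolynomial.smul_eq_C_mul (_ * _) (c j b), map_smul, vertexOp_fockVar_mul,
      vertexOp_fockVar_mul, map_sum, MvPolynomial.smul_eq_C_mul, Finset.mul_sum, Finset.mul_sum]
    refine Finset.sum_congr rfl fun s _ => ?_
    rw [map_sum, Finset.mul_sum, Finset.mul_sum]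
    refine Finset.sum_congr rfl fun t _ => ?_
    rw [map_mul, map_mul, fockSubst_fockVar, hp, ← MvPolynomial.algebraMap_eq, AlgHom.commutes,
      h, sub_right_comm m, sub_right_comm n]
    ring

theorem fockSubst_comp (c c' : ι → Root → ℂ) (p : Fock ι) :
    fockSubst c 0 id (fockSubst c' 0 id p) = fockSubst (fun j b => c j b * c' j b) 0 id p := by
  induction p using fock_induction with
  | one => simp
  | add p q hp hq => simp only [map_add, hp, hq]
  | smul r p hp => simp only [map_smul, hp]
  | var j b m p hp =>
    simp only [map_mul, fockSubst_fockVar, hp, ← MvPolynomial.algebraMap_eq, AlgHom.commutes]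
    simp only [MvPolynomial.algebraMap_eq, Pi.zero_apply, Nat.cast_zero, sub_zero, id]
    ring

theorem fockSubst_one (p : Fock ι) : fockSubst (fun _ _ => 1) 0 id p = p := by
  induction p using fock_induction with
  | one => simp
  | add p q hp hq => simp only [map_add, hp, hq]
  | smul r p hp => simp only [map_smul, hp]
  | var j b m p hp => simp [fockSubst_fockVar, hp]

theorem fockSubst_injective {c : ι → Root → ℂ} (hc : ∀ j b, c j b ≠ 0) :
    Function.Injective (fockSubst c 0 id) := by
  refine Function.LeftInverse.injective (g := fockSubst (fun j b => (c j b)⁻¹) 0 id) fun p => ?_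
  rw [fockSubst_comp]
  simp only [inv_mul_cancel₀ (hc _ _), fockSubst_one]

theorem fockVar_ne_zero (i : ι) (a : Root) : fockVar i a 0 ≠ 0 := by
  simp [fockVar]

/-- The mode shifts caused by `e₂₁[0]`. -/
def vacuumShift (s : Finset ι) [DecidableEq ι] (i : ι) (a : Root) : ℤ :=
  if i ∈ s then (match a with | Root.e21 => 2 | Root.e31 => 1) else 0

/-- The scalars equal to `-ε` on the variables `(i,e31)` and to `1` on all other variables. -/
def raiseScalar [DecidableEq ι] (ε : ℂ) (i j : ι) (b : Root) : ℂ :=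
  if j = i then (match b with | Root.e21 => 1 | Root.e31 => -ε) else 1

/-- The linear map `p ↦ fockVar i e21 0 * ρ(p)`, where `ρ` rescales the variables `(i,e31)`. -/
def raise [DecidableEq ι] (ε : ℂ) (i : ι) : Fock ι →ₗ[ℂ] Fock ι :=
  (LinearMap.mulLeft ℂ (fockVar i Root.e21 0)).comp
    (fockSubst (raiseScalar ε i) 0 id).toLinearMap

theorem raise_apply [DecidableEq ι] (ε : ℂ) (i : ι) (p : Fock ι) :
    raise ε i p = fockVar i Root.e21 0 * fockSubst (raiseScalar ε i) 0 id p := rfl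

theorem raise_injective [DecidableEq ι] {ε : ℂ} (hε : ε ≠ 0) (i : ι) :
    Function.Injective (raise ε i) := by
  intro p q h
  rw [raise_apply, raise_apply] at h
  refine fockSubst_injective (fun j b => ?_) (mul_left_cancel₀ (fockVar_ne_zero i Root.e21) h)
  unfold raiseScalar
  split_ifs
  · cases b
    · exact one_ne_zero
    · exact neg_ne_zero.2 hε
  · exact one_ne_zero

theorem raise_one [DecidableEq ι] (ε : ℂ) (i : ι) : raise ε i 1 = fockVar i Root.e21 0 := by
  rw [raise_apply, map_one, mul_one]

/-- Variables of negative index are zero, so passing `fockVar i e21 0` retains only the part of the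
pairing polynomial free of `z`: `x²` for `e₂₁`, `-εx` for `e₃₁`, and `1` at other sites. The powers
of `x` are the shifts, and the rescaling inside `raise` absorbs `-ε`. -/
theorem vertexOp_raise [DecidableEq ι] (ε : ℂ) (i j : ι) (a : Root) (n : ℤ) (p : Fock ι) :
    vertexOp ε j a n (raise ε i p) = raise ε i (vertexOp ε j a (n - vacuumShift {i} j a) p) := by
  have h0 : ∀ b, fockVar i b (-1) = 0 := fun b => fockVar_of_neg _ _ (by omega)
  have h1 : ∀ b, fockVar i b (-2) = 0 := fun b => fockVar_of_neg _ _ (by omega)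
  rw [raise_apply, raise_apply,
    fockSubst_vertexOp _ _ id (ε' := ε) (fun _ _ _ _ => rfl), vertexOp_fockVar_mul]
  by_cases hj : j = i
  · subst hj
    cases a
    · simp [Fin.sum_univ_three, pairing, rootPairing, vacuumShift, raiseScalar, h0, h1]
    · simp [Fin.sum_univ_three, pairing, rootPairing, vacuumShift, raiseScalar, h0]
      ring
  · simp [Fin.sum_univ_three, pairing, hj, vacuumShift, raiseScalar]

/-- Applying the zero mode of `e₂₁` to the vacuum at each site of `s` yields a vector that behaves
like a vacuum with shifted modes. Injectivity of `T` lets vanishing be tested on that new vacuum. -/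
theorem exists_raise [DecidableEq ι] {ε : ℂ} (hε : ε ≠ 0) (s : Finset ι) :
    ∃ T : Fock ι →ₗ[ℂ] Fock ι, Function.Injective T ∧
      (∀ i a n p, vertexOp ε i a n (T p) = T (vertexOp ε i a (n - vacuumShift s i a) p)) ∧
      T 1 = VertexAlg.toEnd ε (∏ i ∈ s, vertexElt ε i Root.e21 0) 1 := by
  induction s using Finset.induction_on with
  | empty => exact ⟨LinearMap.id, fun _ _ h => h, by simp [vacuumShift], by simp⟩
  | insert j s hj ih =>
    obtain ⟨T, hT, hTop, hT1⟩ := ih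
    refine ⟨T.comp (raise ε j), hT.comp (raise_injective hε j), fun i a n p => ?_, ?_⟩
    · have hv : vacuumShift s i a + vacuumShift {j} i a = vacuumShift (insert j s) i a := by
        simp only [vacuumShift, Finset.mem_insert, Finset.mem_singleton]
        by_cases h1 : i = j
        · subst h1; simp [hj]
        · simp [h1]
      rw [LinearMap.comp_apply, hTop, vertexOp_raise, LinearMap.comp_apply, sub_sub, hv]
    · rw [LinearMap.comp_apply, raise_one, ← vertexOp_one ε,
        Finset.prod_insert hj, map_mul, Module.End.mul_apply, ← hT1, toEnd_vertexElt,
        hTop]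
      simp [vacuumShift, hj]

/-! ### The annihilator of the vacuum vector -/

theorem action_mode_apply [Fintype ι] [DecidableEq ι] (ε : ℂ) (sh : ι → Root → ℤ) (a : Root)
    (n : ℤ) (p : Fock ι) :
    VertexAlg.toEnd ε (action ε sh (mode a n)) p = ∑ i, vertexOp ε i a (-n - sh i a) p := by
  rw [action_mode, map_sum, LinearMap.sum_apply]
  rfl

theorem action_intertwine [Fintype ι] [DecidableEq ι] {ε ε' : ℂ} {sh sh' : ι → Root → ℤ}
    (T : Fock ι →ₗ[ℂ] Fock ι) (f : UA →ₐ[ℂ] UA)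
    (h : ∀ a n p, T (VertexAlg.toEnd ε (action ε sh (mode a n)) p) = VertexAlg.toEnd ε' (action ε' sh' (f (mode a n))) (T p))
    (u : UA) (p : Fock ι) : T (VertexAlg.toEnd ε (action ε sh u) p) = VertexAlg.toEnd ε' (action ε' sh' (f u)) (T p) := by
  induction u using MvPolynomial.induction_on generalizing p with
  | C c =>
    rw [← MvPolynomial.algebraMap_eq, AlgHom.commutes, AlgHom.commutes, AlgHom.commutes,
      AlgHom.commutes, AlgHom.commutes, Module.algebraMap_end_apply, Module.algebraMap_end_apply,
      map_smul]
  | add u v hu hv => simp [map_add, hu, hv]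
  | mul_X u x hu =>
    have := h x.1 x.2
    rw [mode] at this
    simp only [map_mul, Module.End.mul_apply, hu, this]

/-- The ideal of elements of `U(â)` that annihilate the vacuum vector. -/
def vacuumAnn [Fintype ι] [DecidableEq ι] (ε : ℂ) (sh : ι → Root → ℤ) : Ideal UA where
  carrier := {u | VertexAlg.toEnd ε (action ε sh u) 1 = 0}
  add_mem' {u v} hu hv := by
    simp only [Set.mem_ofPred_eq] at hu hv ⊢
    simp [map_add, hu, hv]
  zero_mem' := by simp
  smul_mem' c u hu := by
    simp only [Set.mem_ofPred_eq] at hu ⊢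
    simp [hu]

theorem mem_vacuumAnn [Fintype ι] [DecidableEq ι] {ε : ℂ} {sh : ι → Root → ℤ} {u : UA} :
    u ∈ vacuumAnn ε sh ↔ VertexAlg.toEnd ε (action ε sh u) 1 = 0 := Iff.rfl

theorem C_mem_vacuumAnn [Fintype ι] [DecidableEq ι] {ε : ℂ} {sh : ι → Root → ℤ} {c : ℂ} :
    MvPolynomial.C c ∈ vacuumAnn ε sh ↔ c = 0 := by
  rw [mem_vacuumAnn, ← MvPolynomial.algebraMap_eq, AlgHom.commutes, AlgHom.commutes]
  simp [Module.algebraMap_end_apply, MvPolynomial.smul_eq_C_mul]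

/-- The substitution `X_{i,a}(z) ↦ z^(sh' - sh) X_{i,a}(z)` fixes `1` and intertwines the two
actions. -/
theorem vacuumAnn_mono [Fintype ι] [DecidableEq ι] (ε : ℂ) {sh sh' : ι → Root → ℤ}
    (h : ∀ i a, sh i a ≤ sh' i a) : vacuumAnn ε sh ≤ vacuumAnn ε sh' := by
  intro u hu
  have := action_intertwine (ε := ε) (ε' := ε) (sh := sh) (sh' := sh')
    (fockSubst (fun _ _ => 1) (fun i a => (sh' i a - sh i a).toNat) id).toLinearMap
    (AlgHom.id ℂ UA) (fun a n p => ?_) u 1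
  · rw [mem_vacuumAnn] at hu
    rw [hu] at this
    simpa [mem_vacuumAnn] using this.symm
  · rw [action_mode_apply, AlgHom.id_apply, action_mode_apply, map_sum]
    refine Finset.sum_congr rfl fun i _ => ?_
    rw [AlgHom.toLinearMap_apply, AlgHom.toLinearMap_apply,
      fockSubst_vertexOp _ _ id (ε' := ε) (fun _ _ _ _ => rfl), map_one, one_mul, Int.toNat_of_nonneg (by have := h i a; omega), id]
    congr 2
    ring

/-- The involution of the roots. -/
def Root.swap : Root → Root
  | Root.e21 => Root.e31
  | Root.e31 => Root.e21

/-- `x - z` appears with opposite signs for the two orders of the roots. Exchanging the roots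
therefore changes `ε` to `-ε`, so the parameter cannot be fixed once and for all. -/
theorem pairing_swap [DecidableEq ι] (ε : ℂ) (i : ι) (a : Root) (j : ι) (b : Root) :
    pairing ε i a j b = pairing (-ε) i a.swap j b.swap := by
  unfold pairing
  split_ifs
  · cases a <;> cases b <;> simp [rootPairing, Root.swap]
  · rfl

/-- Exchanging the two families of variables intertwines the action with its twist by `shift`. The
extra `+1` compensates the mode lost when `shift` turns `e₃₁[n]` into `e₂₁[n-1]`. -/
theorem mem_vacuumAnn_of_shift [Fintype ι] [DecidableEq ι] {ε : ℂ} {sh sh' : ι → Root → ℤ}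
    (h21 : ∀ i, sh' i Root.e21 = sh i Root.e31 + 1) (h31 : ∀ i, sh' i Root.e31 = sh i Root.e21)
    {u : UA} (hu : shift u ∈ vacuumAnn ε sh') : u ∈ vacuumAnn (-ε) sh := by
  have := action_intertwine (ε := ε) (ε' := -ε) (sh := sh') (sh' := sh)
    (fockSubst (fun _ _ => 1) 0 Root.swap).toLinearMap
    (shift.symm : UA →ₐ[ℂ] UA) (fun a n p => ?_) (shift u) 1
  · rw [mem_vacuumAnn] at hu
    rw [hu] at this
    simpa [mem_vacuumAnn] using this.symm
  · rw [action_mode_apply, map_sum]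
    have hs : ∀ (b : Root) (m : ℤ), (shift.symm : UA →ₐ[ℂ] UA) (mode a n) = mode b m →
        (∀ i, (fockSubst (fun _ _ => 1) 0 Root.swap).toLinearMap
          (vertexOp ε i a (-n - sh' i a) p) = vertexOp (-ε) i b (-m - sh i b)
            ((fockSubst (fun _ _ => 1) 0 Root.swap).toLinearMap p)) →
        ∑ i, (fockSubst (fun _ _ => 1) 0 Root.swap).toLinearMap
          (vertexOp ε i a (-n - sh' i a) p) =
          VertexAlg.toEnd (-ε) (action (-ε) sh ((shift.symm : UA →ₐ[ℂ] UA) (mode a n)))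
            ((fockSubst (fun _ _ => 1) 0 Root.swap).toLinearMap p) := by
      intro b m hb hi
      rw [hb, action_mode_apply]
      exact Finset.sum_congr rfl fun i _ => hi i
    cases a with
    | e21 =>
      refine hs Root.e31 (n + 1) ?_ fun i => ?_
      · rw [AlgEquiv.coe_toAlgHom, AlgEquiv.symm_apply_eq, shift_mode_e31, add_sub_cancel_right]
      · rw [AlgHom.toLinearMap_apply, AlgHom.toLinearMap_apply,
          fockSubst_vertexOp _ _ _ (pairing_swap ε), h21]
        simp only [map_one, one_mul, Pi.zero_apply, Nat.cast_zero, sub_zero, Root.swap]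
        congr 2
        ring
    | e31 =>
      refine hs Root.e21 n ?_ fun i => ?_
      · rw [AlgEquiv.coe_toAlgHom, AlgEquiv.symm_apply_eq, shift_mode_e21]
      · rw [AlgHom.toLinearMap_apply, AlgHom.toLinearMap_apply,
          fockSubst_vertexOp _ _ _ (pairing_swap ε), h31]
        simp only [map_one, one_mul, Pi.zero_apply, Nat.cast_zero, sub_zero, Root.swap]

/-! ### The three types of vacuum vectors and their rotation. -/

/-- The mode shifts of the three fundamental vacuum vectors. -/
def typeShift : Fin 3 → Root → ℤ
  | 0, _ => 0
  | 1, Root.e21 => 1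
  | 1, Root.e31 => 0
  | 2, _ => 1

theorem typeShift_nonneg (t : Fin 3) (a : Root) : 0 ≤ typeShift t a := by
  fin_cases t <;> cases a <;> simp [typeShift]

theorem typeShift_le_one (a : Root) : typeShift 0 a ≤ typeShift 1 a := by
  cases a <;> simp [typeShift]

theorem vertexElt_mul_of_nonpos [DecidableEq ι] (ε : ℂ) (i : ι) (a b : Root) {n m : ℤ}
    (hn : n ≤ 0) (hm : m ≤ 0) : vertexElt ε i a n * vertexElt ε i b m = 0 := by
  rcases hn.lt_or_eq with hn | rfl
  · rw [vertexElt_of_neg ε i a hn, zero_mul]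
  rcases hm.lt_or_eq with hm | rfl
  · rw [vertexElt_of_neg ε i b hm, mul_zero]
  · exact vertexElt_zero_mul ε i a b

theorem action_mode_zero [Fintype ι] [DecidableEq ι] (ε : ℂ) (τ : ι → Fin 3) (a : Root)
    (s : Finset ι) (hs : ∀ i ∉ s, 0 < typeShift (τ i) a) :
    action ε (fun i => typeShift (τ i)) (mode a 0) =
      ∑ i ∈ s, vertexElt ε i a (-typeShift (τ i) a) := by
  rw [action_mode]
  simp only [neg_zero, zero_sub]
  refine (Finset.sum_subset (Finset.subset_univ s) fun i _ hi => ?_).symm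
  exact vertexElt_of_neg ε i a (by have := hs i hi; omega)

theorem map_action_current [Fintype ι] [DecidableEq ι] (ε : ℂ) (sh : ι → Root → ℤ) (a : Root) :
    (current a).map (action ε sh : UA →+* VertexAlg ι ε) = ∑ i, vertexCurrent ε i a (sh i a) := by
  ext1 N
  simp [PowerSeries.coeff_map, coeff_current, action_mode, vertexCurrent]

/-- Each relation is a product of sums over sites in which two factors at the same site multiply to
zero, so the pigeonhole principle applies. The relevant sites are those of type `0` for the top
relation, of types `0` and `1` for the mixed ones, and all `k` of them for the currents. -/
theorem relationIdeal_le_vacuumAnn [Fintype ι] [DecidableEq ι] (ε : ℂ) (τ : ι → Fin 3) {k l₁ l₂ : ℕ}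
    (hk : Fintype.card ι = k) (h₁ : (Finset.univ.filter fun i => τ i = 0).card = l₁)
    (h₂ : (Finset.univ.filter fun i => τ i = 1).card = l₂) :
    relationIdeal k l₁ l₂ ≤ vacuumAnn ε fun i => typeShift (τ i) := by
  have key : ∀ u : UA, action ε (fun i => typeShift (τ i)) u = 0 →
      u ∈ vacuumAnn ε fun i => typeShift (τ i) := by
    intro u hu
    rw [mem_vacuumAnn, hu, map_zero]; rfl
  have hz : ∀ (a b : Root) (i : ι), vertexElt ε i a (-typeShift (τ i) a) *
      vertexElt ε i b (-typeShift (τ i) b) = 0 := fun a b i =>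
    vertexElt_mul_of_nonpos ε i a b (by have := typeShift_nonneg (τ i) a; omega)
      (by have := typeShift_nonneg (τ i) b; omega)
  rw [relationIdeal_le_iff]
  refine ⟨fun a n hn => key _ ?_, key _ ?_, fun α β hab => key _ ?_, fun α β N hab => key _ ?_⟩
  · rw [action_mode]
    exact Finset.sum_eq_zero fun i _ =>
      vertexElt_of_neg ε i a (by have := typeShift_nonneg (τ i) a; omega)
  · rw [map_pow, action_mode_zero ε τ _ (Finset.univ.filter fun i => τ i = 0)]
    · have := pow_mul_pow_sum_eq_zero (Finset.univ.filter fun i => τ i = 0)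
        (fun a i => vertexElt ε i a (-typeShift (τ i) a)) hz (α := l₁ + 1) (β := 0) (by omega)
      rwa [pow_zero, mul_one] at this
    · intro i hi
      have : τ i ≠ 0 := by simpa using hi
      generalize τ i = t at this
      fin_cases t <;> simp_all [typeShift]
  · have hs : ∀ a, ∀ i ∉ Finset.univ.filter (fun i => τ i = 0) ∪
        Finset.univ.filter (fun i => τ i = 1), 0 < typeShift (τ i) a := by
      intro a i hi
      have : ¬ (τ i = 0 ∨ τ i = 1) := by simpa using hi
      generalize τ i = t at this
      fin_cases t <;> simp_all [typeShift]
    rw [map_mul, map_pow, map_pow, action_mode_zero ε τ _ _ (hs _), action_mode_zero ε τ _ _ (hs _)]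
    refine pow_mul_pow_sum_eq_zero _ (fun a i => vertexElt ε i a (-typeShift (τ i) a)) hz ?_
    refine lt_of_le_of_lt (Finset.card_union_le _ _) (by omega)
  · have := PowerSeries.coeff_map (action ε (fun i => typeShift (τ i)) : UA →+* VertexAlg ι ε) N
      (current Root.e21 ^ α * current Root.e31 ^ β)
    rw [map_mul, map_pow, map_pow, map_action_current, map_action_current,
      pow_mul_pow_sum_eq_zero Finset.univ (fun a i => vertexCurrent ε i a (typeShift (τ i) a))
        (fun a b i => vertexCurrent_mul ε i a b (typeShift_nonneg _ _) (typeShift_nonneg _ _))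
        (by rw [Finset.card_univ]; omega), map_zero] at this
    exact this.symm

/-- The rotation of the types that corresponds to `shift`. -/
def rotate (t : Fin 3) : Fin 3 := t + 2

/-- The zero mode of `e₂₁` acts only at the `l` sites of type `0`, so its `l`-th power is `l!` times
the product of the single-site operators. `exists_raise` turns the resulting vector into a shifted
vacuum, and undoing `shift` leaves a vacuum of rotated type. -/
theorem mem_vacuumAnn_rotate [Fintype ι] [DecidableEq ι] {ε : ℂ} (hε : ε ≠ 0) (τ : ι → Fin 3)
    {l : ℕ} (h : (Finset.univ.filter fun i => τ i = 0).card = l) {u : UA}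
    (hu : mode Root.e21 0 ^ l * shift u ∈ vacuumAnn ε fun i => typeShift (τ i)) :
    u ∈ vacuumAnn (-ε) fun i => typeShift (rotate (τ i)) := by
  set s := Finset.univ.filter fun i => τ i = 0 with hs
  obtain ⟨T, hT, hTop, hT1⟩ := exists_raise hε s
  have hint := action_intertwine (ε := ε) (ε' := ε)
    (sh := fun i a => typeShift (τ i) a + vacuumShift s i a)
    (sh' := fun i => typeShift (τ i)) T (AlgHom.id ℂ UA) (fun a n p => by
      rw [AlgHom.id_apply, action_mode_apply, action_mode_apply, map_sum]
      refine Finset.sum_congr rfl fun i _ => ?_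
      rw [hTop, sub_sub])
  have hx : action ε (fun i => typeShift (τ i)) (mode Root.e21 0 ^ l) =
      (l.factorial : VertexAlg ι ε) * ∏ i ∈ s, vertexElt ε i Root.e21 0 := by
    rw [map_pow, action_mode_zero ε τ _ s]
    · have := sum_pow_card s (fun i => vertexElt ε i Root.e21 0)
        (fun i => vertexElt_zero_mul ε i _ _)
      rw [h] at this
      rw [← this]
      refine congrArg (· ^ l) (Finset.sum_congr rfl fun i hi => ?_)
      have : τ i = 0 := by simpa [hs] using hi
      rw [this]; rfl
    · intro i hi
      have : τ i ≠ 0 := by simpa [hs] using hi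
      generalize τ i = t at this
      fin_cases t <;> simp_all [typeShift]
  have h0 : shift u ∈ vacuumAnn ε fun i a => typeShift (τ i) a + vacuumShift s i a := by
    rw [mem_vacuumAnn] at hu ⊢
    rw [map_mul, hx, mul_assoc, mul_comm (∏ i ∈ s, vertexElt ε i Root.e21 0), map_mul, map_mul,
      Module.End.mul_apply, Module.End.mul_apply, ← hT1] at hu
    have hint1 := hint (shift u) 1
    rw [AlgHom.id_apply] at hint1
    rw [← hint1] at hu
    have hcast : ∀ p : Fock ι,
        VertexAlg.toEnd ε (l.factorial : VertexAlg ι ε) p = (l.factorial : ℂ) • p := by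
      intro p
      rw [map_natCast]
      simp [MvPolynomial.smul_eq_C_mul]
    rw [hcast, smul_eq_zero] at hu
    rcases hu with hu | hu
    · exact absurd hu (Nat.cast_ne_zero.2 (Nat.factorial_ne_zero l))
    · exact hT (hu.trans (map_zero T).symm)
  -- After raising, types `0, 1, 2` have shifts `(2,1)`, `(1,0)`, `(1,1)` on `(e21, e31)`. Undoing
  -- `shift` turns them into `(1,1)`, `(0,0)`, `(1,0)`, which are the types `2, 0, 1`.
  refine mem_vacuumAnn_of_shift (fun i => ?_) (fun i => ?_) h0
  all_goals
    have hi : (i ∈ s) ↔ τ i = 0 := by simp [hs]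
    simp only [vacuumShift, hi]
    generalize τ i = t
    fin_cases t <;> simp [typeShift, rotate]

end VacuumAnnihilator

/-! ### Degrees -/

theorem weight_snd_le (e : Root × ℤ →₀ ℕ) :
    (Finsupp.weight modeDegree e).2.1 ≤ (Finsupp.weight modeDegree e).1 := by
  induction e using Finsupp.induction_linear with
  | zero => simp
  | add e f he hf => rw [map_add]; exact add_le_add he hf
  | single x n =>
    obtain ⟨_ | _, m⟩ := x <;> simp [Finsupp.weight_single, modeDegree]

theorem weight_fst (e : Root × ℤ →₀ ℕ) : (Finsupp.weight modeDegree e).1 = e.degree := by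
  induction e using Finsupp.induction_linear with
  | zero => simp
  | add e f he hf => rw [map_add, Prod.fst_add, he, hf, map_add]
  | single x n =>
    obtain ⟨_ | _, m⟩ := x <;> simp [Finsupp.weight_single, modeDegree]

theorem exists_pos_of_weight_neg (e : Root × ℤ →₀ ℕ) (h : (Finsupp.weight modeDegree e).2.2 < 0) :
    ∃ a n, 0 < n ∧ e (a, n) ≠ 0 := by
  by_contra! hcon
  revert h
  rw [imp_false, not_lt, Finsupp.weight_apply, Finsupp.sum, Prod.snd_sum, Prod.snd_sum]
  refine Finset.sum_nonneg fun x hx => ?_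
  obtain ⟨a, n⟩ := x
  have hn : n ≤ 0 := by
    by_contra hn
    exact Finsupp.mem_support_iff.1 hx (hcon a n (not_le.1 hn))
  cases a <;> simp only [modeDegree, Prod.smul_snd] <;>
    exact nsmul_nonneg (by omega) _

theorem weight_mapDomain (e : Root × ℤ →₀ ℕ) :
    (Finsupp.weight modeDegree (e.mapDomain shiftIndex)).1 = (Finsupp.weight modeDegree e).1 ∧
    (Finsupp.weight modeDegree (e.mapDomain shiftIndex)).2.1 + (Finsupp.weight modeDegree e).2.1 =
      (Finsupp.weight modeDegree e).1 ∧
    (Finsupp.weight modeDegree (e.mapDomain shiftIndex)).2.2 =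
      (Finsupp.weight modeDegree e).2.2 + (Finsupp.weight modeDegree e).2.1 := by
  induction e using Finsupp.induction_linear with
  | zero => simp
  | add e f he hf =>
    rw [Finsupp.mapDomain_add, map_add, map_add]
    simp only [Prod.fst_add, Prod.snd_add, Nat.cast_add]
    omega
  | single x n =>
    rw [Finsupp.mapDomain_single]
    obtain ⟨_ | _, m⟩ := x
    · simp [Finsupp.weight_single, modeDegree, shiftIndex]
    · simp [Finsupp.weight_single, modeDegree, shiftIndex]
      ring

/-- On degrees `shift` is `(m₁, m₂, d) ↦ (m₁, m₁ - m₂, d + m₂)`, which on characters is the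
substitution `(z₁,z₂) ↦ (z₁z₂, q/z₂)`. Writing `m₁ = a + b`, `m₂ = b` avoids truncated subtraction.
-/
theorem shift_mem_homog {a b : ℕ} {d : ℤ} {u : UA} :
    shift u ∈ homog (b + a, a, d + b) ↔ u ∈ homog (a + b, b, d) := by
  have hcoeff : ∀ e, (shift u).coeff (e.mapDomain shiftIndex) = u.coeff e := fun e =>
    MvPolynomial.coeff_rename_mapDomain _ shiftIndex.injective _ _
  have hiff : ∀ e : Root × ℤ →₀ ℕ,
      Finsupp.weight modeDegree (e.mapDomain shiftIndex) = (b + a, a, d + b) ↔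
        Finsupp.weight modeDegree e = (a + b, b, d) := by
    intro e
    obtain ⟨h1, h2, h3⟩ := weight_mapDomain e
    simp only [Prod.ext_iff]
    omega
  simp only [MvPolynomial.mem_weightedHomogeneousSubmodule, MvPolynomial.IsWeightedHomogeneous]
  constructor
  · intro h e he
    rw [← hiff]
    exact h (by rwa [hcoeff])
  · intro h e he
    obtain ⟨e, rfl⟩ : ∃ f : Root × ℤ →₀ ℕ, e = f.mapDomain shiftIndex :=
      ⟨e.mapDomain shiftIndex.symm, by
        rw [← Finsupp.mapDomain_comp, Equiv.self_comp_symm, Finsupp.mapDomain_id]⟩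
    rw [hcoeff] at he
    exact (hiff e).2 (h he)

theorem homog_eq_zero {m₁ m₂ : ℕ} {d : ℤ} (h : m₁ < m₂) {u : UA} (hu : u ∈ homog (m₁, m₂, d)) :
    u = 0 := by
  ext e
  by_contra he
  have h1 := hu he
  have := weight_snd_le e
  rw [h1] at this
  exact absurd this (not_le.2 h)

theorem homog_zero {m₂ : ℕ} {d : ℤ} {u : UA} (hu : u ∈ homog (0, m₂, d)) :
    ∃ c : ℂ, u = MvPolynomial.C c ∧ (d ≠ 0 → c = 0) := by
  have key : ∀ e, u.coeff e ≠ 0 → e = 0 ∧ d = 0 := by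
    intro e he
    have h1 := hu he
    have h2 := weight_fst e
    rw [h1] at h2
    have h3 : e = 0 := (Finsupp.degree_eq_zero_iff e).1 h2.symm
    refine ⟨h3, ?_⟩
    rw [h3, map_zero] at h1
    exact (congrArg (fun x => x.2.2) h1).symm
  refine ⟨u.coeff 0, ?_, fun hd => ?_⟩
  · classical
    ext e
    rw [MvPolynomial.coeff_C]
    split_ifs with h
    · rw [h]
    · by_contra he
      exact h (key e he).1.symm
  · by_contra he
    exact hd (key 0 he).2

/-- A monomial with `d < 0` must contain a positive mode, and positive modes kill the cyclic vector.
-/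
theorem mem_relationIdeal_of_neg {k l₁ l₂ m₁ m₂ : ℕ} {d : ℤ} (hd : d < 0) {u : UA}
    (hu : u ∈ homog (m₁, m₂, d)) : u ∈ relationIdeal k l₁ l₂ := by
  rw [u.as_sum]
  refine Ideal.sum_mem _ fun e he => ?_
  have hw := hu (MvPolynomial.mem_support_iff.1 he)
  obtain ⟨a, n, hn, hne⟩ := exists_pos_of_weight_neg e (by rw [hw]; exact hd)
  have : mode a n ∣ MvPolynomial.monomial e (u.coeff e) := by
    rw [mode, MvPolynomial.X_dvd_monomial]
    exact Or.inr hne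
  exact Ideal.mem_of_dvd _ this (mem_relationIdeal_pos _ _ _ a hn)

/-- Multiplication by `e₂₁[0]^l` adds `l` to `m₁ - m₂`, which is never negative on monomials. Hence
nothing lies in degrees with `a < l`, and elsewhere the component is again a multiple. -/
theorem component_pow_mul (l a b : ℕ) (d : ℤ) (x : UA) :
    (a < l → MvPolynomial.weightedHomogeneousComponent modeDegree (a + b, b, d)
      (mode Root.e21 0 ^ l * x) = 0) ∧
    (l ≤ a → ∃ y ∈ homog (a - l + b, b, d),
      MvPolynomial.weightedHomogeneousComponent modeDegree (a + b, b, d)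
        (mode Root.e21 0 ^ l * x) = mode Root.e21 0 ^ l * y) := by
  induction x using MvPolynomial.induction_on' with
  | monomial e c =>
    have hx : mode Root.e21 0 ^ l * MvPolynomial.monomial e c ∈
        homog ((l, 0, 0) + Finsupp.weight modeDegree e) := by
      refine MvPolynomial.IsWeightedHomogeneous.mul ?_
        (MvPolynomial.isWeightedHomogeneous_monomial _ _ _ rfl)
      have := (isWeightedHomogeneous_mode Root.e21 0).pow l
      simpa [modeDegree] using this
    have hle := weight_snd_le e
    by_cases h : (l, 0, 0) + Finsupp.weight modeDegree e = (a + b, b, d)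
    · have hwe : l ≤ a ∧ Finsupp.weight modeDegree e = (a - l + b, b, d) := by
        simp only [Prod.ext_iff, Prod.fst_add, Prod.snd_add] at h ⊢
        omega
      refine ⟨fun hlt => absurd hwe.1 (not_le.2 hlt), fun _ => ⟨MvPolynomial.monomial e c,
        MvPolynomial.isWeightedHomogeneous_monomial _ _ _ hwe.2, ?_⟩⟩
      rw [← h]
      exact MvPolynomial.IsWeightedHomogeneous.weightedHomogeneousComponent_same hx
    · have h0 := MvPolynomial.IsWeightedHomogeneous.weightedHomogeneousComponent_ne _ hx (Ne.symm h)
      exact ⟨fun _ => h0, fun _ => ⟨0, Submodule.zero_mem _, by rw [h0, mul_zero]⟩⟩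
  | add p q hp hq =>
    refine ⟨fun h => by rw [mul_add, map_add, hp.1 h, hq.1 h, add_zero], fun h => ?_⟩
    obtain ⟨y, hy, hy'⟩ := hp.2 h
    obtain ⟨z, hz, hz'⟩ := hq.2 h
    exact ⟨y + z, Submodule.add_mem _ hy hz, by rw [mul_add, map_add, hy', hz', mul_add]⟩

/-! ### The defining relations are complete -/

/-- The annihilator of the cyclic vector of the quotient `X^k_{l₁-1,l₂+1}` of `X^k_{l₁,l₂}`, which
is zero for `l₁ = 0`. -/
def quotientIdeal (k : ℕ) : ℕ → ℕ → Ideal UA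
  | 0, _ => ⊤
  | l₁ + 1, l₂ => relationIdeal k l₁ (l₂ + 1)

theorem quotientIdeal_le (k l₁ l₂ : ℕ) :
    quotientIdeal k l₁ l₂ ≤ relationIdeal k l₁ l₂ ⊔ Ideal.span {mode Root.e21 0 ^ l₁} := by
  cases l₁ with
  | zero =>
    intro u _
    refine Ideal.mem_sup_right ?_
    simp
  | succ l₁ => exact relationIdeal_succ_le k l₁ l₂

theorem relationIdeal_le_quotientIdeal (k l₁ l₂ : ℕ) :
    relationIdeal k l₁ l₂ ≤ quotientIdeal k l₁ l₂ := by
  cases l₁ with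
  | zero => exact le_top
  | succ l₁ => exact relationIdeal_le_succ k l₁ l₂

theorem pow_mem_quotientIdeal (k l₁ l₂ : ℕ) : mode Root.e21 0 ^ l₁ ∈ quotientIdeal k l₁ l₂ := by
  cases l₁ with
  | zero => exact Submodule.mem_top
  | succ l₁ => exact mem_relationIdeal_top _ _ _

/-- This is exactness in the middle, degree by degree: an element that dies in the quotient is
`e₂₁[0]^l₁ shift w` modulo the relations, with `w` homogeneous. If `a < l₁` the kernel has no room
in this degree. -/
theorem exists_sub_mem_of_mem_quotientIdeal {k l₁ l₂ a b : ℕ} {d : ℤ} {u : UA}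
    (hu : u ∈ homog (a + b, b, d)) (h : u ∈ quotientIdeal k l₁ l₂) :
    (a < l₁ → u ∈ relationIdeal k l₁ l₂) ∧
    (l₁ ≤ a → ∃ w ∈ homog (b + (a - l₁), a - l₁, d - (a - l₁ : ℕ)),
      u - mode Root.e21 0 ^ l₁ * shift w ∈ relationIdeal k l₁ l₂) := by
  obtain ⟨r, hr, x, hx, rfl⟩ := Submodule.mem_sup.1 (quotientIdeal_le k l₁ l₂ h)
  obtain ⟨x, rfl⟩ := Ideal.mem_span_singleton'.1 hx
  have hr' := component_mem_relationIdeal hr (a + b, b, d)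
  have hc := MvPolynomial.IsWeightedHomogeneous.weightedHomogeneousComponent_same hu
  obtain ⟨h1, h2⟩ := component_pow_mul l₁ a b d x
  rw [map_add, mul_comm x] at hc
  rw [mul_comm x]
  refine ⟨fun hlt => ?_, fun hle => ?_⟩
  · rw [h1 hlt, add_zero] at hc
    rwa [← hc]
  · obtain ⟨y, hy, hy'⟩ := h2 hle
    refine ⟨shift.symm y, ?_, ?_⟩
    · rw [← shift_mem_homog, AlgEquiv.apply_symm_apply, sub_add_cancel]
      exact hy
    · rw [AlgEquiv.apply_symm_apply, ← hc, hy', add_sub_cancel_right]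
      exact hr'

theorem card_rotate {ι : Type} [Fintype ι] {τ : ι → Fin 3} {l₁ l₂ l₃ : ℕ}
    (hk : Fintype.card ι = l₁ + l₂ + l₃)
    (h₁ : (Finset.univ.filter fun i => τ i = 0).card = l₁)
    (h₂ : (Finset.univ.filter fun i => τ i = 1).card = l₂) :
    (Finset.univ.filter fun i => rotate (τ i) = 0).card = l₂ ∧
    (Finset.univ.filter fun i => rotate (τ i) = 1).card = l₃ := by
  have h3 : ∀ t : Fin 3, (rotate t = 0 ↔ t = 1) ∧ (rotate t = 1 ↔ t = 2) := by decide
  simp only [h3]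
  refine ⟨h₂, ?_⟩
  have := Finset.card_eq_sum_card_fiberwise (s := (Finset.univ : Finset ι)) (f := τ)
    (t := Finset.univ) (by simp)
  rw [Finset.card_univ, hk, Fin.sum_univ_three, h₁, h₂] at this
  omega

theorem mem_relationIdeal_of_mem_vacuumAnn_of_charge_zero {ι : Type} [Fintype ι] [DecidableEq ι]
    {ε : ℂ} {sh : ι → Root → ℤ} {k l₁ l₂ b : ℕ} {d : ℤ} {u : UA}
    (hu : u ∈ homog (0, b, d)) (h : u ∈ vacuumAnn ε sh) :
    u ∈ relationIdeal k l₁ l₂ := by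
  obtain ⟨c, rfl, -⟩ := homog_zero hu
  rw [C_mem_vacuumAnn.1 h, map_zero]
  exact Submodule.zero_mem _

theorem vacuumAnn_le_update {ι : Type} [Fintype ι] [DecidableEq ι] (ε : ℂ) (τ : ι → Fin 3) {i₀ : ι}
    (h : τ i₀ = 0) : vacuumAnn ε (fun i => typeShift (τ i)) ≤
      vacuumAnn ε fun i => typeShift (Function.update τ i₀ 1 i) := by
  refine vacuumAnn_mono ε fun i a => ?_
  by_cases hi : i = i₀
  · subst hi
    rw [Function.update_self, h]
    exact typeShift_le_one a
  · rw [Function.update_of_ne hi]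

/-- The defining relations are complete. The descent quantity `2d + b` is chosen because passing
from `u` to `w` lowers it by `b + (a - l₁)`. This is positive unless `w` has charge zero, where only
constants occur. The statement is kept uniform in `ε` and `τ` because a step changes both. -/
theorem mem_relationIdeal_of_mem_vacuumAnn {ι : Type} [Fintype ι] [DecidableEq ι] {k : ℕ}
    (hk : Fintype.card ι = k) (N : ℕ) (l₁ l₂ l₃ : ℕ) (hl : l₁ + l₂ + l₃ = k) (a b : ℕ) (d : ℤ)
    (hN : 2 * d + b < N) {ε : ℂ} (hε : ε ≠ 0) (τ : ι → Fin 3)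
    (h₁ : (Finset.univ.filter fun i => τ i = 0).card = l₁)
    (h₂ : (Finset.univ.filter fun i => τ i = 1).card = l₂) {u : UA}
    (hu : u ∈ homog (a + b, b, d)) (h : u ∈ vacuumAnn ε fun i => typeShift (τ i)) :
    u ∈ relationIdeal k l₁ l₂ := by
  induction N generalizing l₁ l₂ l₃ a b d ε τ u with
  | zero => exact mem_relationIdeal_of_neg (by omega) hu
  | succ N ihN =>
    by_cases hd : d < 0
    · exact mem_relationIdeal_of_neg hd hu
    by_cases hab : a + b = 0
    · rw [hab] at hu
      exact mem_relationIdeal_of_mem_vacuumAnn_of_charge_zero hu h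
    -- If `u` vanishes in the quotient, then `u ≡ e₂₁[0]^l₁ shift w`. Since `u` kills the vacuum,
    -- `w` kills the rotated one, and the outer induction puts `w` into the relation ideal for `(l₂,
    -- l₃)`.
    have key : ∀ (l₁ l₂ : ℕ) (_ : l₁ + l₂ + l₃ = k) (τ : ι → Fin 3)
        (_ : (Finset.univ.filter fun i => τ i = 0).card = l₁)
        (_ : (Finset.univ.filter fun i => τ i = 1).card = l₂)
        (_ : u ∈ vacuumAnn ε fun i => typeShift (τ i)) (_ : u ∈ quotientIdeal k l₁ l₂),
        u ∈ relationIdeal k l₁ l₂ := by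
      intro l₁ l₂ hl τ h₁ h₂ h hq
      obtain ⟨hlt, hle⟩ := exists_sub_mem_of_mem_quotientIdeal hu hq
      rcases lt_or_ge a l₁ with ha | ha
      · exact hlt ha
      obtain ⟨w, hw, hsub⟩ := hle ha
      have hw' := mem_vacuumAnn_rotate hε τ h₁ (u := w) (by
        have := relationIdeal_le_vacuumAnn ε τ hk h₁ h₂ hsub
        simpa using Ideal.sub_mem _ h this)
      have hwR : w ∈ relationIdeal k l₂ l₃ := by
        by_cases h0 : b + (a - l₁) = 0
        · rw [h0] at hw
          exact mem_relationIdeal_of_mem_vacuumAnn_of_charge_zero hw hw'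
        · obtain ⟨hc1, hc2⟩ := card_rotate (hk.trans hl.symm) h₁ h₂
          exact ihN _ _ l₁ (by omega) _ _ _ (by omega) (neg_ne_zero.2 hε) _ hc1 hc2 hw hw'
      have := Ideal.add_mem _ hsub (relationIdeal_shift k l₁ l₂ l₃ hl hwR)
      rwa [sub_add_cancel] at this
    induction l₁ generalizing l₂ τ with
    | zero => exact key 0 l₂ hl τ h₁ h₂ h Submodule.mem_top
    | succ l₁ ih =>
      refine key _ _ hl τ h₁ h₂ h ?_
      -- Turning one site of type `0` into type `1` enlarges the annihilator and changes `(l₁ + 1,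
      -- l₂)` into `(l₁, l₂ + 1)`. The inner induction then shows that `u` dies in the quotient.
      obtain ⟨i₀, hi₀⟩ := Finset.card_pos.1 (h₁.symm ▸ Nat.succ_pos l₁ :
        0 < (Finset.univ.filter fun i => τ i = 0).card)
      have hi₀ : τ i₀ = 0 := by simpa using hi₀
      refine ih (l₂ + 1) (by omega) (Function.update τ i₀ 1) ?_ ?_
        (vacuumAnn_le_update ε τ hi₀ h)
      · have : (Finset.univ.filter fun i => Function.update τ i₀ 1 i = 0) =
            (Finset.univ.filter fun i => τ i = 0).erase i₀ := by
          ext i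
          by_cases hi : i = i₀
          · subst hi; simp
          · simp [hi]
        rw [this, Finset.card_erase_of_mem (by simpa using hi₀), h₁]
        rfl
      · have : (Finset.univ.filter fun i => Function.update τ i₀ 1 i = 1) =
            insert i₀ (Finset.univ.filter fun i => τ i = 1) := by
          ext i
          by_cases hi : i = i₀
          · subst hi; simp
          · simp [hi]
        rw [this, Finset.card_insert_of_notMem (by simp [hi₀]), h₂]

/-- A tensor product of `l₁`, `l₂`, `l₃` copies of the three fundamental modules. -/
def standardType (l₁ l₂ l₃ : ℕ) : Fin l₁ ⊕ Fin l₂ ⊕ Fin l₃ → Fin 3 :=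
  Sum.elim (fun _ => 0) (Sum.elim (fun _ => 1) fun _ => 2)

theorem card_standardType_zero (l₁ l₂ l₃ : ℕ) :
    (Finset.univ.filter fun i => standardType l₁ l₂ l₃ i = 0).card = l₁ := by
  rw [Finset.card_filter, Fintype.sum_sum_type, Fintype.sum_sum_type]
  simp [standardType]

theorem card_standardType_one (l₁ l₂ l₃ : ℕ) :
    (Finset.univ.filter fun i => standardType l₁ l₂ l₃ i = 1).card = l₂ := by
  rw [Finset.card_filter, Fintype.sum_sum_type, Fintype.sum_sum_type]
  simp [standardType]

/-- This is injectivity of the left map: pass to the vacuum annihilator, rotate, and return by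
completeness. Here `ε = 1` becomes `-1` after the rotation. -/
theorem mem_relationIdeal_of_pow_mul_shift_mem {k l₁ l₂ l₃ a b : ℕ} {d : ℤ}
    (hl : l₁ + l₂ + l₃ = k) {w : UA} (hw : w ∈ homog (a + b, b, d))
    (h : mode Root.e21 0 ^ l₁ * shift w ∈ relationIdeal k l₁ l₂) : w ∈ relationIdeal k l₂ l₃ := by
  have hk : Fintype.card (Fin l₁ ⊕ Fin l₂ ⊕ Fin l₃) = k := by simp; omega
  have h₁ := card_standardType_zero l₁ l₂ l₃
  have h₂ := card_standardType_one l₁ l₂ l₃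
  obtain ⟨hc1, hc2⟩ := card_rotate (hk.trans hl.symm) h₁ h₂
  exact mem_relationIdeal_of_mem_vacuumAnn hk (2 * d + b + 1).toNat l₂ l₃ l₁ (by omega) a b d
    (by omega) (neg_ne_zero.2 one_ne_zero) _ hc1 hc2 hw
    (mem_vacuumAnn_rotate one_ne_zero _ h₁ (relationIdeal_le_vacuumAnn 1 _ hk h₁ h₂ h))

/-! ### The recursion for the dimensions -/

/-- The dimension count for `0 → range F' → range F → range F'' → 0`, with exactness expressed on
representatives. This keeps the three quotient algebras out of the argument. -/
theorem finrank_range_eq_add {V V' A A' A'' : Type*} [AddCommGroup V] [Module ℂ V]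
    [AddCommGroup V'] [Module ℂ V'] [AddCommGroup A] [Module ℂ A] [AddCommGroup A'] [Module ℂ A']
    [AddCommGroup A''] [Module ℂ A''] (F : V →ₗ[ℂ] A) (F' : V' →ₗ[ℂ] A') (F'' : V →ₗ[ℂ] A'')
    (φ : V' →ₗ[ℂ] V) (h' : ∀ w, F (φ w) = 0 ↔ F' w = 0)
    (h'' : ∀ u, F'' u = 0 ↔ ∃ w, F (u - φ w) = 0)
    [Module.Finite ℂ (LinearMap.range F')] [Module.Finite ℂ (LinearMap.range F'')] :
    Module.Finite ℂ (LinearMap.range F) ∧ Module.finrank ℂ (LinearMap.range F) =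
      Module.finrank ℂ (LinearMap.range F'') + Module.finrank ℂ (LinearMap.range F') := by
  have hle : LinearMap.ker F ≤ LinearMap.ker F'' := fun u hu =>
    (h'' u).2 ⟨0, by rw [map_zero, sub_zero]; exact hu⟩
  set β := (LinearMap.ker F).liftQ F'' hle with hβ
  have hr : LinearMap.range β = LinearMap.range F'' := Submodule.range_liftQ _ _ _
  have hk : LinearMap.ker β = LinearMap.range ((LinearMap.ker F).mkQ.comp φ) := by
    ext x
    obtain ⟨u, rfl⟩ := Submodule.mkQ_surjective _ x
    rw [LinearMap.mem_ker, hβ, Submodule.mkQ_apply, Submodule.liftQ_apply, h'']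
    refine exists_congr fun w => ?_
    rw [LinearMap.comp_apply, Submodule.mkQ_apply, eq_comm (b := Submodule.Quotient.mk u),
      Submodule.Quotient.eq, LinearMap.mem_ker]
  have hk' : LinearMap.ker ((LinearMap.ker F).mkQ.comp φ) = LinearMap.ker F' := by
    ext w
    rw [LinearMap.mem_ker, LinearMap.comp_apply, Submodule.mkQ_apply,
      Submodule.Quotient.mk_eq_zero, LinearMap.mem_ker, h', LinearMap.mem_ker]
  have e : LinearMap.ker β ≃ₗ[ℂ] LinearMap.range F' :=
    (LinearEquiv.ofEq _ _ hk).trans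
      ((LinearMap.quotKerEquivRange _).symm.trans
        ((Submodule.quotEquivOfEq _ _ hk').trans (LinearMap.quotKerEquivRange F')))
  have e'' : LinearMap.range β ≃ₗ[ℂ] LinearMap.range F'' := LinearEquiv.ofEq _ _ hr
  have : Module.Finite ℂ (LinearMap.ker β) := Module.Finite.equiv e.symm
  have : Module.Finite ℂ (LinearMap.range β) := Module.Finite.equiv e''.symm
  have : Module.Finite ℂ ((V ⧸ LinearMap.ker F) ⧸ LinearMap.ker β) :=
    Module.Finite.equiv (LinearMap.quotKerEquivRange β).symm
  have : Module.Finite ℂ (V ⧸ LinearMap.ker F) :=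
    Module.Finite.of_submodule_quotient (LinearMap.ker β)
  refine ⟨Module.Finite.equiv (LinearMap.quotKerEquivRange F), ?_⟩
  rw [← (LinearMap.quotKerEquivRange F).finrank_eq, ← e.finrank_eq, ← e''.finrank_eq,
    LinearMap.finrank_range_add_finrank_ker]

/-- The restriction of the quotient map to a homogeneous component. -/
def toQuot (I : Ideal UA) (g : ℕ × ℕ × ℤ) : homog g →ₗ[ℂ] UA ⧸ I :=
  (Ideal.Quotient.mkₐ ℂ I).toLinearMap.comp (homog g).subtype

theorem toQuot_eq_zero {I : Ideal UA} {g : ℕ × ℕ × ℤ} {u : homog g} :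
    toQuot I g u = 0 ↔ (u : UA) ∈ I := Ideal.Quotient.eq_zero_iff_mem

theorem range_toQuot (k l₁ l₂ : ℕ) (g : ℕ × ℕ × ℤ) :
    LinearMap.range (toQuot (relationIdeal k l₁ l₂) g) = piece k l₁ l₂ g := by
  rw [toQuot, LinearMap.range_comp, Submodule.range_subtype, piece]

/-- The multiplication with `e₂₁[0]^l` after `shift` on a homogeneous component. -/
def powMulShift (l a b : ℕ) (d : ℤ) (h : l ≤ a) :
    homog (b + (a - l), a - l, d - (a - l : ℕ)) →ₗ[ℂ] homog (a + b, b, d) :=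
  ((LinearMap.mulLeft ℂ (mode Root.e21 0 ^ l)).comp shift.toLinearMap).restrict fun w hw => by
    have h1 := (shift_mem_homog (a := b) (b := a - l)).2 hw
    rw [sub_add_cancel] at h1
    have h2 := ((isWeightedHomogeneous_mode Root.e21 0).pow l).mul h1
    have h3 : l • modeDegree (Root.e21, 0) + (a - l + b, b, d) = (a + b, b, d) := by
      simp [modeDegree]; omega
    rw [h3] at h2
    exact h2

theorem coe_powMulShift (l a b : ℕ) (d : ℤ) (h : l ≤ a)
    (w : homog (b + (a - l), a - l, d - (a - l : ℕ))) :
    (powMulShift l a b d h w : UA) = mode Root.e21 0 ^ l * shift (w : UA) := rfl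

theorem subsingleton_range_toQuot {I : Ideal UA} {g : ℕ × ℕ × ℤ} (h : ∀ u ∈ homog g, u ∈ I) :
    Subsingleton (LinearMap.range (toQuot I g)) := by
  refine ⟨fun x y => ?_⟩
  obtain ⟨_, u, rfl⟩ := x
  obtain ⟨_, v, rfl⟩ := y
  exact Subtype.ext ((toQuot_eq_zero.2 (h u u.2)).trans (toQuot_eq_zero.2 (h v v.2)).symm)

theorem finite_finrank_toQuot {k l₁ l₂ l₃ : ℕ} (hl : l₁ + l₂ + l₃ = k) (a b : ℕ) (d : ℤ)
    (h'' : Module.Finite ℂ (LinearMap.range (toQuot (quotientIdeal k l₁ l₂) (a + b, b, d))))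
    (h' : l₁ ≤ a → Module.Finite ℂ (piece k l₂ l₃ (b + (a - l₁), a - l₁, d - (a - l₁ : ℕ)))) :
    Module.Finite ℂ (piece k l₁ l₂ (a + b, b, d)) ∧
    charCoeff k l₁ l₂ (a + b) b d =
      Module.finrank ℂ (LinearMap.range (toQuot (quotientIdeal k l₁ l₂) (a + b, b, d))) +
        if l₁ ≤ a then charCoeff k l₂ l₃ (b + (a - l₁)) (a - l₁) (d - (a - l₁ : ℕ)) else 0 := by
  rw [charCoeff, charCoeff, ← range_toQuot, ← range_toQuot]
  by_cases ha : l₁ ≤ a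
  · rw [if_pos ha]
    have := h' ha
    rw [← range_toQuot] at this
    refine finrank_range_eq_add _ _ _ (powMulShift l₁ a b d ha) (fun w => ?_) fun u => ?_
    · rw [toQuot_eq_zero, toQuot_eq_zero, coe_powMulShift]
      exact ⟨mem_relationIdeal_of_pow_mul_shift_mem hl w.2,
        fun h => relationIdeal_shift k l₁ l₂ l₃ hl h⟩
    · simp only [toQuot_eq_zero, AddSubgroupClass.coe_sub, coe_powMulShift]
      constructor
      · intro h
        obtain ⟨w, hw, hw'⟩ := (exists_sub_mem_of_mem_quotientIdeal u.2 h).2 ha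
        exact ⟨⟨w, hw⟩, hw'⟩
      · rintro ⟨w, hw⟩
        have := Ideal.add_mem _ (relationIdeal_le_quotientIdeal k l₁ l₂ hw)
          (Ideal.mul_mem_right (shift (w : UA)) _ (pow_mem_quotientIdeal k l₁ l₂))
        rwa [sub_add_cancel] at this
  · rw [if_neg ha]
    have := finrank_range_eq_add (toQuot (relationIdeal k l₁ l₂) (a + b, b, d))
      (0 : PUnit.{1} →ₗ[ℂ] PUnit.{1}) (toQuot (quotientIdeal k l₁ l₂) (a + b, b, d)) 0
      (fun w => by simp) fun u => by
        simp only [toQuot_eq_zero, LinearMap.zero_apply, sub_zero, exists_const]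
        exact ⟨fun h => (exists_sub_mem_of_mem_quotientIdeal u.2 h).1 (not_le.1 ha),
          fun h => relationIdeal_le_quotientIdeal k l₁ l₂ h⟩
    rwa [Module.finrank_zero_of_subsingleton (M := LinearMap.range (0 : PUnit →ₗ[ℂ] PUnit))]
      at this

theorem finite_of_charge_zero (I : Ideal UA) (m₂ : ℕ) (d : ℤ) :
    Module.Finite ℂ (LinearMap.range (toQuot I (0, m₂, d))) := by
  have : Module.Finite ℂ (homog (0, m₂, d)) := by
    have hle : homog (0, m₂, d) ≤ Submodule.span ℂ {(1 : UA)} := by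
      intro u hu
      obtain ⟨c, rfl, -⟩ := homog_zero hu
      exact Submodule.mem_span_singleton.2 ⟨c, by rw [MvPolynomial.smul_eq_C_mul, mul_one]⟩
    exact Submodule.finiteDimensional_of_le hle
  infer_instance

/-- The same descent on `2d + b` as for completeness of the relations: the exact sequence bounds
each component by two components that are already finite-dimensional. -/
theorem finite_piece_of_lt {k : ℕ} (N : ℕ) (l₁ l₂ l₃ : ℕ) (hl : l₁ + l₂ + l₃ = k) (a b : ℕ)
    (d : ℤ) (hN : 2 * d + b < N) : Module.Finite ℂ (piece k l₁ l₂ (a + b, b, d)) := by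
  induction N generalizing l₁ l₂ l₃ a b d with
  | zero =>
    rw [← range_toQuot]
    have := subsingleton_range_toQuot (I := relationIdeal k l₁ l₂) (g := (a + b, b, d))
      fun u hu => mem_relationIdeal_of_neg (by omega) hu
    infer_instance
  | succ N ihN =>
    by_cases hab : a + b = 0
    · rw [hab, ← range_toQuot]
      exact finite_of_charge_zero _ _ _
    have hrec : ∀ l₁ l₂ l₃, l₁ + l₂ + l₃ = k →
        Module.Finite ℂ (piece k l₂ l₃ (b + (a - l₁), a - l₁, d - (a - l₁ : ℕ))) := by
      intro l₁ l₂ l₃ hl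
      by_cases h0 : b + (a - l₁) = 0
      · rw [h0, ← range_toQuot]
        exact finite_of_charge_zero _ _ _
      · exact ihN _ _ l₁ (by omega) _ _ _ (by omega)
    induction l₁ generalizing l₂ with
    | zero =>
      refine (finite_finrank_toQuot hl a b d ?_ fun _ => hrec _ _ _ hl).1
      have := subsingleton_range_toQuot (I := quotientIdeal k 0 l₂) (g := (a + b, b, d))
        fun u _ => Submodule.mem_top
      infer_instance
    | succ l₁ ih =>
      refine (finite_finrank_toQuot hl a b d ?_ fun _ => hrec _ _ _ hl).1
      have := ih (l₂ + 1) (by omega)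
      rw [← range_toQuot] at this
      exact this

theorem finite_piece {k l₁ l₂ : ℕ} (hl : l₁ + l₂ ≤ k) (g : ℕ × ℕ × ℤ) :
    Module.Finite ℂ (piece k l₁ l₂ g) := by
  obtain ⟨m₁, m₂, d⟩ := g
  rcases lt_or_ge m₁ m₂ with h | h
  · rw [← range_toQuot]
    have := subsingleton_range_toQuot (I := relationIdeal k l₁ l₂) (g := (m₁, m₂, d))
      fun u hu => by rw [homog_eq_zero h hu]; exact Submodule.zero_mem _
    infer_instance
  · have := finite_piece_of_lt (k := k) (2 * d + m₂ + 1).toNat l₁ l₂ (k - l₁ - l₂) (by omega)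
      (m₁ - m₂) m₂ d (by omega)
    rwa [Nat.sub_add_cancel h] at this

theorem charCoeff_zero_left {k l₂ l₃ : ℕ} (hl : l₂ + l₃ = k) (a b : ℕ) (d : ℤ) :
    charCoeff k 0 l₂ (a + b) b d = charCoeff k l₂ l₃ (b + a) a (d - a) := by
  have hs := subsingleton_range_toQuot (I := quotientIdeal k 0 l₂) (g := (a + b, b, d))
    fun u _ => Submodule.mem_top
  have := (finite_finrank_toQuot (l₁ := 0) (by omega : 0 + l₂ + l₃ = k) a b d
    (by infer_instance) fun _ => finite_piece (by omega) _).2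
  rw [this, Module.finrank_zero_of_subsingleton]
  simp

theorem charCoeff_succ {k l₁ l₂ l₃ : ℕ} (hl : l₁ + 1 + l₂ + l₃ = k) (a b : ℕ) (d : ℤ) :
    charCoeff k (l₁ + 1) l₂ (a + b) b d = charCoeff k l₁ (l₂ + 1) (a + b) b d +
      if l₁ + 1 ≤ a then
        charCoeff k l₂ l₃ (b + (a - (l₁ + 1))) (a - (l₁ + 1)) (d - (a - (l₁ + 1) : ℕ)) else 0 := by
  rw [(finite_finrank_toQuot hl a b d (by
    have := finite_piece (k := k) (l₁ := l₁) (l₂ := l₂ + 1) (by omega) (a + b, b, d)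
    rw [← range_toQuot] at this
    exact this) fun _ => finite_piece (by omega) _).2]
  congr 1
  rw [charCoeff, ← range_toQuot]
  rfl

theorem charCoeff_eq_zero {k l₁ l₂ m₁ m₂ : ℕ} {d : ℤ}
    (h : ∀ u ∈ homog (m₁, m₂, d), u ∈ relationIdeal k l₁ l₂) : charCoeff k l₁ l₂ m₁ m₂ d = 0 := by
  rw [charCoeff, ← range_toQuot]
  have := subsingleton_range_toQuot h
  exact Module.finrank_zero_of_subsingleton

theorem charCoeff_of_neg (k l₁ l₂ m₁ m₂ : ℕ) {d : ℤ} (hd : d < 0) :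
    charCoeff k l₁ l₂ m₁ m₂ d = 0 :=
  charCoeff_eq_zero fun _ hu => mem_relationIdeal_of_neg hd hu

theorem charCoeff_of_lt (k l₁ l₂ : ℕ) {m₁ m₂ : ℕ} (d : ℤ) (h : m₁ < m₂) :
    charCoeff k l₁ l₂ m₁ m₂ d = 0 :=
  charCoeff_eq_zero fun _ hu => by rw [homog_eq_zero h hu]; exact Submodule.zero_mem _

/-- The module is nonzero because its cyclic vector acts as a nonzero vacuum in the vertex operator
model. -/
theorem C_mem_relationIdeal {k l₁ l₂ : ℕ} (hl : l₁ + l₂ ≤ k) {c : ℂ}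
    (h : MvPolynomial.C c ∈ relationIdeal k l₁ l₂) : c = 0 :=
  C_mem_vacuumAnn.1 (relationIdeal_le_vacuumAnn 1 (standardType l₁ l₂ (k - l₁ - l₂))
    (by simp; omega) (card_standardType_zero _ _ _) (card_standardType_one _ _ _) h)

theorem charCoeff_zero_zero {k l₁ l₂ : ℕ} (hl : l₁ + l₂ ≤ k) (d : ℤ) :
    charCoeff k l₁ l₂ 0 0 d = if d = 0 then 1 else 0 := by
  split_ifs with hd
  · subst hd
    rw [charCoeff, finrank_eq_one_iff']
    refine ⟨⟨Ideal.Quotient.mk _ 1, 1, MvPolynomial.isWeightedHomogeneous_one _ _, rfl⟩, ?_, ?_⟩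
    · intro h
      have h1 : (1 : UA) ∈ relationIdeal k l₁ l₂ :=
        Ideal.Quotient.eq_zero_iff_mem.1 (congrArg Subtype.val h)
      rw [← map_one MvPolynomial.C] at h1
      exact one_ne_zero (C_mem_relationIdeal hl h1)
    · rintro ⟨_, u, hu, rfl⟩
      obtain ⟨c, rfl, -⟩ := homog_zero hu
      refine ⟨c, Subtype.ext ?_⟩
      have : (MvPolynomial.C c : UA) = c • 1 := by rw [MvPolynomial.smul_eq_C_mul, mul_one]
      exact (((Ideal.Quotient.mkₐ ℂ (relationIdeal k l₁ l₂)).toLinearMap.map_smul c 1).symm.trans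
        (congrArg _ this.symm))
  · refine charCoeff_eq_zero fun u hu => ?_
    obtain ⟨c, rfl, hc⟩ := homog_zero hu
    rw [hc hd, map_zero]
    exact Submodule.zero_mem _

/-! ### The direct sum decomposition -/

/-- The projection of `X^k_{l₁,l₂}` to its homogeneous component of degree `g`. -/
def pieceProj (k l₁ l₂ : ℕ) (g : ℕ × ℕ × ℤ) : X k l₁ l₂ →ₗ[ℂ] X k l₁ l₂ :=
  ((relationIdeal k l₁ l₂).restrictScalars ℂ).liftQ
    ((Ideal.Quotient.mkₐ ℂ (relationIdeal k l₁ l₂)).toLinearMap.comp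
      (MvPolynomial.weightedHomogeneousComponent modeDegree g)) fun _ hu =>
    Ideal.Quotient.eq_zero_iff_mem.2 (component_mem_relationIdeal hu g)

theorem pieceProj_mk (k l₁ l₂ : ℕ) (g : ℕ × ℕ × ℤ) (u : UA) :
    pieceProj k l₁ l₂ g (Ideal.Quotient.mk _ u) =
      Ideal.Quotient.mk _ (MvPolynomial.weightedHomogeneousComponent modeDegree g u) := rfl

/-- The relation ideal is homogeneous, so the component maps descend to the quotient. They fix their
own component and kill all others, which gives independence; monomials give spanning. -/
theorem isInternal_piece (k l₁ l₂ : ℕ) : DirectSum.IsInternal (piece k l₁ l₂) := by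
  refine DirectSum.isInternal_submodule_of_iSupIndep_of_iSup_eq_top ?_ ?_
  · rw [iSupIndep_def]
    intro g
    rw [Submodule.disjoint_def]
    intro x hx hx'
    have h1 : pieceProj k l₁ l₂ g x = x := by
      obtain ⟨u, hu, rfl⟩ := hx
      refine (pieceProj_mk k l₁ l₂ g u).trans ?_
      rw [MvPolynomial.IsWeightedHomogeneous.weightedHomogeneousComponent_same hu]
      rfl
    have h2 : (⨆ (j) (_ : j ≠ g), piece k l₁ l₂ j) ≤ LinearMap.ker (pieceProj k l₁ l₂ g) := by
      refine iSup₂_le fun j hj => ?_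
      rintro _ ⟨u, hu, rfl⟩
      refine (pieceProj_mk k l₁ l₂ g u).trans ?_
      rw [MvPolynomial.IsWeightedHomogeneous.weightedHomogeneousComponent_ne _ hu hj.symm, map_zero]
    rw [← h1]
    exact h2 hx'
  · rw [eq_top_iff]
    rintro x -
    obtain ⟨u, rfl⟩ := Ideal.Quotient.mk_surjective x
    rw [u.as_sum, map_sum]
    refine Submodule.sum_mem _ fun e _ => ?_
    exact Submodule.mem_iSup_of_mem (Finsupp.weight modeDegree e)
      ⟨_, MvPolynomial.isWeightedHomogeneous_monomial _ _ _ rfl, rfl⟩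

/-! ### The bosonic terms over a field -/

section Bosonic

variable {K : Type*} [Field K]

/-- The product `(q)_n`. -/
def qFac (q : K) (n : ℕ) : K := ∏ j ∈ Finset.range n, (1 - q ^ (j + 1))

/-- The product `(w)_n`. -/
def qPoch (q w : K) (n : ℕ) : K := ∏ j ∈ Finset.range n, (1 - w * q ^ j)

/-- The expansion of `1 / (u z)_∞`. -/
def eSeries (q u : K) : PowerSeries K := PowerSeries.mk fun i => u ^ i / qFac q i

theorem qFac_succ (q : K) (n : ℕ) : qFac q (n + 1) = qFac q n * (1 - q ^ (n + 1)) :=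
  Finset.prod_range_succ _ _

theorem qPoch_succ (q w : K) (n : ℕ) : qPoch q w (n + 1) = qPoch q w n * (1 - w * q ^ n) :=
  Finset.prod_range_succ _ _

/-- `q` is not zero and not a root of unity. -/
structure Generic (q : K) : Prop where
  ne_zero : q ≠ 0
  pow_ne_one : ∀ n : ℕ, q ^ (n + 1) ≠ 1

/-- `w` is not zero and not a power of `q`. -/
structure GenericPair (q w : K) : Prop extends Generic q where
  ne_zero' : w ≠ 0
  mul_zpow_ne_one : ∀ n : ℤ, w * q ^ n ≠ 1

theorem Generic.qFac_ne_zero {q : K} (h : Generic q) (n : ℕ) : qFac q n ≠ 0 :=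
  Finset.prod_ne_zero_iff.2 fun j _ => sub_ne_zero.2 (h.pow_ne_one j).symm

theorem GenericPair.symm {q w : K} (h : GenericPair q w) : GenericPair q (q / w) where
  toGeneric := h.toGeneric
  ne_zero' := div_ne_zero h.ne_zero h.ne_zero'
  mul_zpow_ne_one n hn := h.mul_zpow_ne_one (-n - 1) (by
    have h1 := h.ne_zero
    have h2 := h.ne_zero'
    have h3 : q ^ (-n - 1) = (q ^ n)⁻¹ * q⁻¹ := by rw [zpow_sub₀ h1, zpow_neg, zpow_one, div_eq_mul_inv]
    have h4 : q ^ n ≠ 0 := zpow_ne_zero n h1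
    rw [h3]
    field_simp at hn ⊢
    exact hn.symm)

/-- The `q`-difference equation of Euler's series, reflecting the removal of the first factor of
`(uz)_∞`. -/
theorem one_sub_mul_eSeries {q : K} (h : Generic q) (u : K) :
    (1 - PowerSeries.C u * PowerSeries.X) * eSeries q u = eSeries q (u * q) := by
  ext1 i
  rw [sub_mul, one_mul, map_sub, mul_assoc, PowerSeries.coeff_C_mul]
  cases i with
  | zero => simp [eSeries]
  | succ i =>
    rw [PowerSeries.coeff_succ_X_mul]
    simp only [eSeries, PowerSeries.coeff_mk, qFac_succ]
    have h1 := h.qFac_ne_zero i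
    have h2 : 1 - q ^ (i + 1) ≠ 0 := sub_ne_zero.2 (h.pow_ne_one i).symm
    field_simp
    ring

theorem rescale_eSeries (q u w : K) :
    PowerSeries.rescale w (eSeries q u) = eSeries q (w * u) := by
  ext1 i
  rw [PowerSeries.coeff_rescale]
  simp only [eSeries, PowerSeries.coeff_mk]
  rw [mul_pow, mul_div_assoc]

theorem constantCoeff_eSeries (q u : K) : PowerSeries.constantCoeff (eSeries q u) = 1 := by
  simp [eSeries, qFac]

/-- The exponent of `q` common to all bosonic terms. -/
def baseExp (k n p : ℤ) : ℤ := (k + 1) * (n ^ 2 + n * p + p ^ 2) + p ^ 2 + n ^ 2 - n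

/-- The exponent of `z` in the bosonic terms, with `m = n + p` for `s ≤ 3` and `m = n + p + 1` for
`s = 4, 5`; the parameter `l` is `l₁ + 1`. -/
def boseDeg (k l l₂ : ℕ) : Fin 6 × ℕ × ℕ → ℕ
  | (0, n, p) => (k + 1) * (n + p)
  | (1, n, p) => (k + 1) * (n + p) + l
  | (2, n, p) => (k + 1) * (n + p) + l + l₂
  | (3, n, p) => (k + 1) * (n + p) + l + l₂
  | (4, n, p) => (k + 1) * (n + p + 1) + l
  | (5, n, p) => (k + 1) * (n + p + 1)

/-- The exponents of `w` and `q` in the bosonic terms. -/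
def boseExp (k l l₂ : ℤ) : Fin 6 × ℕ × ℕ → ℤ × ℤ
  | (0, n, p) => ((k + 2) * n - p, baseExp k n p - (n + p) * (l - 1) - n * l₂)
  | (1, n, p) => ((k + 2) * n - p,
      baseExp k n p - (n + p) * (l - 1) - n * l₂ + (n + 2 * p) * l)
  | (2, n, p) => ((k + 2) * n - p + 1 + l₂,
      baseExp k n p + 2 * (n + p) + p * (l - 1) + (n + p) * l₂)
  | (3, n, p) => ((k + 2) * n - p + 1 + l₂ + l,
      baseExp k n p + 2 * (n + p) + p * (l - 1) + (n + p) * l₂ + (n - p) * l)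
  | (4, n, p) => ((k + 2) * n - (p + 1) + 1 + l + l₂,
      baseExp k n (p + 1) + 3 * n + n * (l - 1) - (p + 1) * l₂)
  | (5, n, p) => ((k + 2) * n - (p + 1) + 1 + l₂,
      baseExp k n (p + 1) + n - (p + 1) - (n + p + 1) * (l - 1) - (p + 1) * l₂)

/-- The signs and denominators of the bosonic terms. -/
def boseDen (q w : K) : Fin 6 × ℕ × ℕ → K
  | (0, n, p) => qFac q n * qFac q p * qPoch q w n * qPoch q (q / w) p
  | (1, n, p) => -(qFac q n * qFac q p * qPoch q w n * qPoch q (q / w) p)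
  | (2, n, p) => -(qFac q n * qFac q p * qPoch q w (n + 1) * qPoch q (q / w) p)
  | (3, n, p) => qFac q n * qFac q p * qPoch q w (n + 1) * qPoch q (q / w) p
  | (4, n, p) => qFac q n * qFac q p * qPoch q w (n + 1) * qPoch q (q / w) (p + 1)
  | (5, n, p) => -(qFac q n * qFac q p * qPoch q w (n + 1) * qPoch q (q / w) (p + 1))

/-- The infinite products of the bosonic terms. -/
def boseInf (q w : K) : Fin 6 × ℕ × ℕ → PowerSeries K
  | (0, n, p) => eSeries q (q ^ (n + p)) * eSeries q (w * q ^ (n + p))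
  | (1, n, p) => eSeries q (q ^ (n + p)) * eSeries q (w * q ^ (n + p))
  | (2, n, p) => eSeries q (q ^ (n + p + 1)) * eSeries q (w * q ^ (n + p))
  | (3, n, p) => eSeries q (q ^ (n + p + 1)) * eSeries q (w * q ^ (n + p))
  | (4, n, p) => eSeries q (q ^ (n + p + 1)) * eSeries q (w * q ^ (n + p + 1))
  | (5, n, p) => eSeries q (q ^ (n + p + 1)) * eSeries q (w * q ^ (n + p + 1))

/-- The scalar factors of the bosonic terms. -/
def boseScalar (k l l₂ : ℕ) (q w : K) (y : Fin 6 × ℕ × ℕ) : K :=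
  w ^ (boseExp k l l₂ y).1 * q ^ (boseExp k l l₂ y).2 / boseDen q w y

/-- The bosonic terms, as power series in `z = z₁` with `w = z₂`, where `l = l₁ + 1`. -/
def bose (k l l₂ : ℕ) (q w : K) (y : Fin 6 × ℕ × ℕ) : PowerSeries K :=
  PowerSeries.X ^ boseDeg k l l₂ y * (PowerSeries.C (boseScalar k l l₂ q w y) * boseInf q w y)

/-- The correspondence of the bosonic terms on the two sides of the recursion. -/
def boseMap : Fin 6 × ℕ × ℕ → Fin 6 × ℕ × ℕ
  | (0, n, p) => (1, p, n)
  | (1, n, p) => (2, p, n)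
  | (2, n, p) => (5, p, n)
  | (3, n, p) => (0, p, n + 1)
  | (4, n, p) => (3, p, n + 1)
  | (5, n, p) => (4, p, n)

theorem rescale_C (w a : K) :
    PowerSeries.rescale w (PowerSeries.C a) = PowerSeries.C a := by
  ext1 i
  rw [PowerSeries.coeff_rescale, PowerSeries.coeff_C]
  split_ifs with h
  · rw [h, pow_zero, one_mul]
  · rw [mul_zero]

theorem rescale_bose {k l l₂ : ℕ} {q w : K} (h : GenericPair q w) (y : Fin 6 × ℕ × ℕ) :
    PowerSeries.rescale w (bose k l l₂ q (q / w) y) =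
      PowerSeries.X ^ boseDeg k l l₂ y *
        (PowerSeries.C (w ^ ((boseDeg k l l₂ y : ℤ) - (boseExp k l l₂ y).1) *
          q ^ ((boseExp k l l₂ y).1 + (boseExp k l l₂ y).2) / boseDen q (q / w) y) *
          PowerSeries.rescale w (boseInf q (q / w) y)) := by
  have hw : w ^ boseDeg k l l₂ y * boseScalar k l l₂ q (q / w) y =
      w ^ ((boseDeg k l l₂ y : ℤ) - (boseExp k l l₂ y).1) *
          q ^ ((boseExp k l l₂ y).1 + (boseExp k l l₂ y).2) / boseDen q (q / w) y := by
    rw [boseScalar, div_zpow, zpow_sub₀ h.ne_zero', zpow_add₀ h.ne_zero, zpow_natCast]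
    ring
  rw [bose, map_mul, map_mul, map_pow, PowerSeries.rescale_X, rescale_C, mul_pow, ← hw, map_mul,
    map_pow]
  ring

theorem scalar_sub {G D D' c x y : K} (hx : x = G) (hy : y = G * c) (hD : D = D' * (1 - c))
    (hc : 1 - c ≠ 0) : x / D - y / D = G / D' := by
  rw [← sub_div, hx, hy, hD, show G - G * c = G * (1 - c) by ring, mul_div_mul_right _ _ hc]

theorem zpow_mul_zpow_eq {q w : K} {a a' b b' : ℤ} (h1 : a = a') (h2 : b = b') :
    w ^ a * q ^ b = w ^ a' * q ^ b' := by rw [h1, h2]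

theorem zpow_mul_zpow_mul_pow {q w : K} (h : Generic q) {a a' b b' : ℤ} {j : ℕ}
    (h1 : a = a') (h2 : b = b' + j) : w ^ a * q ^ b = w ^ a' * q ^ b' * q ^ j := by
  rw [h1, h2, zpow_add₀ h.ne_zero, zpow_natCast, mul_assoc]

theorem zpow_mul_zpow_mul_mul_pow {q w : K} (h : GenericPair q w) {a a' b b' : ℤ} {j : ℕ}
    (h1 : a = a' + 1) (h2 : b = b' + j) : w ^ a * q ^ b = w ^ a' * q ^ b' * (w * q ^ j) := by
  rw [h1, h2, zpow_add₀ h.ne_zero, zpow_add₀ h.ne_zero', zpow_natCast, zpow_one]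
  ring

theorem bose_sub_of_deg_eq {k l l' l₂ l₂' d d' : ℕ} {q w c : K} {y : Fin 6 × ℕ × ℕ}
    {E : PowerSeries K}
    (hd : boseDeg k l l₂ y = d + d') (hd' : boseDeg k l' l₂' y = d + d')
    (hs : boseScalar k l l₂ q w y - boseScalar k l' l₂' q w y = c) (hE : boseInf q w y = E) :
    bose k l l₂ q w y - bose k l' l₂' q w y =
      PowerSeries.X ^ d * (PowerSeries.X ^ d' * (PowerSeries.C c * E)) := by
  rw [bose, bose, hd, hd', hE, ← hs, map_sub]
  ring

theorem bose_sub_of_deg_succ {k l l' l₂ l₂' d d' : ℕ} {q w c u : K} {y : Fin 6 × ℕ × ℕ}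
    {E E' : PowerSeries K} (h : Generic q)
    (hd : boseDeg k l l₂ y = d + d' + 1) (hd' : boseDeg k l' l₂' y = d + d')
    (hs : boseScalar k l l₂ q w y = -c * u) (hs' : boseScalar k l' l₂' q w y = -c)
    (hE : boseInf q w y = eSeries q u * E) (hE' : E' = eSeries q (u * q) * E) :
    bose k l l₂ q w y - bose k l' l₂' q w y =
      PowerSeries.X ^ d * (PowerSeries.X ^ d' * (PowerSeries.C c * E')) := by
  rw [bose, bose, hd, hd', hE, hE', hs, hs', ← one_sub_mul_eSeries h, map_mul, map_neg]
  ring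

/-- The two terms on the left differ by one factor `1 - c`, which cancels against a denominator. The
factor is `1 - w q^p` for `s = 1, 2` and `1 - q^(n+1)` for `s = 3, 4`. For `s = 0, 5` it is the
first factor of an infinite product in `z`. -/
theorem bose_rec {k l₁ l₂ l₃ : ℕ} (hk : l₁ + l₂ + l₃ = k) {q w : K} (h : GenericPair q w)
    (y : Fin 6 × ℕ × ℕ) :
    bose k (l₁ + 1) l₂ q w (boseMap y) - bose k l₁ (l₂ + 1) q w (boseMap y) =
      PowerSeries.X ^ l₁ * PowerSeries.rescale w (bose k (l₂ + 1) l₃ q (q / w) y) := by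
  subst hk
  have hw := h.ne_zero'
  have hqw : q / (q / w) = w := div_div_cancel₀ h.ne_zero
  have hwq : w * (q / w) = q := mul_div_cancel₀ _ hw
  rw [rescale_bose h]
  obtain ⟨s, n, p⟩ := y
  have h1 (n : ℕ) : 1 - q ^ (n + 1) ≠ 0 := sub_ne_zero.2 (h.pow_ne_one n).symm
  have h2 : 1 - w * q ^ p ≠ 0 := sub_ne_zero.2 (by
    have := h.mul_zpow_ne_one p
    rw [zpow_natCast] at this
    exact this.symm)
  have e1 (m : ℕ) : w * (q / w * q ^ m) = q ^ m * q := by rw [← mul_assoc, hwq, mul_comm]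
  have e2 (m : ℕ) : w * (q / w * q ^ m) = q ^ (m + 1) := by rw [e1, pow_succ]
  have e3 : p + (n + 1) = n + p + 1 := by omega
  match s with
  | 0 =>
    refine bose_sub_of_deg_succ (u := q ^ (p + n)) (E := eSeries q (w * q ^ (n + p)))
      h.toGeneric ?_ ?_ ?_ ?_ ?_ ?_
    · simp only [boseMap, boseDeg]; ring
    · simp only [boseMap, boseDeg]; ring
    · simp only [boseScalar, boseMap, boseDen, hqw, boseExp, boseDeg]
      rw [neg_mul, div_mul_eq_mul_div, div_neg, neg_inj]
      refine congrArg₂ _ (zpow_mul_zpow_mul_pow h.toGeneric (by push_cast; ring) (by push_cast [baseExp]; ring)) ?_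
      ring
    · simp only [boseScalar, boseMap, boseDen, hqw, boseExp, boseDeg]
      rw [div_neg]
      refine congrArg Neg.neg (congrArg₂ _ (zpow_mul_zpow_eq (by push_cast; ring) (by push_cast [baseExp]; ring)) ?_)
      ring
    · simp only [boseInf, boseMap, add_comm]
    · simp only [boseInf, map_mul, rescale_eSeries, e1, add_comm]; ring
  | 1 =>
    refine bose_sub_of_deg_eq ?_ ?_ ?_ ?_
    · simp only [boseMap, boseDeg]; ring
    · simp only [boseMap, boseDeg]; ring
    · simp only [boseScalar, boseMap, boseDen, hqw, boseExp, boseDeg]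
      rw [div_neg, div_neg, div_neg, sub_neg_eq_add, neg_add_eq_sub, ← neg_sub, neg_inj]
      refine scalar_sub (zpow_mul_zpow_eq (by push_cast; ring) (by push_cast [baseExp]; ring))
        (zpow_mul_zpow_mul_mul_pow h (by push_cast; ring) (by push_cast [baseExp]; ring)) ?_ h2
      rw [qPoch_succ]; ring
    · simp only [boseInf, boseMap, map_mul, rescale_eSeries, e2, add_comm]
      rw [mul_comm]
  | 2 =>
    refine bose_sub_of_deg_eq ?_ ?_ ?_ ?_
    · simp only [boseMap, boseDeg]; ring
    · simp only [boseMap, boseDeg]; ring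
    · simp only [boseScalar, boseMap, boseDen, hqw, boseExp, boseDeg]
      rw [div_neg, div_neg, div_neg, sub_neg_eq_add, neg_add_eq_sub, ← neg_sub, neg_inj]
      refine scalar_sub (zpow_mul_zpow_eq (by push_cast; ring) (by push_cast [baseExp]; ring))
        (zpow_mul_zpow_mul_mul_pow h (by push_cast; ring) (by push_cast [baseExp]; ring)) ?_ h2
      rw [qPoch_succ]; ring
    · simp only [boseInf, boseMap, map_mul, rescale_eSeries, e2, add_comm]
      rw [mul_comm]
  | 3 =>
    refine bose_sub_of_deg_eq ?_ ?_ ?_ ?_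
    · simp only [boseMap, boseDeg]; ring
    · simp only [boseMap, boseDeg]; ring
    · simp only [boseScalar, boseMap, boseDen, hqw, boseExp, boseDeg]
      refine scalar_sub (zpow_mul_zpow_eq (by push_cast; ring) (by push_cast [baseExp]; ring))
        (zpow_mul_zpow_mul_pow h.toGeneric (by push_cast; ring) (by push_cast [baseExp]; ring)) ?_ (h1 n)
      rw [qFac_succ]; ring
    · simp only [boseInf, boseMap, map_mul, rescale_eSeries, e2, e3]
      rw [mul_comm]
  | 4 =>
    refine bose_sub_of_deg_eq ?_ ?_ ?_ ?_
    · simp only [boseMap, boseDeg]; ring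
    · simp only [boseMap, boseDeg]; ring
    · simp only [boseScalar, boseMap, boseDen, hqw, boseExp, boseDeg]
      refine scalar_sub (zpow_mul_zpow_eq (by push_cast; ring) (by push_cast [baseExp]; ring))
        (zpow_mul_zpow_mul_pow h.toGeneric (by push_cast; ring) (by push_cast [baseExp]; ring)) ?_ (h1 n)
      rw [qFac_succ]; ring
    · simp only [boseInf, boseMap, map_mul, rescale_eSeries, e2, e3]
      rw [mul_comm]
  | 5 =>
    refine bose_sub_of_deg_succ (u := q ^ (p + n + 1)) (E := eSeries q (w * q ^ (n + p + 1)))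
      h.toGeneric ?_ ?_ ?_ ?_ ?_ ?_
    · simp only [boseMap, boseDeg]; ring
    · simp only [boseMap, boseDeg]; ring
    · simp only [boseScalar, boseMap, boseDen, hqw, boseExp, boseDeg]
      rw [div_neg, neg_neg, div_mul_eq_mul_div]
      refine congrArg₂ _ (zpow_mul_zpow_mul_pow h.toGeneric (by push_cast; ring) (by push_cast [baseExp]; ring)) ?_
      ring
    · simp only [boseScalar, boseMap, boseDen, hqw, boseExp, boseDeg]
      rw [div_neg, neg_neg]
      refine congrArg₂ _ (zpow_mul_zpow_eq (by push_cast; ring) (by push_cast [baseExp]; ring)) ?_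
      ring
    · simp only [boseInf, boseMap, add_comm]
    · simp only [boseInf, map_mul, rescale_eSeries, e1, add_comm]; ring

/-- The indices missed are `(0, n, 0)` and `(3, n, 0)`. There the term depends only on `l₁ + l₂`, so
the difference is zero. -/
theorem bose_sub_of_notMem_range {k l₁ l₂ : ℕ} {q w : K} {y : Fin 6 × ℕ × ℕ}
    (hy : y ∉ Set.range boseMap) : bose k (l₁ + 1) l₂ q w y - bose k l₁ (l₂ + 1) q w y = 0 := by
  rw [sub_eq_zero]
  obtain ⟨s, n, p⟩ := y
  match s, p with
  | 0, 0 =>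
    rw [bose, bose, boseScalar, boseScalar]
    refine congrArg₂ _ rfl (congrArg₂ _ (congrArg PowerSeries.C ?_) rfl)
    exact congrArg₂ _ (zpow_mul_zpow_eq rfl (by simp only [boseExp]; push_cast; ring)) rfl
  | 3, 0 =>
    rw [bose, bose, boseScalar, boseScalar]
    congr 1
    · simp only [boseDeg]; ring
    refine congrArg₂ _ (congrArg PowerSeries.C ?_) rfl
    exact congrArg₂ _ (zpow_mul_zpow_eq (by simp only [boseExp]; push_cast; ring)
      (by simp only [boseExp]; push_cast; ring)) rfl
  | 0, p + 1 => exact (hy ⟨(3, p, n), rfl⟩).elim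
  | 1, p => exact (hy ⟨(0, p, n), rfl⟩).elim
  | 2, p => exact (hy ⟨(1, p, n), rfl⟩).elim
  | 3, p + 1 => exact (hy ⟨(4, p, n), rfl⟩).elim
  | 4, p => exact (hy ⟨(5, p, n), rfl⟩).elim
  | 5, p => exact (hy ⟨(2, p, n), rfl⟩).elim

/-- A left inverse of `boseMap`. -/
def boseMapInv : Fin 6 × ℕ × ℕ → Fin 6 × ℕ × ℕ
  | (0, n, p) => (3, p - 1, n)
  | (1, n, p) => (0, p, n)
  | (2, n, p) => (1, p, n)
  | (3, n, p) => (4, p - 1, n)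
  | (4, n, p) => (5, p, n)
  | (5, n, p) => (2, p, n)

theorem boseMap_injective : Function.Injective boseMap := by
  refine Function.LeftInverse.injective (g := boseMapInv) ?_
  rintro ⟨s, n, p⟩
  fin_cases s <;> rfl

/-- The involution of the index set under which the bosonic terms with `l₁ = -1` change sign. -/
def boseSwap : Fin 6 × ℕ × ℕ → Fin 6 × ℕ × ℕ
  | (0, n, p) => (1, n, p)
  | (1, n, p) => (0, n, p)
  | (2, n, p) => (3, n, p)
  | (3, n, p) => (2, n, p)
  | (4, n, p) => (5, n, p)
  | (5, n, p) => (4, n, p)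

theorem boseSwap_involutive : Function.Involutive boseSwap := by
  rintro ⟨s, n, p⟩
  fin_cases s <;> rfl

/-- With `l = l₁ + 1 = 0` the monomials and infinite products of the paired indices agree, and only
the sign in the denominator differs. -/
theorem bose_boseSwap (k l₂ : ℕ) (q w : K) (y : Fin 6 × ℕ × ℕ) :
    bose k 0 l₂ q w (boseSwap y) = -bose k 0 l₂ q w y := by
  have key : ∀ {y y' : Fin 6 × ℕ × ℕ}, boseDeg k 0 l₂ y = boseDeg k 0 l₂ y' →
      (boseExp k (0 : ℕ) l₂ y).1 = (boseExp k (0 : ℕ) l₂ y').1 →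
      (boseExp k (0 : ℕ) l₂ y).2 = (boseExp k (0 : ℕ) l₂ y').2 →
      boseDen q w y = -boseDen q w y' → boseInf q w y = boseInf q w y' →
      bose k 0 l₂ q w y = -bose k 0 l₂ q w y' := by
    intro y y' h1 h2 h3 h4 h5
    rw [bose, bose, boseScalar, boseScalar, h1, h2, h3, h4, h5, div_neg, map_neg, neg_mul, mul_neg]
  obtain ⟨s, n, p⟩ := y
  match s with
  | 0 =>
    exact key (y := (1, n, p)) (y' := (0, n, p)) rfl rfl
      (by simp only [boseExp, Nat.cast_zero]; ring) rfl rfl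
  | 1 =>
    exact key (y := (0, n, p)) (y' := (1, n, p)) rfl rfl
      (by simp only [boseExp, Nat.cast_zero]; ring) (neg_neg _).symm rfl
  | 2 =>
    exact key (y := (3, n, p)) (y' := (2, n, p)) rfl (by simp only [boseExp, Nat.cast_zero]; ring)
      (by simp only [boseExp, Nat.cast_zero]; ring) (neg_neg _).symm rfl
  | 3 =>
    exact key (y := (2, n, p)) (y' := (3, n, p)) rfl (by simp only [boseExp, Nat.cast_zero]; ring)
      (by simp only [boseExp, Nat.cast_zero]; ring) rfl rfl
  | 4 =>
    exact key (y := (5, n, p)) (y' := (4, n, p)) rfl (by simp only [boseExp, Nat.cast_zero]; ring)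
      (by simp only [boseExp, Nat.cast_zero]; ring) rfl rfl
  | 5 =>
    exact key (y := (4, n, p)) (y' := (5, n, p)) rfl (by simp only [boseExp, Nat.cast_zero]; ring)
      (by simp only [boseExp, Nat.cast_zero]; ring) (neg_neg _).symm rfl

/-! ### Summation of the bosonic terms. -/

theorem add_le_boseDeg (k l l₂ : ℕ) (y : Fin 6 × ℕ × ℕ) : y.2.1 + y.2.2 ≤ boseDeg k l l₂ y := by
  obtain ⟨s, n, p⟩ := y
  have h1 := Nat.le_mul_of_pos_left (n + p) k.succ_pos
  have h2 := Nat.le_mul_of_pos_left (n + p + 1) k.succ_pos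
  simp only [Nat.succ_eq_add_one] at h1 h2
  match s with
  | 0 | 1 | 2 | 3 | 4 | 5 => simp only [boseDeg]; omega

theorem coeff_bose_of_lt {k l l₂ D : ℕ} (q w : K) {y : Fin 6 × ℕ × ℕ}
    (h : D < boseDeg k l l₂ y) : PowerSeries.coeff D (bose k l l₂ q w y) = 0 := by
  rw [bose, PowerSeries.coeff_X_pow_mul', if_neg (by omega)]

theorem coeff_bose_boseDeg (k l l₂ : ℕ) (q w : K) (y : Fin 6 × ℕ × ℕ) :
    PowerSeries.coeff (boseDeg k l l₂ y) (bose k l l₂ q w y) = boseScalar k l l₂ q w y := by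
  have : PowerSeries.constantCoeff (boseInf q w y) = 1 := by
    obtain ⟨s, n, p⟩ := y
    match s with
    | 0 | 1 | 2 | 3 | 4 | 5 =>
      simp only [boseInf, map_mul, constantCoeff_eSeries, mul_one]
  rw [bose, PowerSeries.coeff_X_pow_mul', if_pos le_rfl, Nat.sub_self, PowerSeries.coeff_C_mul,
    PowerSeries.coeff_zero_eq_constantCoeff, this, mul_one]

theorem finite_support_coeff_bose (k l l₂ D : ℕ) (q w : K) :
    Function.HasFiniteSupport fun y => PowerSeries.coeff D (bose k l l₂ q w y) := by
  refine Set.Finite.subset (Set.finite_univ.prod ((Set.finite_Iic D).prod (Set.finite_Iic D))) ?_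
  rintro y hy
  have h := add_le_boseDeg k l l₂ y
  have : boseDeg k l l₂ y ≤ D := by
    by_contra hlt
    exact hy (coeff_bose_of_lt q w (not_le.1 hlt))
  exact ⟨trivial, by simp only [Set.mem_Iic]; omega, by simp only [Set.mem_Iic]; omega⟩

/-- The coefficient of `z ^ D` in the sum of the bosonic terms. -/
def boseSum (k l l₂ : ℕ) (q w : K) (D : ℕ) : K :=
  ∑ᶠ y, PowerSeries.coeff D (bose k l l₂ q w y)

theorem boseSum_zero_left [CharZero K] (k l₂ : ℕ) (q w : K) (D : ℕ) :
    boseSum k 0 l₂ q w D = 0 := by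
  have h : boseSum k 0 l₂ q w D = -boseSum k 0 l₂ q w D := by
    conv_lhs => rw [boseSum, ← finsum_comp_equiv boseSwap_involutive.toPerm]
    rw [boseSum, ← finsum_neg_distrib]
    refine finsum_congr fun y => ?_
    rw [Function.Involutive.coe_toPerm, bose_boseSwap, map_neg]
  exact self_eq_neg.1 h

theorem boseSum_succ_left {k l₁ l₂ l₃ : ℕ} (hk : l₁ + l₂ + l₃ = k) {q w : K}
    (h : GenericPair q w) (D : ℕ) :
    boseSum k (l₁ + 1) l₂ q w D = boseSum k l₁ (l₂ + 1) q w D +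
      if l₁ ≤ D then w ^ (D - l₁) * boseSum k (l₂ + 1) l₃ q (q / w) (D - l₁) else 0 := by
  rw [← sub_eq_iff_eq_add', boseSum, boseSum, ← finsum_sub_distrib
    (finite_support_coeff_bose ..) (finite_support_coeff_bose ..)]
  simp only [← map_sub]
  have h1 : ∑ᶠ y, PowerSeries.coeff D (bose k (l₁ + 1) l₂ q w y - bose k l₁ (l₂ + 1) q w y) =
      ∑ᶠ y ∈ Set.range boseMap,
        PowerSeries.coeff D (bose k (l₁ + 1) l₂ q w y - bose k l₁ (l₂ + 1) q w y) := by
    rw [← finsum_mem_univ]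
    refine finsum_mem_inter_support_eq' _ _ _ fun y hy => ?_
    simp only [Set.mem_univ, true_iff]
    by_contra hr
    exact hy ((congrArg _ (bose_sub_of_notMem_range hr)).trans (map_zero _))
  rw [h1, finsum_mem_range boseMap_injective]
  simp only [bose_rec hk h, PowerSeries.coeff_X_pow_mul', PowerSeries.coeff_rescale]
  split_ifs with hD
  · rw [boseSum, mul_finsum]
  · exact finsum_zero

theorem boseSum_zero_right (k l₁ l₂ : ℕ) (q w : K) : boseSum k (l₁ + 1) l₂ q w 0 = 1 := by
  rw [boseSum, finsum_eq_single _ (0, 0, 0)]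
  · have := coeff_bose_boseDeg k (l₁ + 1) l₂ q w (0, 0, 0)
    simp only [boseDeg, add_zero, mul_zero] at this
    rw [this]
    simp [boseScalar, boseExp, boseDen, baseExp, qFac, qPoch]
  · rintro ⟨s, n, p⟩ hy
    refine coeff_bose_of_lt q w ?_
    match s with
    | 0 =>
      have : 0 < n + p := by
        by_contra h0
        exact hy (by rw [show n = 0 by omega, show p = 0 by omega])
      exact Nat.mul_pos k.succ_pos this
    | 1 | 2 | 3 | 4 | 5 => simp only [boseDeg]; positivity

end Bosonic

/-! ### The recursion determines its solution -/

/-- The recursion in the `z₁`-degree `D`; the two values of the Boolean variable correspond to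
`z₂` and `q / z₂`. -/
structure IsRecursive {K : Type*} [Field K] (k : ℕ) (W : Bool → K)
    (A : Bool → ℕ → ℕ → ℕ → K) : Prop where
  zero : ∀ b l₁ l₂, l₁ + l₂ ≤ k → A b l₁ l₂ 0 = 1
  zero_left : ∀ b l₂ l₃ D, l₂ + l₃ = k → A b 0 l₂ D = W b ^ D * A (!b) l₂ l₃ D
  succ_left : ∀ b l₁ l₂ l₃ D, l₁ + 1 + l₂ + l₃ = k → A b (l₁ + 1) l₂ D = A b l₁ (l₂ + 1) D +
    if l₁ + 1 ≤ D then W b ^ (D - (l₁ + 1)) * A (!b) l₂ l₃ (D - (l₁ + 1)) else 0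

theorem isRecursive_boseSum {K : Type*} [Field K] [CharZero K] (k : ℕ) {q w : K}
    (h : GenericPair q w) : IsRecursive k (fun b => bif b then q / w else w)
      (fun b l₁ l₂ => boseSum k (l₁ + 1) l₂ q (bif b then q / w else w)) where
  zero b l₁ l₂ _ := boseSum_zero_right ..
  zero_left b l₂ l₃ D hl := by
    have hqw : q / (q / w) = w := div_div_cancel₀ h.ne_zero
    cases b
    · have := boseSum_succ_left (show 0 + l₂ + l₃ = k by omega) h D
      rwa [boseSum_zero_left, if_pos (Nat.zero_le _), Nat.sub_zero, zero_add (_ * _)] at this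
    · have := boseSum_succ_left (show 0 + l₂ + l₃ = k by omega) h.symm D
      rwa [boseSum_zero_left, if_pos (Nat.zero_le _), Nat.sub_zero, zero_add (_ * _), hqw] at this
  succ_left b l₁ l₂ l₃ D hl := by
    have hqw : q / (q / w) = w := div_div_cancel₀ h.ne_zero
    cases b
    · exact boseSum_succ_left hl h D
    · have := boseSum_succ_left hl h.symm D
      rwa [hqw] at this

/-- By strong induction on `D` the inhomogeneous terms of lower degree cancel, so the difference of
two solutions depends only on `b` and `l₁ + l₂`. The rule for `l₁ = 0` then links the two values of
`b` through the single pair `(0, k)`. -/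
theorem IsRecursive.eq {K : Type*} [Field K] {k : ℕ} {q : K} (hq : Generic q) {W : Bool → K}
    (hW : W false * W true = q) {A B : Bool → ℕ → ℕ → ℕ → K} (hA : IsRecursive k W A)
    (hB : IsRecursive k W B) (D : ℕ) :
    ∀ (b : Bool) (l₁ l₂ : ℕ), l₁ + l₂ ≤ k → A b l₁ l₂ D = B b l₁ l₂ D := by
  induction D using Nat.strong_induction_on with
  | _ D ih =>
    rcases D with _ | D
    · intro b l₁ l₂ hl
      rw [hA.zero b l₁ l₂ hl, hB.zero b l₁ l₂ hl]
    have hW' (b : Bool) : W (!b) * W b = q := by cases b <;> simpa [mul_comm] using hW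
    have step : ∀ (b : Bool) (l₁ l₂ : ℕ), l₁ + l₂ ≤ k →
        A b l₁ l₂ (D + 1) - B b l₁ l₂ (D + 1) =
          A b 0 (l₁ + l₂) (D + 1) - B b 0 (l₁ + l₂) (D + 1) := by
      intro b l₁
      induction l₁ with
      | zero => intro l₂ _; rw [zero_add]
      | succ l₁ ihl =>
        intro l₂ hl
        have e := show l₁ + 1 + l₂ + (k - (l₁ + 1 + l₂)) = k by omega
        rw [hA.succ_left b l₁ l₂ _ _ e, hB.succ_left b l₁ l₂ _ _ e,
          show l₁ + 1 + l₂ = l₁ + (l₂ + 1) by omega, ← ihl (l₂ + 1) (by omega),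
          ih (D + 1 - (l₁ + 1)) (by omega) (!b) l₂ _ (by omega), add_sub_add_right_eq_sub]
    have zstep : ∀ (b : Bool) (l₂ : ℕ), l₂ ≤ k →
        A b 0 l₂ (D + 1) - B b 0 l₂ (D + 1) =
          W b ^ (D + 1) * (A (!b) 0 k (D + 1) - B (!b) 0 k (D + 1)) := by
      intro b l₂ hl
      have e := show l₂ + (k - l₂) = k by omega
      have := step (!b) l₂ (k - l₂) (by omega)
      rw [e] at this
      rw [hA.zero_left b l₂ _ _ e, hB.zero_left b l₂ _ _ e, ← mul_sub, this]
    -- Going through both values of `b` multiplies the difference by `(W false * W true)^(D+1) =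
    -- q^(D+1)`, which is not `1`.
    have top : ∀ b : Bool, A b 0 k (D + 1) - B b 0 k (D + 1) = 0 := by
      intro b
      have h1 := zstep b k le_rfl
      rw [zstep (!b) k le_rfl, Bool.not_not, ← mul_assoc, ← mul_pow, mul_comm (W b), hW'] at h1
      by_contra hne
      exact hq.pow_ne_one D (mul_right_cancel₀ hne (by rw [one_mul]; exact h1.symm))
    intro b l₁ l₂ hl
    rw [← sub_eq_zero, step b l₁ l₂ hl, zstep b _ hl, top, mul_zero]

/-! ### From power series in `z₁, z₂` to power series in `z₁` over a field -/

section ToBase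

variable {K : Type*} [Field K] (o : PowerSeries (LaurentSeries ℚ) →+* K)

/-- The image of `q` in the base field. -/
def baseQ : K := o (PowerSeries.C (HahnSeries.single 1 1))

/-- The image of `z₂` in the base field. -/
def baseW : K := o PowerSeries.X

theorem baseQ_zpow (n : ℤ) : baseQ o ^ n = o (PowerSeries.C (HahnSeries.single n 1)) := by
  have key : ∀ n : ℕ, baseQ o ^ n = o (PowerSeries.C (HahnSeries.single (n : ℤ) 1)) := by
    intro n
    rw [baseQ, ← map_pow, ← map_pow, HahnSeries.single_pow, one_pow, nsmul_eq_mul, mul_one]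
  obtain ⟨n, rfl | rfl⟩ := n.eq_nat_or_neg
  · rw [zpow_natCast, key]
  · rw [zpow_neg, zpow_natCast, key]
    refine inv_eq_of_mul_eq_one_right ?_
    rw [← map_mul, ← map_mul, HahnSeries.single_mul_single, add_neg_cancel, mul_one,
      HahnSeries.single_zero_one, map_one, map_one]

theorem genericPair_base (ho : Function.Injective o) : GenericPair (baseQ o) (baseW o) where
  ne_zero := by
    rw [baseQ, Ne, map_eq_zero_iff o ho, map_eq_zero_iff _ PowerSeries.C_injective]
    exact HahnSeries.single_ne_zero one_ne_zero
  ne_zero' := by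
    rw [baseW, Ne, map_eq_zero_iff o ho]
    exact PowerSeries.X_ne_zero
  pow_ne_one n h := by
    rw [← zpow_natCast, baseQ_zpow, ← map_one o] at h
    have h0 := PowerSeries.C_injective ((ho h).trans (map_one PowerSeries.C).symm)
    have h1 := congrArg (fun x => HahnSeries.coeff x 0) h0
    simp only [HahnSeries.coeff_one, if_true] at h1
    rw [HahnSeries.coeff_single_of_ne (by omega)] at h1
    exact zero_ne_one h1
  mul_zpow_ne_one n h := by
    rw [baseQ_zpow, baseW, ← map_mul, ← map_one o] at h
    have h1 := congrArg PowerSeries.constantCoeff (ho h)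
    rw [map_mul, PowerSeries.constantCoeff_X, zero_mul, map_one] at h1
    exact zero_ne_one h1

theorem expo_apply_zero (i j : ℕ) : expo i j 0 = i := by simp [expo]

theorem expo_apply_one (i j : ℕ) : expo i j 1 = j := by simp [expo]

theorem expo_add (i j i' j' : ℕ) : expo (i + i') (j + j') = expo i j + expo i' j' := by
  simp only [expo, Finsupp.single_add]
  abel

theorem expo_eq (e : Fin 2 →₀ ℕ) : expo (e 0) (e 1) = e := by
  ext i
  fin_cases i
  · exact expo_apply_zero _ _
  · exact expo_apply_one _ _

theorem expo_inj {i j i' j' : ℕ} : expo i j = expo i' j' ↔ i = i' ∧ j = j' := by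
  constructor
  · intro h
    have h0 := DFunLike.congr_fun h 0
    have h1 := DFunLike.congr_fun h 1
    rw [expo_apply_zero, expo_apply_zero] at h0
    rw [expo_apply_one, expo_apply_one] at h1
    exact ⟨h0, h1⟩
  · rintro ⟨rfl, rfl⟩
    rfl

theorem coeff_expo_mul {R : Type*} [CommRing R] (f g : MvPowerSeries (Fin 2) R) (i j : ℕ) :
    MvPowerSeries.coeff (expo i j) (f * g) =
      ∑ x ∈ Finset.HasAntidiagonal.antidiagonal i,
        ∑ y ∈ Finset.HasAntidiagonal.antidiagonal j,
        MvPowerSeries.coeff (expo x.1 y.1) f * MvPowerSeries.coeff (expo x.2 y.2) g := by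
  classical
  rw [MvPowerSeries.coeff_mul, ← Finset.sum_product']
  refine Finset.sum_nbij' (fun e => ((e.1 0, e.2 0), (e.1 1, e.2 1)))
    (fun x => (expo x.1.1 x.2.1, expo x.1.2 x.2.2)) ?_ ?_ ?_ ?_ ?_
  · rintro ⟨e, e'⟩ h
    rw [Finset.HasAntidiagonal.mem_antidiagonal] at h
    rw [Finset.mem_product, Finset.HasAntidiagonal.mem_antidiagonal, Finset.HasAntidiagonal.mem_antidiagonal]
    have h0 := DFunLike.congr_fun h 0
    have h1 := DFunLike.congr_fun h 1
    rw [expo_apply_zero] at h0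
    rw [expo_apply_one] at h1
    exact ⟨h0, h1⟩
  · rintro ⟨⟨a, b⟩, c, d⟩ h
    rw [Finset.mem_product, Finset.HasAntidiagonal.mem_antidiagonal, Finset.HasAntidiagonal.mem_antidiagonal] at h
    rw [Finset.HasAntidiagonal.mem_antidiagonal, ← h.1, ← h.2, expo_add]
  · rintro ⟨e, e'⟩ _
    simp only [expo_eq]
  · rintro ⟨⟨a, b⟩, c, d⟩ _
    simp only [expo_apply_zero, expo_apply_one]
  · rintro ⟨e, e'⟩ _
    simp only [expo_eq]

/-- The inclusion of the power series in `z₁, z₂` into the power series in `z₁` whose coefficients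
are Laurent series in `z₂`. -/
def toBase : Series →+* PowerSeries K where
  toFun f := PowerSeries.mk fun i => o
    (PowerSeries.mk fun j => MvPowerSeries.coeff (expo i j) f)
  map_one' := by
    classical
    ext1 i
    rw [PowerSeries.coeff_mk, PowerSeries.coeff_one]
    have : ∀ j, MvPowerSeries.coeff (expo i j) (1 : Series) = if i = 0 ∧ j = 0 then 1 else 0 := by
      intro j
      have h0 : (0 : Fin 2 →₀ ℕ) = expo 0 0 := by simp [expo]
      simp only [MvPowerSeries.coeff_one, h0, expo_inj]
    simp only [this]
    split_ifs with hi
    · rw [← map_one o]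
      congr 1
      ext1 j
      rw [PowerSeries.coeff_mk, PowerSeries.coeff_one]
      simp only [hi, true_and]
    · rw [← map_zero o]
      congr 1
      ext1 j
      rw [PowerSeries.coeff_mk, if_neg fun h => hi h.1, map_zero]
  map_mul' f g := by
    ext1 i
    rw [PowerSeries.coeff_mk, PowerSeries.coeff_mul]
    simp only [PowerSeries.coeff_mk, ← map_mul]
    rw [← map_sum]
    congr 1
    ext1 j
    simp only [PowerSeries.coeff_mk, coeff_expo_mul, map_sum, PowerSeries.coeff_mul]
  map_zero' := by
    ext1 i
    rw [PowerSeries.coeff_mk, map_zero, ← map_zero o]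
    congr 1
  map_add' f g := by
    ext1 i
    rw [map_add, PowerSeries.coeff_mk, PowerSeries.coeff_mk, PowerSeries.coeff_mk, ← map_add]
    congr 1

theorem coeff_toBase (f : Series) (i : ℕ) :
    PowerSeries.coeff i (toBase o f) = o
      (PowerSeries.mk fun j => MvPowerSeries.coeff (expo i j) f) :=
  PowerSeries.coeff_mk i fun i => o (PowerSeries.mk fun j => MvPowerSeries.coeff (expo i j) f)

theorem toBase_mono (i j : ℕ) (c : ℤ) :
    toBase o (mono i j c) = PowerSeries.C (baseW o ^ j * baseQ o ^ c) * PowerSeries.X ^ i := by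
  classical
  ext1 i'
  rw [PowerSeries.coeff_C_mul, PowerSeries.coeff_X_pow, coeff_toBase]
  have : ∀ j', MvPowerSeries.coeff (expo i' j') (mono i j c) =
      if i' = i ∧ j' = j then HahnSeries.single c 1 else 0 := by
    intro j'
    simp only [mono, MvPowerSeries.coeff_monomial, expo_inj]
  simp only [this]
  split_ifs with hi
  · have h : (PowerSeries.mk fun j' => if i' = i ∧ j' = j then HahnSeries.single c (1 : ℚ) else 0) =
        PowerSeries.C (HahnSeries.single c (1 : ℚ)) * PowerSeries.X ^ j := by
      ext1 j'
      rw [PowerSeries.coeff_mk, PowerSeries.coeff_C_mul, PowerSeries.coeff_X_pow]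
      simp only [hi, true_and, mul_ite, mul_one, mul_zero]
    rw [h, map_mul, map_pow, baseQ_zpow, baseW, mul_one, mul_comm]
  · rw [mul_zero, ← map_zero o]
    congr 1
    ext1 j'
    rw [PowerSeries.coeff_mk, if_neg fun h => hi h.1, map_zero]

/-! ### The infinite products -/

theorem coeff_mono_mul (i j : ℕ) (c : ℤ) (f : Series) (e : Fin 2 →₀ ℕ) :
    MvPowerSeries.coeff e (mono i j c * f) =
      if expo i j ≤ e then HahnSeries.single c 1 * MvPowerSeries.coeff (e - expo i j) f else 0 := by
  classical
  rw [mono, MvPowerSeries.coeff_monomial_mul]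

theorem expo_le_apply_zero {i j : ℕ} {e : Fin 2 →₀ ℕ} (h : expo i j ≤ e) : i ≤ e 0 := by
  have := h 0
  rwa [expo_apply_zero] at this

theorem sub_expo_apply_zero (i j : ℕ) (e : Fin 2 →₀ ℕ) : (e - expo i j) 0 = e 0 - i := by
  rw [Finsupp.tsub_apply, expo_apply_zero]

/-- Starting the product at exponent `c` amounts to replacing `z₁` by `q^c z₁`, since each factor is
linear in `z₁`. -/
theorem coeff_prod_eq_single_mul (j c N : ℕ) (e : Fin 2 →₀ ℕ) :
    MvPowerSeries.coeff e (∏ r ∈ Finset.range N, (1 - mono 1 j (c + r))) =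
      HahnSeries.single ((c : ℤ) * e 0) 1 *
        MvPowerSeries.coeff e (∏ r ∈ Finset.range N, (1 - mono 1 j ((0 : ℕ) + r))) := by
  classical
  induction N generalizing e with
  | zero =>
    rw [Finset.prod_range_zero, Finset.prod_range_zero, MvPowerSeries.coeff_one]
    split_ifs with h
    · rw [h, Finsupp.zero_apply, Nat.cast_zero, mul_zero]
      exact (one_mul 1).symm
    · rw [mul_zero]
  | succ N ih =>
    rw [Finset.prod_range_succ, Finset.prod_range_succ, mul_comm, sub_mul, one_mul, map_sub,
      coeff_mono_mul, mul_comm (∏ r ∈ _, _), sub_mul, one_mul, map_sub, coeff_mono_mul, mul_sub,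
      ← ih e]
    congr 1
    split_ifs with h
    · rw [ih, ← mul_assoc, ← mul_assoc, HahnSeries.single_mul_single, HahnSeries.single_mul_single,
        sub_expo_apply_zero, Nat.cast_sub (expo_le_apply_zero h)]
      congr 3
      push_cast
      ring
    · rw [mul_zero]

theorem coeff_pochInf_eq_single_mul (j c : ℕ) (e : Fin 2 →₀ ℕ) :
    MvPowerSeries.coeff e (pochInf 1 j c) =
      HahnSeries.single ((c : ℤ) * e 0) 1 * MvPowerSeries.coeff e (pochInf 1 j 0) := by
  ext d
  have h : d - c * e 0 < (d.toNat + 1 : ℕ) := by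
    have : (0 : ℤ) ≤ c * e 0 := by positivity
    omega
  rw [HahnSeries.coeff_single_mul, one_mul, ← coeff_prod_eq_coeff_pochInf 1 j 0 _ e _ h,
    ← coeff_prod_eq_coeff_pochInf 1 j c (d.toNat + 1) e d (by omega), coeff_prod_eq_single_mul,
    HahnSeries.coeff_single_mul, one_mul]

theorem coeff_pochInf_of_apply_zero (j c : ℕ) {e : Fin 2 →₀ ℕ} (he : e 0 = 0) :
    MvPowerSeries.coeff e (pochInf 1 j c) = MvPowerSeries.coeff e 1 := by
  have h : ∀ N : ℕ, MvPowerSeries.coeff e (∏ r ∈ Finset.range N, (1 - mono 1 j (c + r))) =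
      MvPowerSeries.coeff e 1 := by
    intro N
    induction N with
    | zero => rw [Finset.prod_range_zero]
    | succ N ih =>
      rw [Finset.prod_range_succ, mul_comm, sub_mul, one_mul, map_sub, coeff_mono_mul, if_neg, ih,
        sub_zero]
      intro h
      have := expo_le_apply_zero h
      omega
  ext d
  rw [← coeff_prod_eq_coeff_pochInf 1 j c (d.toNat + 1) e d (by omega), h]

theorem pochInf_zero (j : ℕ) : pochInf 1 j 0 = (1 - mono 1 j 0) * pochInf 1 j 1 := by
  classical
  ext e d
  rw [sub_mul, one_mul, map_sub, coeff_mono_mul, HahnSeries.coeff_sub,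
    ← coeff_prod_eq_coeff_pochInf 1 j 0 (d.toNat + 2) e d (by omega), Finset.prod_range_succ',
    mul_comm]
  have h : ∏ r ∈ Finset.range (d.toNat + 1), (1 - mono 1 j ((0 : ℕ) + (r + 1 : ℕ))) =
      ∏ r ∈ Finset.range (d.toNat + 1), (1 - mono 1 j ((1 : ℕ) + r)) :=
    Finset.prod_congr rfl fun r _ => by push_cast; rw [zero_add, add_comm]
  rw [h, Nat.cast_zero, zero_add, sub_mul, one_mul, map_sub, coeff_mono_mul,
    HahnSeries.coeff_sub, coeff_prod_eq_coeff_pochInf 1 j 1 _ e d (by omega)]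
  congr 1
  split_ifs
  · rw [HahnSeries.coeff_single_mul, HahnSeries.coeff_single_mul, sub_zero,
      coeff_prod_eq_coeff_pochInf 1 j 1 _ _ d (by omega)]
  · rfl

/-- The product `f(z)` of `(w^j z)_∞` and Euler's series satisfies `f(z) = f(qz)`, because both
factors obey opposite `q`-difference equations. As `q` is not a root of unity, `f` is its constant
term `1`; other `c` follow by rescaling. -/
theorem toBase_pochInf_mul_eSeries (ho : Function.Injective o) (j c : ℕ) :
    toBase o (pochInf 1 j c) * eSeries (baseQ o) (baseW o ^ j * baseQ o ^ c) = 1 := by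
  have hg := (genericPair_base o ho).toGeneric
  have scale : ∀ c : ℕ, toBase o (pochInf 1 j c) =
      PowerSeries.rescale (baseQ o ^ c) (toBase o (pochInf 1 j 0)) := by
    intro c
    ext1 i
    rw [PowerSeries.coeff_rescale, ← pow_mul, ← zpow_natCast, baseQ_zpow]
    rw [coeff_toBase, coeff_toBase, ← map_mul]
    congr 1
    ext1 j'
    rw [PowerSeries.coeff_mk, PowerSeries.coeff_C_mul, PowerSeries.coeff_mk,
      coeff_pochInf_eq_single_mul, expo_apply_zero, Nat.cast_mul]
  have scale' : ∀ c : ℕ, toBase o (pochInf 1 j c) * eSeries (baseQ o) (baseW o ^ j * baseQ o ^ c) =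
      PowerSeries.rescale (baseQ o ^ c)
        (toBase o (pochInf 1 j 0) * eSeries (baseQ o) (baseW o ^ j)) := by
    intro c
    rw [scale, map_mul, rescale_eSeries, mul_comm (baseW o ^ j)]
  have step : toBase o (pochInf 1 j 0) * eSeries (baseQ o) (baseW o ^ j) =
      PowerSeries.rescale (baseQ o) (toBase o (pochInf 1 j 0) * eSeries (baseQ o) (baseW o ^ j)) := by
    have := scale' 1
    rw [pow_one, ← one_sub_mul_eSeries hg] at this
    rw [← this, pochInf_zero, map_mul, map_sub, map_one, toBase_mono, zpow_zero, mul_one, pow_one]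
    ring
  have hone : toBase o (pochInf 1 j 0) * eSeries (baseQ o) (baseW o ^ j) = 1 := by
    ext1 i
    rcases i with _ | i
    · have h0 : PowerSeries.coeff 0 (toBase o (pochInf 1 j 0)) = 1 := by
        rw [coeff_toBase, ← map_one o]
        congr 1
        ext1 j'
        rw [PowerSeries.coeff_mk, PowerSeries.coeff_one]
        rw [coeff_pochInf_of_apply_zero _ _ (expo_apply_zero _ _), MvPowerSeries.coeff_one]
        simp only [show (0 : Fin 2 →₀ ℕ) = expo 0 0 by simp [expo], expo_inj, true_and]
      rw [PowerSeries.coeff_zero_eq_constantCoeff] at h0 ⊢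
      rw [map_mul, constantCoeff_eSeries, mul_one, h0, map_one]
    · rw [PowerSeries.coeff_one, if_neg i.succ_ne_zero]
      have h1 := congrArg (PowerSeries.coeff (i + 1)) step
      rw [PowerSeries.coeff_rescale] at h1
      by_contra hne
      exact hg.pow_ne_one i (mul_right_cancel₀ hne (by rw [one_mul]; exact h1.symm))
  rw [scale', hone, map_one]

end ToBase

/-! ### The terms of the bosonic sum -/

section Terms

variable {K : Type*} [Field K] (o : PowerSeries (LaurentSeries ℚ) →+* K)

theorem constantCoeff_mono {i j : ℕ} (c : ℤ) (h : i ≠ 0 ∨ j ≠ 0) :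
    MvPowerSeries.constantCoeff (mono i j c) = 0 := by
  classical
  rw [← MvPowerSeries.coeff_zero_eq_constantCoeff_apply, mono, MvPowerSeries.coeff_monomial,
    if_neg]
  rw [show (0 : Fin 2 →₀ ℕ) = expo 0 0 by simp [expo], expo_inj]
  rintro ⟨rfl, rfl⟩
  simp at h

theorem toBase_inv_mul {i j : ℕ} (c : ℤ) (h : i ≠ 0 ∨ j ≠ 0) :
    toBase o (1 - mono i j c)⁻¹ *
      (1 - PowerSeries.C (baseW o ^ j * baseQ o ^ c) * PowerSeries.X ^ i) = 1 := by
  rw [← toBase_mono, ← map_one (toBase o), ← map_sub, ← map_mul, MvPowerSeries.inv_mul_cancel]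
  rw [map_sub, map_one, constantCoeff_mono c h, sub_zero]
  exact one_ne_zero

theorem toBase_inv_eq (c : ℤ) :
    toBase o (1 - mono 0 1 c)⁻¹ = PowerSeries.C (1 - baseW o * baseQ o ^ c)⁻¹ := by
  have h := toBase_inv_mul o (i := 0) (j := 1) c (Or.inr one_ne_zero)
  rw [pow_zero, mul_one, pow_one, ← map_one PowerSeries.C, ← map_sub] at h
  have hne : 1 - baseW o * baseQ o ^ c ≠ 0 := by
    intro h0
    rw [h0, map_zero, mul_zero, map_one] at h
    exact zero_ne_one h
  calc toBase o (1 - mono 0 1 c)⁻¹ = toBase o (1 - mono 0 1 c)⁻¹ *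
        (PowerSeries.C (1 - baseW o * baseQ o ^ c) *
          PowerSeries.C (1 - baseW o * baseQ o ^ c)⁻¹) := by
        rw [← map_mul, mul_inv_cancel₀ hne, map_one, mul_one]
    _ = _ := by rw [← mul_assoc, h, map_one, one_mul]

theorem toBase_invFactor_zero_one (c : ℤ) :
    toBase o (invFactor 0 1 c) = PowerSeries.C (1 - baseW o * baseQ o ^ c)⁻¹ := by
  rw [invFactor, if_pos (by norm_num)]
  exact toBase_inv_eq o c

theorem toBase_invFactor_zero_neg_one (ho : Function.Injective o) (c : ℤ) :
    toBase o (invFactor 0 (-1) c) = PowerSeries.C (1 - (baseW o)⁻¹ * baseQ o ^ c)⁻¹ := by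
  have hw := (genericPair_base o ho).ne_zero'
  have hq : baseQ o ^ c ≠ 0 := zpow_ne_zero _ (genericPair_base o ho).ne_zero
  have hne := (genericPair_base o ho).mul_zpow_ne_one (-c)
  rw [invFactor, if_neg (by norm_num)]
  show toBase o (-mono 0 1 (-c) * (1 - mono 0 1 (-c))⁻¹) = _
  rw [map_mul, toBase_inv_eq, map_neg, toBase_mono, pow_zero, mul_one, pow_one, ← map_neg,
    ← map_mul]
  congr 1
  have h1 : 1 - baseW o * baseQ o ^ (-c) ≠ 0 := sub_ne_zero.2 hne.symm
  have h2 : 1 - (baseW o)⁻¹ * baseQ o ^ c = -(baseW o * baseQ o ^ (-c))⁻¹ *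
      (1 - baseW o * baseQ o ^ (-c)) := by
    rw [zpow_neg]
    field_simp
    ring
  rw [h2, mul_inv, inv_neg, inv_inv]

/-- A factor with negative exponents is expanded as `-x⁻¹/(1 - x⁻¹)`. The denominator `1 - x⁻¹`
extends the infinite product by one factor at the front, leaving only a signed monomial. -/
theorem toBase_invFactor_mul_eSeries (ho : Function.Injective o) (j : ℕ) {j' : ℤ} (hj : j' = -j)
    (c : ℤ) : toBase o (invFactor (-1) j' c) * eSeries (baseQ o) (baseW o ^ j * baseQ o ^ (1 - c)) =
      PowerSeries.C (-(baseW o ^ (j : ℤ) * baseQ o ^ (-c))) * PowerSeries.X *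
        eSeries (baseQ o) (baseW o ^ j * baseQ o ^ (-c)) := by
  have hg := (genericPair_base o ho).toGeneric
  subst hj
  rw [invFactor, if_neg (by norm_num), neg_neg, neg_neg, Int.toNat_natCast]
  show toBase o (-mono 1 j (-c) * (1 - mono 1 j (-c))⁻¹) * _ = _
  have h := toBase_inv_mul o (i := 1) (j := j) (-c) (Or.inl one_ne_zero)
  rw [show 1 - c = -c + 1 by ring, zpow_add₀ hg.ne_zero, zpow_one, ← mul_assoc, ← one_sub_mul_eSeries hg,
    map_mul, map_neg, toBase_mono, zpow_natCast, map_neg]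
  rw [pow_one] at h ⊢
  linear_combination (-(PowerSeries.C (baseW o ^ j * baseQ o ^ (-c)) * PowerSeries.X *
    eSeries (baseQ o) (baseW o ^ j * baseQ o ^ (-c)))) * h

/-- The triangular numbers `0 + 1 + ⋯ + (n - 1)`. -/
def tri (n : ℕ) : ℤ := ∑ r ∈ Finset.range n, (r : ℤ)

theorem tri_succ (n : ℕ) : tri (n + 1) = tri n + n := Finset.sum_range_succ _ _

theorem two_mul_tri (n : ℕ) : 2 * tri n = n * (n - 1) := by
  induction n with
  | zero => rfl
  | succ n ih =>
    rw [tri_succ, mul_add, ih]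
    push_cast
    ring

theorem prod_neg_zpow {q w : K} (h : GenericPair q w) (a b c : ℤ) (N : ℕ) :
    ∏ r ∈ Finset.range N, (-(w ^ a * q ^ (b * (c + r)))) =
      (-1) ^ N * (w ^ (a * N) * q ^ (b * (c * N + tri N))) := by
  induction N with
  | zero => simp [tri]
  | succ N ih =>
    have e1 : a * (N + 1 : ℕ) = a * N + a := by push_cast; ring
    have e2 : b * (c * (N + 1 : ℕ) + tri (N + 1)) = b * (c * N + tri N) + b * (c + N) := by
      rw [tri_succ]; push_cast; ring
    rw [Finset.prod_range_succ, ih, e1, e2, zpow_add₀ h.ne_zero, zpow_add₀ h.ne_zero']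
    ring

theorem toBase_invPoch_mul_eSeries (ho : Function.Injective o) (j : ℕ) {j' : ℤ} (hj : j' = -j)
    (c : ℤ) (N : ℕ) :
    toBase o (invPoch (-1) j' c N) * eSeries (baseQ o) (baseW o ^ j * baseQ o ^ (1 - c)) =
      PowerSeries.C (∏ r ∈ Finset.range N, (-(baseW o ^ (j : ℤ) * baseQ o ^ (-1 * (c + r))))) *
        PowerSeries.X ^ N * eSeries (baseQ o) (baseW o ^ j * baseQ o ^ (1 - c - N)) := by
  induction N with
  | zero => simp [invPoch]
  | succ N ih =>
    have h := toBase_invFactor_mul_eSeries o ho j hj (c + N)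
    rw [show 1 - (c + N) = 1 - c - N by ring] at h
    rw [show -(c + N) = -1 * (c + N) by ring] at h
    rw [invPoch, Finset.prod_range_succ, ← invPoch, map_mul, mul_right_comm, ih, mul_assoc,
      mul_comm (eSeries _ _), h, Finset.prod_range_succ, map_mul,
      show 1 - c - (N + 1 : ℕ) = -1 * (c + N) by push_cast; ring]
    ring

theorem toBase_inv_pochInf (ho : Function.Injective o) (j c : ℕ) :
    toBase o (pochInf 1 j c)⁻¹ = eSeries (baseQ o) (baseW o ^ j * baseQ o ^ c) := by
  have h : toBase o (pochInf 1 j c)⁻¹ * toBase o (pochInf 1 j c) = 1 := by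
    rw [← map_mul, MvPowerSeries.inv_mul_cancel, map_one]
    rw [← MvPowerSeries.coeff_zero_eq_constantCoeff_apply, coeff_pochInf_of_apply_zero _ _ rfl,
      MvPowerSeries.coeff_zero_one]
    exact one_ne_zero
  rw [← mul_one (toBase o _), ← toBase_pochInf_mul_eSeries o ho j c, ← mul_assoc, h, one_mul]

/-- Iterating the previous absorption `N` times lowers the start of the infinite product from `C = M
+ N` to `M`. This is where the bosonic degree `(k+1)(n+p)` acquires its extra `n + p`. -/
theorem toBase_block (ho : Function.Injective o) (j : ℕ) {j' : ℤ} (hj : j' = -j)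
    {c : ℤ} {C M N : ℕ} (hC : C = M + N) (hc : c = 1 - C) :
    toBase o (pochInf 1 j C)⁻¹ * toBase o (invPoch (-1) j' c N) =
      PowerSeries.C ((-1) ^ N * (baseW o ^ ((j : ℤ) * N) * baseQ o ^ (-1 * (c * N + tri N)))) *
        PowerSeries.X ^ N * eSeries (baseQ o) (baseW o ^ j * baseQ o ^ M) := by
  have h := toBase_invPoch_mul_eSeries o ho j hj c N
  rw [show 1 - c - N = (M : ℕ) by rw [hc, hC]; push_cast; ring,
    show 1 - c = (C : ℕ) by rw [hc]; ring, prod_neg_zpow (genericPair_base o ho), zpow_natCast,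
    zpow_natCast] at h
  rw [toBase_inv_pochInf o ho, mul_comm, h]

theorem toBase_C (a : LaurentSeries ℚ) :
    toBase o (MvPowerSeries.C a) = PowerSeries.C (o (PowerSeries.C a)) := by
  classical
  ext1 i
  rw [coeff_toBase, PowerSeries.coeff_C, ← map_zero o, ← apply_ite o]
  congr 1
  ext1 j
  rw [PowerSeries.coeff_mk, MvPowerSeries.coeff_C, show (0 : Fin 2 →₀ ℕ) = expo 0 0 by simp [expo]]
  simp only [expo_inj]
  by_cases hi : i = 0
  · simp only [hi, true_and, if_true, PowerSeries.coeff_C]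
  · simp only [hi, false_and, if_false, map_zero]

theorem toBase_invQ (ho : Function.Injective o) (n : ℕ) :
    toBase o (invQ n) = PowerSeries.C (qFac (baseQ o) n)⁻¹ := by
  have hne := (genericPair_base o ho).qFac_ne_zero n
  have h : o (PowerSeries.C (∏ r ∈ Finset.range n, (1 - HahnSeries.single ((r : ℤ) + 1) (1 : ℚ)))) =
      qFac (baseQ o) n := by
    rw [map_prod, map_prod, qFac]
    refine Finset.prod_congr rfl fun r _ => ?_
    rw [map_sub, map_sub, map_one, map_one, ← zpow_natCast, baseQ_zpow, Nat.cast_succ]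
  rw [invQ, if_neg (by omega), Int.toNat_natCast, toBase_C]
  congr 1
  refine eq_inv_of_mul_eq_one_left ?_
  rw [← h, ← map_mul, ← map_mul, inv_mul_cancel₀, map_one, map_one]
  intro h0
  rw [h0, map_zero, map_zero] at h
  exact hne h.symm

theorem prod_one_sub_inv {q w : K} (h : GenericPair q w) (c : ℤ) (N : ℕ) :
    ∏ r ∈ Finset.range N, (1 - w⁻¹ * q ^ (c + r)) =
      (∏ r ∈ Finset.range N, (-(w ^ (-1 : ℤ) * q ^ (1 * (c + r))))) *
        ∏ r ∈ Finset.range N, (1 - w * q ^ (1 - c - N + r)) := by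
  rw [← Finset.prod_range_reflect (fun r : ℕ => 1 - w * q ^ (1 - c - N + r)),
    ← Finset.prod_mul_distrib]
  refine Finset.prod_congr rfl fun r hr => ?_
  have hq : q ^ (c + r) ≠ 0 := zpow_ne_zero _ h.ne_zero
  have hw := h.ne_zero'
  have hr' := Finset.mem_range.1 hr
  rw [show 1 - c - N + (N - 1 - r : ℕ) = -(c + r) by omega, one_mul, zpow_neg_one, zpow_neg]
  field_simp
  ring

/-- Inverting the factors in `w⁻¹` turns them into `(w q^(-p))_M`, which abuts the other product to
form `(w q^(-p))_(M+N)`. Splitting this after `p` factors and inverting the first part back gives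
`(w)_U` and `(q/w)_p`. -/
theorem prod_one_sub_mul_prod_one_sub_inv {q w : K} (h : GenericPair q w) {M N p U : ℕ}
    (hU : N + M = p + U) :
    (∏ r ∈ Finset.range N, (1 - w * q ^ ((M : ℤ) - p + r))) *
        ∏ r ∈ Finset.range M, (1 - w⁻¹ * q ^ ((p : ℤ) - M + 1 + r)) =
      (-1) ^ (M + p) * (w ^ ((p : ℤ) - M) *
        q ^ (((p : ℤ) - M + 1) * M + tri M - p - tri p)) * (qPoch q w U * qPoch q (q / w) p) := by
  have hq := h.ne_zero
  have hw := h.ne_zero'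
  have h1 := prod_one_sub_inv h ((p : ℤ) - M + 1) M
  have h2 := prod_one_sub_inv h 1 p
  rw [prod_neg_zpow h] at h1 h2
  have h3 : qPoch q (q / w) p = ∏ r ∈ Finset.range p, (1 - w⁻¹ * q ^ ((1 : ℤ) + r)) := by
    refine Finset.prod_congr rfl fun r _ => ?_
    rw [zpow_add₀ hq, zpow_one, zpow_natCast, div_eq_mul_inv]
    ring
  have h4 : (∏ r ∈ Finset.range M, (1 - w * q ^ (-(p : ℤ) + r))) *
      ∏ r ∈ Finset.range N, (1 - w * q ^ ((M : ℤ) - p + r)) =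
      (∏ r ∈ Finset.range p, (1 - w * q ^ (-(p : ℤ) + r))) * qPoch q w U := by
    have e1 := Finset.prod_range_add (fun r : ℕ => 1 - w * q ^ (-(p : ℤ) + r)) M N
    have e2 := Finset.prod_range_add (fun r : ℕ => 1 - w * q ^ (-(p : ℤ) + r)) p U
    rw [add_comm M N, hU, e2] at e1
    have e3 : ∏ r ∈ Finset.range U, (1 - w * q ^ (-(p : ℤ) + (p + r : ℕ))) = qPoch q w U :=
      Finset.prod_congr rfl fun r _ => by
        rw [Nat.cast_add, neg_add_cancel_left, zpow_natCast]
    rw [e3] at e1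
    rw [e1]
    congr 1
    refine Finset.prod_congr rfl fun r _ => ?_
    push_cast
    congr 3
    ring
  rw [show 1 - ((p : ℤ) - M + 1) - M = -p by ring] at h1
  rw [show 1 - 1 - (p : ℤ) = -p by ring] at h2
  have hs : (-1) ^ M * (w ^ (-1 * (M : ℤ)) * q ^ (1 * (((p : ℤ) - M + 1) * M + tri M))) =
      (-1) ^ (M + p) * (w ^ ((p : ℤ) - M) *
        q ^ (((p : ℤ) - M + 1) * M + tri M - p - tri p)) *
        ((-1) ^ p * (w ^ (-1 * (p : ℤ)) * q ^ (1 * (1 * (p : ℤ) + tri p)))) := by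
    have e1 : -1 * (M : ℤ) = (p - M) + -1 * p := by ring
    have e2 : 1 * (((p : ℤ) - M + 1) * M + tri M) =
        (((p : ℤ) - M + 1) * M + tri M - p - tri p) + 1 * (1 * p + tri p) := by ring
    have e3 : (-1 : K) ^ p * (-1) ^ p = 1 := by rw [← pow_add, Even.neg_one_pow ⟨p, rfl⟩]
    rw [e1, e2, zpow_add₀ hw, zpow_add₀ hq, pow_add]
    linear_combination (-((-1) ^ M * (w ^ ((p : ℤ) - M) * w ^ (-1 * (p : ℤ)) *
      (q ^ (((p : ℤ) - M + 1) * M + tri M - p - tri p) * q ^ (1 * (1 * (p : ℤ) + tri p)))))) * e3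
  rw [h3, h2, h1, hs]
  linear_combination ((-1) ^ (M + p) * (w ^ ((p : ℤ) - M) *
        q ^ (((p : ℤ) - M + 1) * M + tri M - p - tri p)) *
        ((-1) ^ p * (w ^ (-1 * (p : ℤ)) * q ^ (1 * (1 * (p : ℤ) + tri p))))) * h4

theorem mul_mul_mul_rearrange {R : Type*} [CommRing R] (m a b t₁ t₂ t₃ t₄ t₅ t₆ : R) :
    m * (a * b * t₁ * t₂ * t₃ * t₄ * t₅ * t₆) =
      m * (a * b) * (t₁ * t₂) * (t₃ * t₄) * (t₅ * t₆) := by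
  ring

/-- The image of a term of the bosonic sum. -/
theorem toBase_term (ho : Function.Injective o) {i j n x C₁ C₂ M₁ M₂ N₁ N₂ M N p U : ℕ}
    {a c₁ c₂ c c' : ℤ} (hC₁ : C₁ = M₁ + N₁) (hc₁ : c₁ = 1 - C₁) (hC₂ : C₂ = M₂ + N₂)
    (hc₂ : c₂ = 1 - C₂) (hc : c = M - p) (hc' : c' = p - M + 1) (hU : N + M = p + U) {A B : ℤ}
    (hA : A = j + N₂ + M - p)
    (hB : B = a - (c₁ * N₁ + tri N₁) - (c₂ * N₂ + tri N₂) - ((p - M + 1) * M + tri M)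
      + p + tri p) {D : ℕ} (hD : i + N₁ + N₂ = D) {d : K}
    (hd : d = (-1) ^ (N₁ + N₂ + M + p) * (qFac (baseQ o) n * qFac (baseQ o) x *
      qPoch (baseQ o) (baseW o) U * qPoch (baseQ o) (baseQ o / baseW o) p)) :
    toBase o (mono i j a * (invQ n * invQ x * (pochInf 1 0 C₁)⁻¹ * invPoch (-1) 0 c₁ N₁
      * (pochInf 1 1 C₂)⁻¹ * invPoch (-1) (-1) c₂ N₂
      * invPoch 0 1 c N * invPoch 0 (-1) c' M)) =
    PowerSeries.X ^ D * (PowerSeries.C (baseW o ^ A * baseQ o ^ B / d) *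
      (eSeries (baseQ o) (baseQ o ^ M₁) * eSeries (baseQ o) (baseW o * baseQ o ^ M₂))) := by
  have h := genericPair_base o ho
  -- Six of the factors group in pairs: those in `z₁`, those in `z₁z₂`, and those in `z₂` alone,
  -- each contributing a signed monomial to the simplified denominator.
  have b₁ := toBase_block o ho 0 (j' := 0) (by norm_num) hC₁ hc₁
  have b₂ := toBase_block o ho 1 (j' := -1) (by norm_num) hC₂ hc₂
  rw [pow_zero, one_mul] at b₁
  rw [pow_one] at b₂
  have b₃ : toBase o (invPoch 0 1 c N) * toBase o (invPoch 0 (-1) c' M) =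
      PowerSeries.C ((-1) ^ (M + p) * (baseW o ^ ((p : ℤ) - M) *
        baseQ o ^ (((p : ℤ) - M + 1) * M + tri M - p - tri p)) *
          (qPoch (baseQ o) (baseW o) U * qPoch (baseQ o) (baseQ o / baseW o) p))⁻¹ := by
    rw [← prod_one_sub_mul_prod_one_sub_inv h hU, invPoch, invPoch, map_prod, map_prod]
    simp only [toBase_invFactor_zero_one, toBase_invFactor_zero_neg_one o ho, hc, hc']
    rw [← map_prod, ← map_prod, ← map_mul, Finset.prod_inv_distrib, Finset.prod_inv_distrib,
      mul_inv]
  simp only [map_mul (toBase o), toBase_mono, toBase_invQ o ho]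
  rw [mul_mul_mul_rearrange, b₁, b₂, b₃]
  have eA : A = j + (1 : ℕ) * N₂ - (p - M) := by rw [hA]; push_cast; ring
  have eB : B = a + -1 * (c₁ * N₁ + tri N₁) + -1 * (c₂ * N₂ + tri N₂) -
      (((p : ℤ) - M + 1) * M + tri M - p - tri p) := by rw [hB]; ring
  have hinv (k : ℕ) : ((-1 : K) ^ k)⁻¹ = (-1) ^ k := by rw [← inv_pow, inv_neg_one]
  have hwA : baseW o ^ A = baseW o ^ j * baseW o ^ (((1 : ℕ) : ℤ) * N₂) *
      (baseW o ^ ((p : ℤ) - M))⁻¹ := by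
    rw [eA, zpow_sub₀ h.ne_zero', zpow_add₀ h.ne_zero', zpow_natCast, div_eq_mul_inv]
  have hqB : baseQ o ^ B = baseQ o ^ a * baseQ o ^ (-1 * (c₁ * N₁ + tri N₁)) *
      baseQ o ^ (-1 * (c₂ * N₂ + tri N₂)) *
      (baseQ o ^ (((p : ℤ) - M + 1) * M + tri M - p - tri p))⁻¹ := by
    rw [eB, zpow_sub₀ h.ne_zero, zpow_add₀ h.ne_zero, zpow_add₀ h.ne_zero, div_eq_mul_inv]
  rw [hwA, hqB, hd, ← hD, Nat.cast_zero, zero_mul, zpow_zero, add_assoc (N₁ + N₂)]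
  simp only [div_eq_mul_inv, mul_inv, hinv, pow_add _ (N₁ + N₂), pow_add _ N₁, pow_add _ (i + N₁),
    pow_add _ i, map_mul, one_mul]
  ring

/-- The triple `(m, n, s)` of an index of the bosonic terms over a field. -/
def boseIndex : Fin 6 × ℕ × ℕ → ℕ × ℕ × Fin 6
  | (0, n, p) => (n + p, n, 0)
  | (1, n, p) => (n + p, n, 1)
  | (2, n, p) => (n + p, n, 2)
  | (3, n, p) => (n + p, n, 3)
  | (4, n, p) => (n + p + 1, n, 4)
  | (5, n, p) => (n + p + 1, n, 5)

/-- `M₁`, `M₂` are the starts of the infinite products after absorption, and `U`, `p` are the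
lengths of `(w)_U`, `(q/w)_p`. The quadratic exponents match through `2 tri n = n(n - 1)`, and the
signs by parity. -/
theorem toBase_bosonTerm (ho : Function.Injective o) (k l₁ l₂ : ℕ) (y : Fin 6 × ℕ × ℕ) :
    toBase o (bosonTerm k l₁ l₂ (boseIndex y)) =
      bose k (l₁ + 1) l₂ (baseQ o) (baseW o) y := by
  obtain ⟨s, n, p⟩ := y
  have t1 := two_mul_tri n
  have e1 : n + p - n = p := by omega
  have e2 : n + p + 1 - n = p + 1 := by omega
  have e3 : ((n + p : ℕ) : ℤ) - n = (p : ℕ) := by push_cast; ring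
  have e4 : ((n + p + 1 : ℕ) : ℤ) - n - 1 = (p : ℕ) := by push_cast; ring
  match s with
  | 0 =>
    rw [bose, boseScalar]
    simp only [bosonTerm, boseIndex, pExp, invD, e1, e3]
    refine toBase_term o ho (M₁ := n + p) (M₂ := n + p) (p := p) (U := n) (by omega)
      (by omega) (by omega) (by omega) (by omega) (by omega) (by omega)
      ?_ ?_ ?_ ?_
    · simp only [boseExp]
      push_cast
      ring
    · simp only [boseExp, baseExp, aExp, Q₂]
      push_cast
      linear_combination t1
    · simp only [boseDeg]
      ring
    · rw [boseDen, Even.neg_one_pow (n := p + n + n + p) ⟨n + p, by ring⟩, one_mul]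
  | 1 =>
    rw [bose, boseScalar]
    simp only [bosonTerm, boseIndex, pExp, invD, e1, e3]
    refine toBase_term o ho (M₁ := n + p) (M₂ := n + p) (p := p) (U := n) (by omega)
      (by omega) (by omega) (by omega) (by omega) (by omega) (by omega)
      ?_ ?_ ?_ ?_
    · simp only [boseExp]
      push_cast
      ring
    · simp only [boseExp, baseExp, aExp, Q₂, tri_succ]
      push_cast
      linear_combination t1
    · simp only [boseDeg]
      ring
    · rw [boseDen, Odd.neg_one_pow (n := p + 1 + n + n + p) ⟨n + p, by ring⟩, neg_one_mul]
  | 2 =>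
    rw [bose, boseScalar]
    simp only [bosonTerm, boseIndex, pExp, invD, e1, e3]
    refine toBase_term o ho (M₁ := n + p + 1) (M₂ := n + p) (p := p) (U := n + 1) (by omega)
      (by omega) (by omega) (by omega) (by omega) (by omega) (by omega)
      ?_ ?_ ?_ ?_
    · simp only [boseExp]
      push_cast
      ring
    · simp only [boseExp, baseExp, aExp, Q₂, tri_succ]
      push_cast
      linear_combination t1
    · simp only [boseDeg]
      ring
    · rw [boseDen, Odd.neg_one_pow (n := p + (n + 1) + n + p) ⟨n + p, by ring⟩, neg_one_mul]
  | 3 =>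
    rw [bose, boseScalar]
    simp only [bosonTerm, boseIndex, pExp, invD, e1, e3]
    refine toBase_term o ho (M₁ := n + p + 1) (M₂ := n + p) (p := p) (U := n + 1) (by omega)
      (by omega) (by omega) (by omega) (by omega) (by omega) (by omega)
      ?_ ?_ ?_ ?_
    · simp only [boseExp]
      push_cast
      ring
    · simp only [boseExp, baseExp, aExp, Q₂, tri_succ]
      push_cast
      linear_combination t1
    · simp only [boseDeg]
      ring
    · rw [boseDen, Even.neg_one_pow (n := p + (n + 1) + (n + 1) + p) ⟨n + 1 + p, by ring⟩, one_mul]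
  | 4 =>
    rw [bose, boseScalar]
    simp only [bosonTerm, boseIndex, pExp, invD, e2, e4]
    refine toBase_term o ho (M₁ := n + p + 1) (M₂ := n + p + 1) (p := p + 1) (U := n + 1) (by omega)
      (by omega) (by omega) (by omega) (by omega) (by omega) (by omega)
      ?_ ?_ ?_ ?_
    · simp only [boseExp]
      push_cast
      ring
    · simp only [boseExp, baseExp, aExp, Q₂, tri_succ]
      push_cast
      linear_combination t1
    · simp only [boseDeg]
      ring
    · rw [boseDen, Even.neg_one_pow (n := p + 1 + (n + 1) + (n + 1) + (p + 1)) ⟨n + 1 + (p + 1), by ring⟩, one_mul]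
  | 5 =>
    rw [bose, boseScalar]
    simp only [bosonTerm, boseIndex, pExp, invD, e2, e4]
    refine toBase_term o ho (M₁ := n + p + 1) (M₂ := n + p + 1) (p := p + 1) (U := n + 1) (by omega)
      (by omega) (by omega) (by omega) (by omega) (by omega) (by omega)
      ?_ ?_ ?_ ?_
    · simp only [boseExp]
      push_cast
      ring
    · simp only [boseExp, baseExp, aExp, Q₂, tri_succ]
      push_cast
      linear_combination t1
    · simp only [boseDeg]
      ring
    · rw [boseDen, Odd.neg_one_pow (n := p + 1 + n + (n + 1) + (p + 1)) ⟨n + (p + 1), by ring⟩, neg_one_mul]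

/-! ### Reindexing and finiteness of the bosonic sum. -/

theorem boseIndex_injective : Function.Injective boseIndex := by
  rintro ⟨s, n, p⟩ ⟨s', n', p'⟩ h
  have key : (boseIndex (s, n, p)).2.2 = s ∧ (boseIndex (s', n', p')).2.2 = s' ∧
      (boseIndex (s, n, p)).2.1 = n ∧ (boseIndex (s', n', p')).2.1 = n' := by
    refine ⟨?_, ?_, ?_, ?_⟩
    · fin_cases s <;> rfl
    · fin_cases s' <;> rfl
    · fin_cases s <;> rfl
    · fin_cases s' <;> rfl
  obtain ⟨h1, h2, h3, h4⟩ := key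
  rw [h] at h1 h3
  obtain rfl : s = s' := h1.symm.trans h2
  obtain rfl : n = n' := h3.symm.trans h4
  have h5 := congrArg Prod.fst h
  have h6 : p = p' := by
    match s with
    | 0 | 1 | 2 | 3 | 4 | 5 => simp only [boseIndex] at h5; omega
  rw [h6]

theorem boseIndex_mem (y : Fin 6 × ℕ × ℕ) : boseIndex y ∈ bosonIndex := by
  obtain ⟨s, n, p⟩ := y
  show (boseIndex (s, n, p)).2.1 ≤ (boseIndex (s, n, p)).1
  match s with
  | 0 | 1 | 2 | 3 | 4 | 5 => simp only [boseIndex]; omega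

/-- Only `m = n` with `s = 4, 5` is missed, and those terms contain `1/(q)_{-1} = 0`. -/
theorem bosonTerm_of_notMem_range (k l₁ l₂ : ℕ) {t : ℕ × ℕ × Fin 6} (ht : t ∈ bosonIndex)
    (hr : t ∉ Set.range boseIndex) : bosonTerm k l₁ l₂ t = 0 := by
  obtain ⟨m, n, s⟩ := t
  obtain ⟨p, rfl⟩ : ∃ p, m = n + p := Nat.exists_eq_add_of_le ht
  have hQ : invQ (((n + 0 : ℕ) : ℤ) - n - 1) = 0 := if_pos (by push_cast; omega)
  match s, p with
  | 0, p => exact (hr ⟨(0, n, p), rfl⟩).elim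
  | 1, p => exact (hr ⟨(1, n, p), rfl⟩).elim
  | 2, p => exact (hr ⟨(2, n, p), rfl⟩).elim
  | 3, p => exact (hr ⟨(3, n, p), rfl⟩).elim
  | 4, p + 1 => exact (hr ⟨(4, n, p), rfl⟩).elim
  | 5, p + 1 => exact (hr ⟨(5, n, p), rfl⟩).elim
  | 4, 0 => simp only [bosonTerm, invD, hQ, mul_zero, zero_mul]
  | 5, 0 => simp only [bosonTerm, invD, hQ, mul_zero, zero_mul]

/-- The coefficients of a term of the bosonic sum of fixed degree in `z₁`. -/
theorem coeff_toBase_bosonTerm (ho : Function.Injective o) (k l₁ l₂ D : ℕ) (y : Fin 6 × ℕ × ℕ) :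
    PowerSeries.coeff D (bose k (l₁ + 1) l₂ (baseQ o) (baseW o) y) =
      o (PowerSeries.mk fun j => MvPowerSeries.coeff (expo D j)
        (bosonTerm k l₁ l₂ (boseIndex y))) := by
  rw [← toBase_bosonTerm o ho, coeff_toBase]

theorem finite_support_slice (ho : Function.Injective o) (k l₁ l₂ D : ℕ) :
    Function.HasFiniteSupport fun y => PowerSeries.mk fun j => MvPowerSeries.coeff (expo D j)
      (bosonTerm k l₁ l₂ (boseIndex y)) := by
  refine Set.Finite.subset
    (finite_support_coeff_bose k (l₁ + 1) l₂ D (baseQ o) (baseW o)) fun y hy h0 => hy ?_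
  refine ho (Eq.trans ?_ (map_zero o).symm)
  rw [← coeff_toBase_bosonTerm o ho]
  exact h0

/-- After the embedding a term is divisible by `z₁` to a power at least `n + p`, so a bounded degree
in `z₁` leaves finitely many indices. -/
theorem finite_boson_support (ho : Function.Injective o) (k l₁ l₂ : ℕ) (e : Fin 2 →₀ ℕ) :
    {t ∈ bosonIndex | MvPowerSeries.coeff e (bosonTerm k l₁ l₂ t) ≠ 0}.Finite := by
  refine Set.Finite.subset ((finite_support_slice o ho k l₁ l₂ (e 0)).image boseIndex) ?_
  rintro t ⟨ht, hne⟩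
  by_cases hr : t ∈ Set.range boseIndex
  · obtain ⟨y, rfl⟩ := hr
    refine ⟨y, fun h0 => hne ?_, rfl⟩
    have := congrArg (PowerSeries.coeff (e 1)) h0
    simp only [PowerSeries.coeff_mk, expo_eq, map_zero] at this
    exact this
  · exact (hne (by rw [bosonTerm_of_notMem_range k l₁ l₂ ht hr, map_zero])).elim

theorem boseSum_eq_chiB (ho : Function.Injective o) (k l₁ l₂ D : ℕ) :
    boseSum k (l₁ + 1) l₂ (baseQ o) (baseW o) D =
      o (PowerSeries.mk fun j => MvPowerSeries.coeff (expo D j) (chiB k l₁ l₂)) := by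
  have hf := finite_support_slice o ho k l₁ l₂ D
  rw [boseSum, finsum_congr (coeff_toBase_bosonTerm o ho k l₁ l₂ D)]
  refine (map_finsum o hf).symm.trans (congrArg o ?_)
  ext1 j
  rw [PowerSeries.coeff_mk]
  show _ = ∑ᶠ t ∈ bosonIndex, MvPowerSeries.coeff (expo D j) (bosonTerm k l₁ l₂ t)
  have h : ∑ᶠ t ∈ bosonIndex, MvPowerSeries.coeff (expo D j) (bosonTerm k l₁ l₂ t) =
      ∑ᶠ t ∈ Set.range boseIndex, MvPowerSeries.coeff (expo D j) (bosonTerm k l₁ l₂ t) := by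
    refine finsum_mem_inter_support_eq' _ _ _ fun t ht => ⟨fun h => ?_, ?_⟩
    · by_contra hr
      exact ht ((congrArg _ (bosonTerm_of_notMem_range k l₁ l₂ h hr)).trans (map_zero _))
    · rintro ⟨y, rfl⟩
      exact boseIndex_mem y
  rw [h, finsum_mem_range boseIndex_injective, map_finsum (PowerSeries.coeff j) hf]
  simp only [PowerSeries.coeff_mk]

end Terms

/-! ### The character satisfies the recursion -/

/-- The coefficient of `z₁^m₁ z₂^m₂` in the character. -/
def charSeries (k l₁ l₂ m₁ m₂ : ℕ) : LaurentSeries ℚ :=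
  HahnSeries.ofPowerSeries ℤ ℚ (PowerSeries.mk fun d => (charCoeff k l₁ l₂ m₁ m₂ (d : ℤ) : ℚ))

theorem coeff_charSeries (k l₁ l₂ m₁ m₂ : ℕ) (d : ℤ) :
    (charSeries k l₁ l₂ m₁ m₂).coeff d = charCoeff k l₁ l₂ m₁ m₂ d := by
  by_cases hd : d < 0
  · rw [charCoeff_of_neg k l₁ l₂ m₁ m₂ hd, Nat.cast_zero, charSeries,
      HahnSeries.ofPowerSeries_apply, HahnSeries.embDomain_of_notMem_range]
    rintro ⟨n, hn⟩
    have : (n : ℤ) = d := hn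
    omega
  · obtain ⟨d, rfl⟩ : ∃ n : ℕ, d = n := ⟨d.toNat, by omega⟩
    rw [charSeries, HahnSeries.ofPowerSeries_apply_coeff, PowerSeries.coeff_mk]

theorem charSeries_of_lt (k l₁ l₂ : ℕ) {m₁ m₂ : ℕ} (h : m₁ < m₂) :
    charSeries k l₁ l₂ m₁ m₂ = 0 := by
  ext d
  rw [coeff_charSeries, charCoeff_of_lt k l₁ l₂ d h, Nat.cast_zero, HahnSeries.coeff_zero]

theorem charSeries_zero_zero {k l₁ l₂ : ℕ} (hl : l₁ + l₂ ≤ k) :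
    charSeries k l₁ l₂ 0 0 = 1 := by
  ext d
  rw [coeff_charSeries, charCoeff_zero_zero hl, HahnSeries.coeff_one]
  split_ifs <;> simp

theorem charSeries_zero_left {k l₂ l₃ : ℕ} (hl : l₂ + l₃ = k) (a b : ℕ) :
    charSeries k 0 l₂ (a + b) b = HahnSeries.single (a : ℤ) 1 * charSeries k l₂ l₃ (b + a) a := by
  ext d
  rw [HahnSeries.coeff_single_mul, one_mul, coeff_charSeries, coeff_charSeries,
    charCoeff_zero_left hl]

theorem charSeries_succ {k l₁ l₂ l₃ : ℕ} (hl : l₁ + 1 + l₂ + l₃ = k) (a b : ℕ) :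
    charSeries k (l₁ + 1) l₂ (a + b) b = charSeries k l₁ (l₂ + 1) (a + b) b +
      if l₁ + 1 ≤ a then HahnSeries.single ((a - (l₁ + 1) : ℕ) : ℤ) 1 *
        charSeries k l₂ l₃ (b + (a - (l₁ + 1))) (a - (l₁ + 1)) else 0 := by
  ext d
  rw [HahnSeries.coeff_add, coeff_charSeries, coeff_charSeries, charCoeff_succ hl]
  split_ifs
  · rw [HahnSeries.coeff_single_mul, one_mul, coeff_charSeries, Nat.cast_add]
  · rw [add_zero, HahnSeries.coeff_zero, add_zero]

section CharSum

variable {K : Type*} [Field K] (o : PowerSeries (LaurentSeries ℚ) →+* K)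

/-- The coefficient of `z₁^D` in the character, with `z₂` replaced by `W`. -/
def charSum (k l₁ l₂ : ℕ) (W : K) (D : ℕ) : K :=
  ∑ x ∈ Finset.HasAntidiagonal.antidiagonal D,
    o (PowerSeries.C (charSeries k l₁ l₂ (x.1 + x.2) x.2)) * W ^ x.2

/-- Exchanging `a = m₁ - m₂` and `b = m₂` together with the factor `q^a` is the substitution
`(z₁,z₂) ↦ (z₁W, q/W)` in degree `D`. -/
theorem sum_single_mul_charSeries (k l₂ l₃ : ℕ) {W : K} (hW : W ≠ 0) (D : ℕ) :
    ∑ x ∈ Finset.HasAntidiagonal.antidiagonal D,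
      o (PowerSeries.C (HahnSeries.single (x.1 : ℤ) 1 * charSeries k l₂ l₃ (x.2 + x.1) x.1)) *
        W ^ x.2 = W ^ D * charSum o k l₂ l₃ (baseQ o / W) D := by
  rw [charSum, ← Finset.Nat.sum_antidiagonal_swap, Finset.mul_sum]
  refine Finset.sum_congr rfl fun x hx => ?_
  rw [← Finset.HasAntidiagonal.mem_antidiagonal.1 hx, map_mul, map_mul, ← baseQ_zpow, zpow_natCast,
    pow_add, div_pow]
  simp only [Prod.fst_swap, Prod.snd_swap]
  field_simp

theorem charSum_zero_left {k l₂ l₃ : ℕ} (hl : l₂ + l₃ = k) {W : K} (hW : W ≠ 0) (D : ℕ) :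
    charSum o k 0 l₂ W D = W ^ D * charSum o k l₂ l₃ (baseQ o / W) D := by
  rw [← sum_single_mul_charSeries o k l₂ l₃ hW, charSum]
  simp only [charSeries_zero_left hl]

theorem charSum_succ_left {k l₁ l₂ l₃ : ℕ} (hl : l₁ + 1 + l₂ + l₃ = k) {W : K} (hW : W ≠ 0)
    (D : ℕ) : charSum o k (l₁ + 1) l₂ W D = charSum o k l₁ (l₂ + 1) W D +
      if l₁ + 1 ≤ D then
        W ^ (D - (l₁ + 1)) * charSum o k l₂ l₃ (baseQ o / W) (D - (l₁ + 1)) else 0 := by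
  rw [charSum, charSum]
  simp only [charSeries_succ hl, map_add, add_mul, Finset.sum_add_distrib]
  congr 1
  have h0 : ∀ x ∈ Finset.HasAntidiagonal.antidiagonal D,
      o (PowerSeries.C (if l₁ + 1 ≤ x.1 then HahnSeries.single ((x.1 - (l₁ + 1) : ℕ) : ℤ) 1 *
        charSeries k l₂ l₃ (x.2 + (x.1 - (l₁ + 1))) (x.1 - (l₁ + 1)) else 0)) * W ^ x.2 =
      if l₁ + 1 ≤ x.1 then o (PowerSeries.C (HahnSeries.single ((x.1 - (l₁ + 1) : ℕ) : ℤ) 1 *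
        charSeries k l₂ l₃ (x.2 + (x.1 - (l₁ + 1))) (x.1 - (l₁ + 1)))) * W ^ x.2 else 0 := by
    intro x _
    split_ifs
    · rfl
    · rw [map_zero, map_zero, zero_mul]
  rw [Finset.sum_congr rfl h0, ← Finset.sum_filter]
  split_ifs with hD
  · rw [Finset.Nat.antidiagonal_filter_le_fst_of_le hD, Finset.sum_map,
      ← sum_single_mul_charSeries o k l₂ l₃ hW]
    refine Finset.sum_congr rfl fun x _ => ?_
    simp
  · refine Finset.sum_eq_zero fun x hx => ?_
    have h1 := Finset.mem_filter.1 hx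
    have h2 := Finset.HasAntidiagonal.mem_antidiagonal.1 h1.1
    omega

theorem isRecursive_charSum (ho : Function.Injective o) (k : ℕ) :
    IsRecursive k (fun b => bif b then baseQ o / baseW o else baseW o)
      (fun b l₁ l₂ => charSum o k l₁ l₂ (bif b then baseQ o / baseW o else baseW o)) := by
  have h := genericPair_base o ho
  have hqw : baseQ o / (baseQ o / baseW o) = baseW o := div_div_cancel₀ h.ne_zero
  refine ⟨fun b l₁ l₂ hl => ?_, fun b l₂ l₃ D hl => ?_, fun b l₁ l₂ l₃ D hl => ?_⟩
  · simp [charSum, charSeries_zero_zero hl]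
  · cases b
    · exact charSum_zero_left o hl h.ne_zero' D
    · have := charSum_zero_left o hl h.symm.ne_zero' D
      rwa [hqw] at this
  · cases b
    · exact charSum_succ_left o hl h.ne_zero' D
    · have := charSum_succ_left o hl h.symm.ne_zero' D
      rwa [hqw] at this

/-- Since components with `m₂ > m₁` vanish, the coefficient of `z₁^D` is a polynomial in `z₂`. This
is why it may also be evaluated at `q/z₂`. -/
theorem charSum_baseW (k l₁ l₂ D : ℕ) :
    charSum o k l₁ l₂ (baseW o) D = o (PowerSeries.mk fun j => charSeries k l₁ l₂ D j) := by
  have h : (PowerSeries.mk fun j => charSeries k l₁ l₂ D j) =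
      ∑ x ∈ Finset.HasAntidiagonal.antidiagonal D,
        PowerSeries.C (charSeries k l₁ l₂ (x.1 + x.2) x.2) * PowerSeries.X ^ x.2 := by
    ext1 j
    rw [PowerSeries.coeff_mk, map_sum]
    simp only [PowerSeries.coeff_C_mul, PowerSeries.coeff_X_pow, mul_ite, mul_one, mul_zero]
    by_cases hj : j ≤ D
    · rw [Finset.sum_eq_single (D - j, j)]
      · simp [Nat.sub_add_cancel hj]
      · rintro ⟨a, b⟩ hx hne
        have := Finset.HasAntidiagonal.mem_antidiagonal.1 hx
        refine if_neg fun hjb => hne ?_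
        ext <;> simp only at * <;> omega
      · intro hn
        exact (hn (Finset.HasAntidiagonal.mem_antidiagonal.2 (Nat.sub_add_cancel hj))).elim
    · rw [charSeries_of_lt k l₁ l₂ (not_le.1 hj), Finset.sum_eq_zero]
      rintro ⟨a, b⟩ hx
      have := Finset.HasAntidiagonal.mem_antidiagonal.1 hx
      refine if_neg fun hjb => ?_
      simp only at *
      omega
  rw [h, map_sum, charSum]
  simp only [map_mul, map_pow, baseW]

end CharSum

theorem charSeries_eq_coeff_chiB {k l₁ l₂ : ℕ} (hl : l₁ + l₂ ≤ k) (m₁ m₂ : ℕ) :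
    charSeries k l₁ l₂ m₁ m₂ = MvPowerSeries.coeff (expo m₁ m₂) (chiB k l₁ l₂) := by
  let o := algebraMap (PowerSeries (LaurentSeries ℚ)) (FractionRing (PowerSeries (LaurentSeries ℚ)))
  have ho : Function.Injective o := IsFractionRing.injective _ _
  have : CharZero (FractionRing (PowerSeries (LaurentSeries ℚ))) :=
    charZero_of_injective_ringHom
      ((o.comp PowerSeries.C).comp (HahnSeries.C : ℚ →+* LaurentSeries ℚ)).injective
  have h := genericPair_base o ho
  have h1 := (isRecursive_charSum o ho k).eq h.toGeneric
    (by simpa using mul_div_cancel₀ (baseQ o) h.ne_zero') (isRecursive_boseSum k h) m₁ false l₁ l₂ hl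
  simp only [cond_false, charSum_baseW, boseSum_eq_chiB o ho] at h1
  have h2 := congrArg (PowerSeries.coeff m₂) (ho h1)
  rwa [PowerSeries.coeff_mk, PowerSeries.coeff_mk] at h2

end SmallPrincipal

end


theorem mainTheorem7 (k l₁ l₂ : ℕ) (h : l₁ + l₂ ≤ k) :
    DirectSum.IsInternal (SmallPrincipal.piece k l₁ l₂) ∧
    (∀ g : ℕ × ℕ × ℤ, FiniteDimensional ℂ (SmallPrincipal.piece k l₁ l₂ g)) ∧
    (∀ e : Fin 2 →₀ ℕ, {t ∈ SmallPrincipal.bosonIndex |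
      MvPowerSeries.coeff e (SmallPrincipal.bosonTerm k l₁ l₂ t) ≠ 0}.Finite) ∧
    ∀ (m₁ m₂ : ℕ) (d : ℤ), (SmallPrincipal.charCoeff k l₁ l₂ m₁ m₂ d : ℚ) =
      (MvPowerSeries.coeff (SmallPrincipal.expo m₁ m₂)
        (SmallPrincipal.chiB k l₁ l₂)).coeff d := by
  refine ⟨SmallPrincipal.isInternal_piece k l₁ l₂, fun g => SmallPrincipal.finite_piece h g,
    SmallPrincipal.finite_boson_support
      (algebraMap (PowerSeries (LaurentSeries ℚ)) (FractionRing (PowerSeries (LaurentSeries ℚ))))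
      (IsFractionRing.injective _ _) k l₁ l₂, fun m₁ m₂ d => ?_⟩
  rw [← SmallPrincipal.charSeries_eq_coeff_chiB h, SmallPrincipal.coeff_charSeries]
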